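/- Let $n\ge 2$ and let $\mathbb{R}^n=\mathbb{R}\times\mathbb{R}^{n-1}$ have coordinates $(t,u_1,\dots,u_{n-1})$. Put $E=\sum_i u_i\partial_{u_i}$ and $\Lambda_{book}=\partial_t\wedge E$. Let $U\subseteq\mathbb{R}^n$ be a nonempty open set such that the projection $p\colon U\to\mathbb{R}^{n-1}$, $(t,u)\mapsto u$, has connected fibers and its image $p(U)$ is star-shaped with respect to $0$. Let $\mathcal{I}=p^{-1}(0)$, regarded as an open interval $\{t : (t,0)\in U\}\subseteq\mathbb{R}$. Let $\mathfrak{X}^k(U)$ be the space of smooth $k$-vector fields on $U$, and let $d_{book}=[\Lambda_{book},\cdot\,]\colon\mathfrak{X}^k(U)\to\mathfrak{X}^{k+1}(U)$ be the Poisson differential, i.e. $$(d_{book}\mu)(df_0,\dots,df_k)=\sum_i(-1)^i\{f_i,\mu(df_0,\dots,\widehat{df_i},\dots,df_k)\}+\sum_{i<j}(-1)^{i+j}\mu(d\{f_i,f_j\},df_0,\dots,\widehat{df_i},\dots,\widehat{df_j},\dots,df_k),$$ where $\{f,g\}=\Lambda_{book}(df,dg)$. Let $H^\bullet_{book}(U)$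 be its cohomology. Let $\mathbb{W}^k$ be the real span of all $k$-fold wedge products of the vector fields $u_i\partial_{u_j}$, $1\le i,j\le n-1$ (so $\mathbb{W}^0=\mathbb{R}$, and $\mathbb{W}^{-1}=0$), and let $$\mathcal{C}^k_{\mathcal{I}}=C^\infty(\mathcal{I})\otimes(\mathbb{W}^{k-1}\oplus\mathbb{W}^k),\qquad \delta(\alpha\oplus\beta)=E\wedge\partial_t\alpha\ \oplus\ (-E\wedge\partial_t\beta).$$ Let $\mathcal{W}^k(U)=\{\mu\in\mathfrak{X}^k(U):\iota_{dt}\mu=0\}$; every $\mu\in\mathfrak{X}^k(U)$ is uniquely of the form $\partial_t\wedge a+b$ with $a\in\mathcal{W}^{k-1}(U)$ and $b\in\mathcal{W}^k(U)$. Let $T^k\colon\mathcal{W}^k(U)\to C^\infty(\mathcal{I})\otimes\mathbb{W}^k$ be the linear map $$\sum_J f_J\,\partial_{u_{j_1}}\wedge\cdots\wedge\partial_{u_{j_k}}\ \mapsto\ \sum_J\frac1{k!}\sum_{(i_1,\dots,i_k)}\frac{\partial^k f_J}{\partial u_{i_1}\cdots\partial u_{i_k}}(t,0)\;u_{i_1}\cdots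 u_{i_k}\,\partial_{u_{j_1}}\wedge\cdots\wedge\partial_{u_{j_k}},$$ where $J=(j_1<\dots<j_k)$ and the inner sum is over all $k$-tuples of indices in $\{1,\dots,n-1\}$. Then $(\mathfrak{X}^\bullet(U),d_{book})$ and $(\mathcal{C}^\bullet_{\mathcal{I}},\delta)$ are cochain complexes, and the map $$\mathcal{T}\colon\mathfrak{X}^\bullet(U)\to\mathcal{C}^\bullet_{\mathcal{I}},\qquad \mathcal{T}(\partial_t\wedge a+b)=T^{k-1}a\oplus T^kb\quad\text{in degree }k,$$ is a morphism of complexes and a quasi-isomorphism. Moreover, $H^n_{book}(U)=0$. -/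

import Mathlib

open scoped ContDiff TensorProduct
open TopologicalSpace CategoryTheory

set_option maxSynthPendingDepth 3

noncomputable section

namespace BookPoisson

/-! ### Smooth maps on open sets -/

section SmoothMaps

variable {E F G : Type} [NormedAddCommGroup E] [NormedSpace ℝ E]
  [NormedAddCommGroup F] [NormedSpace ℝ F] [NormedAddCommGroup G] [NormedSpace ℝ G]

/-- `C^∞(U, F)`: the real vector space of smooth maps `U → F` on an open subset `U` of a normed
space `E`. A smooth map on `U` is stored as the function on `E` that extends it by `0` outside `U`,
so that two elements are equal exactly when they agree on `U`. No regularity at the boundary of `U`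
is required. -/
def SmoothMaps (U : Opens E) (F : Type) [NormedAddCommGroup F] [NormedSpace ℝ F] :
    Submodule ℝ (E → F) where
  carrier := {f | ContDiffOn ℝ ∞ f U ∧ ∀ x ∉ U, f x = 0}
  add_mem' := fun hf hg => ⟨hf.1.add hg.1, fun x hx => by simp [hf.2 x hx, hg.2 x hx]⟩
  zero_mem' := ⟨contDiffOn_const, fun _ _ => rfl⟩
  smul_mem' := fun c _ hf => ⟨contDiffOn_const.smul hf.1, fun x hx => by simp [hf.2 x hx]⟩

/-- The element of `C^∞(U, F)` given by a function that is smooth on `U`. -/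
def SmoothMaps.mk (U : Opens E) (f : E → F) (hf : ContDiffOn ℝ ∞ f U) : SmoothMaps U F :=
  ⟨(U : Set E).indicator f, hf.congr fun _ hx => Set.indicator_of_mem hx f,
    fun _ hx => Set.indicator_of_notMem hx f⟩

theorem SmoothMaps.contDiffOn {U : Opens E} (f : SmoothMaps U F) : ContDiffOn ℝ ∞ f.1 U := f.2.1

theorem SmoothMaps.differentiableAt {U : Opens E} (f : SmoothMaps U F) {x : E} (hx : x ∈ U) :
    DifferentiableAt ℝ f.1 x :=
  (f.2.1.differentiableOn (by simp)).differentiableAt (U.isOpen.mem_nhds hx)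

theorem SmoothMaps.contDiffOn_fderiv {U : Opens E} (f : SmoothMaps U F) :
    ContDiffOn ℝ ∞ (fderiv ℝ f.1) U :=
  f.2.1.fderiv_of_isOpen U.isOpen (by simp)

theorem SmoothMaps.ext {U : Opens E} {f g : SmoothMaps U F} (h : ∀ x ∈ U, f.1 x = g.1 x) :
    f = g := by
  apply Subtype.ext
  funext x
  by_cases hx : x ∈ U
  · exact h x hx
  · rw [f.2.2 x hx, g.2.2 x hx]

theorem SmoothMaps.mk_apply {U : Opens E} {f : E → F} {hf : ContDiffOn ℝ ∞ f U} {x : E}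
    (hx : x ∈ U) : (SmoothMaps.mk U f hf).1 x = f x :=
  Set.indicator_of_mem hx f

theorem SmoothMaps.add_val {U : Opens E} (f g : SmoothMaps U F) : (f + g).1 = f.1 + g.1 := rfl

theorem SmoothMaps.smul_val {U : Opens E} (c : ℝ) (f : SmoothMaps U F) : (c • f).1 = c • f.1 := rfl

theorem SmoothMaps.add_apply {U : Opens E} (f g : SmoothMaps U F) (x : E) :
    (f + g).1 x = f.1 x + g.1 x := rfl

theorem SmoothMaps.smul_apply {U : Opens E} (c : ℝ) (f : SmoothMaps U F) (x : E) :
    (c • f).1 x = c • f.1 x := rfl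

/-- Composition of smooth maps on `U` with a fixed linear map of the values. -/
def SmoothMaps.postcomp (U : Opens E) (L : F →L[ℝ] G) : SmoothMaps U F →ₗ[ℝ] SmoothMaps U G where
  toFun f := ⟨fun x => L (f.1 x), L.contDiff.comp_contDiffOn f.2.1,
    fun x hx => by simp [f.2.2 x hx]⟩
  map_add' f g := Subtype.ext (by funext x; simp)
  map_smul' c f := Subtype.ext (by funext x; simp)

end SmoothMaps

/-! ### Multivectors on `ℝ × ℝ^m` -/

/-- The space `ℝ^n = ℝ × ℝ^(n-1)`, `m = n - 1`, with coordinates `(t, u_1, …, u_m)`. -/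
abbrev Space (m : ℕ) : Type := ℝ × (Fin m → ℝ)

/-- Covectors on `ℝ × ℝ^m`. -/
abbrev Covector (m : ℕ) : Type := Space m →L[ℝ] ℝ

/-- `k`-vectors on `ℝ × ℝ^m`, as alternating `k`-linear functions of covectors. -/
abbrev Multivector (m k : ℕ) : Type := (Covector m) [⋀^Fin k]→L[ℝ] ℝ

variable {m k : ℕ}

/-- The covector `dt`. -/
def dt (m : ℕ) : Covector m := ContinuousLinearMap.fst ℝ ℝ (Fin m → ℝ)

/-- The covector `du_i`. -/
def du (i : Fin m) : Covector m :=
  (ContinuousLinearMap.proj (R := ℝ) (φ := fun _ : Fin m => ℝ) i).comp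
    (ContinuousLinearMap.snd ℝ ℝ (Fin m → ℝ))

/-- The coordinate vector `∂_t`. -/
def ddt (m : ℕ) : Space m := (1, 0)

/-- The coordinate vector `∂_{u_i}`. -/
def ddu (i : Fin m) : Space m := (0, Pi.single i 1)

/-- The Euler vector field `E = ∑ u_i ∂_{u_i}`. -/
def euler (x : Space m) : Space m := (0, x.2)

/-- The `0`-vector `1`. -/
def oneVector (m : ℕ) : Multivector m 0 :=
  ContinuousAlternatingMap.constOfIsEmpty ℝ (Covector m) (Fin 0) (1 : ℝ)

/-- The wedge product `v ∧ μ` of a vector and a `k`-vector: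
`(v ∧ μ)(α_0, …, α_k) = ∑ i, (-1)^i α_i(v) μ(α_0, …, α̂_i, …, α_k)`. -/
def wedge (v : Space m) : Multivector m k →L[ℝ] Multivector m (k + 1) :=
  (ContinuousAlternatingMap.alternatizeUncurryFinCLM ℝ (Covector m) ℝ).comp
    (ContinuousLinearMap.smulRightL ℝ (Covector m) (Multivector m k)
      (ContinuousLinearMap.apply ℝ ℝ v))

theorem wedge_apply (v : Space m) (μ : Multivector m k) (α : Fin (k + 1) → Covector m) :
    wedge v μ α = ∑ i : Fin (k + 1), (-1 : ℝ) ^ (i : ℕ) * (α i v * μ (i.removeNth α)) := by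
  simp [wedge, ContinuousAlternatingMap.alternatizeUncurryFin_apply, zsmul_eq_mul]

/-- The contraction `ι_α μ = μ(α, ⋅, …, ⋅)` of a `(k+1)`-vector with a covector. -/
def contract (α : Covector m) : Multivector m (k + 1) →L[ℝ] Multivector m k :=
  (ContinuousLinearMap.apply ℝ (Multivector m k) α).comp
    (ContinuousAlternatingMap.curryLeftLI (𝕜 := ℝ) (E := Covector m) (F := ℝ)
      (n := k)).toContinuousLinearMap

theorem contract_apply (α : Covector m) (μ : Multivector m (k + 1)) (β : Fin k → Covector m) :
    contract α μ β = μ (Matrix.vecCons α β) := rfl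

/-- A bivector as a bilinear function `(α, β) ↦ λ(α, β)` of covectors. -/
def pairing : Multivector m 2 →L[ℝ] (Covector m →L[ℝ] Covector m →L[ℝ] ℝ) :=
  (ContinuousLinearMap.compL ℝ (Covector m) (Multivector m 1) (Covector m →L[ℝ] ℝ)
    (ContinuousAlternatingMap.ofSubsingletonLIE (𝕜 := ℝ) (E := Covector m) (F := ℝ)
      (0 : Fin 1)).symm.toContinuousLinearEquiv.toContinuousLinearMap).comp
    (ContinuousAlternatingMap.curryLeftLI (𝕜 := ℝ) (E := Covector m) (F := ℝ)
      (n := 1)).toContinuousLinearMap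

theorem pairing_apply (l : Multivector m 2) (α β : Covector m) :
    pairing l α β = l ![α, β] := by
  change l (Matrix.vecCons α fun _ => β) = _
  congr 1
  funext i
  fin_cases i <;> rfl

/-- The map `λ^♯` from covectors to vectors of a bivector `λ`: the vector `λ^♯ α` is characterized
by `β(λ^♯ α) = λ(α, β)` for all covectors `β`. -/
def sharp (l : Multivector m 2) : Covector m →L[ℝ] Space m :=
  ((pairing l).flip (dt m)).prod (ContinuousLinearMap.pi fun i => (pairing l).flip (du i))

theorem apply_sharp (l : Multivector m 2) (α β : Covector m) :
    β (sharp l α) = l ![α, β] := by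
  have hβ : β = β (ddt m) • dt m + ∑ i, β (ddu i) • du i := by
    apply ContinuousLinearMap.coe_injective
    refine LinearMap.prod_ext (LinearMap.ext_ring ?_) (LinearMap.pi_ext' fun i => LinearMap.ext_ring ?_)
    · simp [dt, du, ddt]
    · simp [dt, du, ddu, Pi.single_apply]
  have hx : ∀ x : Space m, β x = β (ddt m) * x.1 + ∑ i, β (ddu i) * x.2 i := by
    intro x
    conv_lhs => rw [hβ]
    simp [dt, du]
  rw [hx, ← pairing_apply]
  conv_rhs => rw [hβ]
  simp [sharp]

/-! ### The Poisson differential -/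

/-- The bilinear map `(α, β) ↦ d(Λ(α, β))` from pairs of constant covector fields to covectors,
where `L` is the derivative at a point of a bivector field `Λ`; that is, the differential
`d{f, g}` at this point of the bracket of two linear functions `f`, `g` with `df = α`, `dg = β`. -/
def bracketDifferential (L : Space m →L[ℝ] Multivector m 2) :
    Covector m →L[ℝ] Covector m →L[ℝ] Covector m :=
  (ContinuousLinearMap.flipₗᵢ ℝ (Space m) (Covector m)
    ℝ).toContinuousLinearEquiv.toContinuousLinearMap.comp (pairing.comp L).flip

theorem bracketDifferential_apply (L : Space m →L[ℝ] Multivector m 2) (α β : Covector m)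
    (v : Space m) : bracketDifferential L α β v = L v ![α, β] := by
  rw [← pairing_apply]; rfl

/-- The part `∑_{i<j} (-1)^(i+j) μ(d{f_i, f_j}, df_0, …, ̂df_i, …, ̂df_j, …, df_k)` of the Poisson
differential of a `k`-vector field with value `μ` at a point, where `f_i` are linear functions and
`L` is the derivative of the bivector field at this point; see `bracketTerm_apply`.
It is `0` for `k = 0`. The double antisymmetrization runs over ordered pairs, so every unordered
pair is counted twice, with sign `-(-1)^(i+j)`; hence the factor `-1/2`. -/
def bracketTerm (L : Space m →L[ℝ] Multivector m 2) :
    {k : ℕ} → Multivector m k → Multivector m (k + 1)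
  | 0, _ => 0
  | k + 1, μ =>
    (-1 / 2 : ℝ) • ContinuousAlternatingMap.alternatizeUncurryFin
      ((ContinuousAlternatingMap.alternatizeUncurryFinCLM ℝ (Covector m) ℝ).comp
        ((ContinuousLinearMap.compL ℝ (Covector m) (Covector m) (Multivector m k)
          μ.curryLeft).comp (bracketDifferential L)))

/-- The value at a point of the Poisson differential `d_Λ μ = [Λ, μ]` of a `k`-vector field, as a
function of the value `l` and the derivative `L` of the bivector field `Λ` and of the value `μ` and
the derivative `D` of the `k`-vector field. It is given by the usual formula
`(d_Λ μ)(df_0, …, df_k) = ∑_i (-1)^i {f_i, μ(df_0, …, ̂df_i, …, df_k)}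
  + ∑_{i<j} (-1)^(i+j) μ(d{f_i, f_j}, df_0, …, ̂df_i, …, ̂df_j, …, df_k)`,
with `{f, g} = Λ(df, dg)`, for linear functions `f_i`; see `poissonValue_apply`. -/
def poissonValue (l : Multivector m 2) (L : Space m →L[ℝ] Multivector m 2)
    (μ : Multivector m k) (D : Space m →L[ℝ] Multivector m k) : Multivector m (k + 1) :=
  ContinuousAlternatingMap.alternatizeUncurryFin (D.comp (sharp l)) + bracketTerm L μ

theorem bracketTerm_apply (L : Space m →L[ℝ] Multivector m 2) (μ : Multivector m (k + 1))
    (α : Fin (k + 2) → Covector m) :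
    bracketTerm L μ α = ∑ i : Fin (k + 1), ∑ j ≥ i, (-1 : ℝ) ^ ((i : ℕ) + (j + 1 : ℕ)) *
      μ (Matrix.vecCons (bracketDifferential L (α i.castSucc) (α j.succ))
        (j.removeNth (i.castSucc.removeNth α))) := by
  have anti : ∀ a b, bracketDifferential L a b = - bracketDifferential L b a := by
    intro a b
    refine ContinuousLinearMap.ext fun v => ?_
    rw [neg_apply, bracketDifferential_apply, bracketDifferential_apply]
    have := (L v).map_swap ![b, a] (i := 0) (j := 1) (by decide)
    refine Eq.trans ?_ this
    change L v ![a, b] = L v (![b, a] ∘ ⇑(Equiv.swap (0 : Fin 2) 1))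
    congr 1
    funext i
    fin_cases i <;> rfl
  simp only [bracketTerm, ContinuousAlternatingMap.smul_apply,
    ContinuousAlternatingMap.alternatizeUncurryFin_alternatizeUncurryFinCLM_comp_apply,
    Finset.smul_sum]
  refine Finset.sum_congr rfl fun i _ => Finset.sum_congr rfl fun j _ => ?_
  have h : ∀ a b, ((ContinuousLinearMap.compL ℝ (Covector m) (Covector m) (Multivector m k)
      μ.curryLeft).comp (bracketDifferential L)) a b
        = μ.curryLeft (bracketDifferential L a b) := fun _ _ => rfl
  rw [h, h, anti (α j.succ), map_neg, ContinuousAlternatingMap.neg_apply,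
    ContinuousAlternatingMap.curryLeft_apply_apply, zsmul_eq_mul, smul_eq_mul]
  push_cast
  ring

theorem poissonValue_apply (l : Multivector m 2) (L : Space m →L[ℝ] Multivector m 2)
    (μ : Multivector m k) (D : Space m →L[ℝ] Multivector m k) (α : Fin (k + 1) → Covector m) :
    poissonValue l L μ D α =
      ∑ i : Fin (k + 1), (-1 : ℝ) ^ (i : ℕ) * D (sharp l (α i)) (i.removeNth α)
        + bracketTerm L μ α := by
  simp [poissonValue, ContinuousAlternatingMap.alternatizeUncurryFin_apply, zsmul_eq_mul]

theorem bracketTerm_add (L : Space m →L[ℝ] Multivector m 2) (μ ν : Multivector m k) :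
    bracketTerm L (μ + ν) = bracketTerm L μ + bracketTerm L ν := by
  cases k with
  | zero => simp [bracketTerm]
  | succ k =>
    ext α
    simp [bracketTerm_apply, mul_add, Finset.sum_add_distrib]

theorem bracketTerm_smul (L : Space m →L[ℝ] Multivector m 2) (c : ℝ) (μ : Multivector m k) :
    bracketTerm L (c • μ) = c • bracketTerm L μ := by
  cases k with
  | zero => simp [bracketTerm]
  | succ k =>
    ext α
    simp [bracketTerm_apply, mul_left_comm, Finset.mul_sum]

theorem poissonValue_add (l : Multivector m 2) (L : Space m →L[ℝ] Multivector m 2)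
    (μ ν : Multivector m k) (D D' : Space m →L[ℝ] Multivector m k) :
    poissonValue l L (μ + ν) (D + D') = poissonValue l L μ D + poissonValue l L ν D' := by
  unfold poissonValue
  rw [bracketTerm_add, ContinuousLinearMap.add_comp,
    ContinuousAlternatingMap.alternatizeUncurryFin_add, add_add_add_comm]

theorem poissonValue_smul (l : Multivector m 2) (L : Space m →L[ℝ] Multivector m 2) (c : ℝ)
    (μ : Multivector m k) (D : Space m →L[ℝ] Multivector m k) :
    poissonValue l L (c • μ) (c • D) = c • poissonValue l L μ D := by
  unfold poissonValue
  rw [bracketTerm_smul, ContinuousLinearMap.smul_comp,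
    ContinuousAlternatingMap.alternatizeUncurryFin_smul, smul_add]

/-- `k`-vector fields on `U`. -/
abbrev MultivectorField (U : Opens (Space m)) (k : ℕ) : Type := SmoothMaps U (Multivector m k)

theorem contDiffOn_poissonValue {U : Opens (Space m)} {Λ : Space m → Multivector m 2}
    (hΛ : ContDiff ℝ ∞ Λ) (μ : MultivectorField U k) :
    ContDiffOn ℝ ∞ (fun x => poissonValue (Λ x) (fderiv ℝ Λ x) (μ.1 x) (fderiv ℝ μ.1 x)) U := by
  have hμ := SmoothMaps.contDiffOn μ
  have hD := SmoothMaps.contDiffOn_fderiv μ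
  have hL : ContDiff ℝ ∞ (fderiv ℝ Λ) := hΛ.fderiv_right (by simp)
  unfold poissonValue
  refine ContDiffOn.add ?_ ?_
  · refine (ContinuousAlternatingMap.alternatizeUncurryFinCLM ℝ (Covector m)
      ℝ).contDiff.comp_contDiffOn (hD.clm_comp ?_)
    refine ContDiff.contDiffOn ?_
    have hp : ∀ α β : Covector m, ContDiff ℝ ∞ fun x => (pairing (Λ x)).flip β α := fun α β => by
      simp only [ContinuousLinearMap.flip_apply, pairing_apply]
      exact (ContinuousAlternatingMap.apply ℝ (Covector m) ℝ ![α, β]).contDiff.comp hΛ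
    rw [contDiff_clm_apply_iff]
    intro α
    exact (hp _ _).prodMk (contDiff_pi.2 fun i => hp _ _)
  · cases k with
    | zero => exact contDiffOn_const
    | succ k =>
      dsimp only [bracketTerm]
      refine ContDiffOn.const_smul _ ?_
      refine (ContinuousAlternatingMap.alternatizeUncurryFinCLM ℝ (Covector m)
        ℝ).contDiff.comp_contDiffOn (contDiffOn_const.clm_comp (ContDiffOn.clm_comp ?_ ?_))
      · exact (ContinuousLinearMap.contDiff _).comp_contDiffOn
          ((ContinuousAlternatingMap.curryLeftLI (𝕜 := ℝ) (E := Covector m) (F := ℝ)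
            (n := k)).contDiff.comp_contDiffOn hμ)
      · refine ContDiff.contDiffOn (contDiff_clm_apply_iff.2 fun α =>
          contDiff_clm_apply_iff.2 fun β => contDiff_clm_apply_iff.2 fun v => ?_)
        simp only [bracketDifferential_apply]
        exact (ContinuousAlternatingMap.apply ℝ (Covector m) ℝ ![α, β]).contDiff.comp
          (hL.clm_apply contDiff_const)

/-- The Poisson differential `d_Λ = [Λ, ⋅] : 𝔛^k(U) → 𝔛^(k+1)(U)` of a bivector field `Λ`. -/
def poissonDifferential (Λ : Space m → Multivector m 2) (hΛ : ContDiff ℝ ∞ Λ)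
    (U : Opens (Space m)) (k : ℕ) : MultivectorField U k →ₗ[ℝ] MultivectorField U (k + 1) where
  toFun μ := SmoothMaps.mk U
    (fun x => poissonValue (Λ x) (fderiv ℝ Λ x) (μ.1 x) (fderiv ℝ μ.1 x))
    (contDiffOn_poissonValue hΛ μ)
  map_add' μ ν := SmoothMaps.ext fun x hx => by
    rw [SmoothMaps.add_apply, SmoothMaps.mk_apply hx, SmoothMaps.mk_apply hx,
      SmoothMaps.mk_apply hx, SmoothMaps.add_apply, SmoothMaps.add_val,
      fderiv_add (SmoothMaps.differentiableAt μ hx) (SmoothMaps.differentiableAt ν hx),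
      poissonValue_add]
  map_smul' c μ := SmoothMaps.ext fun x hx => by
    rw [RingHom.id_apply, SmoothMaps.smul_apply, SmoothMaps.mk_apply hx, SmoothMaps.mk_apply hx,
      SmoothMaps.smul_apply, SmoothMaps.smul_val,
      fderiv_const_smul (SmoothMaps.differentiableAt μ hx), poissonValue_smul]

/-- The book bivector field `Λ_book = ∂_t ∧ E`. -/
def bookBivector (m : ℕ) (x : Space m) : Multivector m 2 :=
  wedge (ddt m) (wedge (euler x) (oneVector m))

theorem contDiff_wedge {F : Type} [NormedAddCommGroup F] [NormedSpace ℝ F] {v : F → Space m}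
    (hv : ContDiff ℝ ∞ v) :
    ContDiff ℝ ∞ fun x => (wedge (v x) : Multivector m k →L[ℝ] Multivector m (k + 1)) := by
  unfold wedge
  refine contDiff_const.clm_comp ?_
  exact (ContinuousLinearMap.contDiff _).comp ((ContinuousLinearMap.contDiff _).comp hv)

theorem contDiff_euler : ContDiff ℝ ∞ (euler : Space m → Space m) :=
  contDiff_const.prodMk contDiff_snd

theorem contDiff_bookBivector : ContDiff ℝ ∞ (bookBivector m) :=
  contDiff_const.clm_apply ((contDiff_wedge contDiff_euler).clm_apply contDiff_const)

/-- The Poisson differential `d_book` of `Λ_book`. -/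
def bookDifferential (U : Opens (Space m)) (k : ℕ) :
    MultivectorField U k →ₗ[ℝ] MultivectorField U (k + 1) :=
  poissonDifferential (bookBivector m) contDiff_bookBivector U k

/-! ### The decomposition `μ = ∂_t ∧ a + b` -/

/-- The contraction `ι_{dt}` of `k`-vectors; the target is read as `0` for `k = 0`. -/
def contractDt : (k : ℕ) → Multivector m k →L[ℝ] Multivector m (k - 1)
  | 0 => 0
  | _ + 1 => contract (dt m)

/-- The map `a ↦ ∂_t ∧ a` from `(k-1)`-vectors to `k`-vectors; it is `0` for `k = 0`. -/
def wedgeDt : (k : ℕ) → Multivector m (k - 1) →L[ℝ] Multivector m k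
  | 0 => 0
  | _ + 1 => wedge (ddt m)

theorem contract_wedge (α : Covector m) (v : Space m) (μ : Multivector m (k + 1)) :
    contract α (wedge v μ) = α v • μ - wedge v (contract α μ) := by
  ext β
  rw [contract_apply, wedge_apply, Fin.sum_univ_succ, ContinuousAlternatingMap.sub_apply,
    wedge_apply, sub_eq_add_neg, ← Finset.sum_neg_distrib]
  congr 1
  · simp
  · refine Finset.sum_congr rfl fun i _ => ?_
    have : i.succ.removeNth (Matrix.vecCons α β) = Matrix.vecCons α (i.removeNth β) := by
      funext j
      refine Fin.cases ?_ (fun j => ?_) j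
      · simp [Fin.removeNth]
      · simp [Fin.removeNth]
    rw [this, contract_apply]
    simp [pow_succ]

theorem contract_wedge_zero (α : Covector m) (v : Space m) (μ : Multivector m 0) :
    contract α (wedge v μ) = α v • μ := by
  ext β
  rw [contract_apply, wedge_apply]
  simp

theorem contractDt_contractDt (μ : Multivector m k) : contractDt (k - 1) (contractDt k μ) = 0 := by
  match k, μ with
  | 0, _ => rfl
  | 1, _ => rfl
  | _ + 2, μ => exact μ.curryLeft_same (dt m)

theorem contractDt_wedgeDt (μ : Multivector m k) :
    contractDt (k + 1) (wedgeDt (k + 1) μ) = μ - wedgeDt k (contractDt k μ) := by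
  match k, μ with
  | 0, μ => simpa [contractDt, wedgeDt, dt, ddt] using contract_wedge_zero (dt m) (ddt m) μ
  | _ + 1, μ => simpa [contractDt, wedgeDt, dt, ddt] using contract_wedge (dt m) (ddt m) μ

/-- `𝒲^k(U)`: the `k`-vector fields `μ` on `U` with `ι_{dt} μ = 0`. -/
def Horizontal (U : Opens (Space m)) (k : ℕ) : Submodule ℝ (MultivectorField U k) :=
  LinearMap.ker (SmoothMaps.postcomp U (contractDt k))

theorem contractDt_sub_wedgeDt (μ : Multivector m k) :
    contractDt k (μ - wedgeDt k (contractDt k μ)) = 0 := by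
  match k, μ with
  | 0, _ => rfl
  | k + 1, μ =>
    have h1 := contractDt_wedgeDt (k := k) (contractDt (k + 1) μ)
    have h2 : contractDt k (contractDt (k + 1) μ) = 0 := contractDt_contractDt μ
    rw [h2, map_zero, sub_zero] at h1
    rw [map_sub, sub_eq_zero]
    exact h1.symm

/-- The part `a ∈ 𝒲^(k-1)(U)` of `μ = ∂_t ∧ a + b`, that is, `a = ι_{dt} μ`. -/
def dtPart (U : Opens (Space m)) (k : ℕ) : MultivectorField U k →ₗ[ℝ] Horizontal U (k - 1) :=
  (SmoothMaps.postcomp U (contractDt k)).codRestrict _ fun μ =>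
    LinearMap.mem_ker.2 (SmoothMaps.ext fun x _ => contractDt_contractDt (μ.1 x))

/-- The part `b ∈ 𝒲^k(U)` of `μ = ∂_t ∧ a + b`, that is, `b = μ - ∂_t ∧ ι_{dt} μ`. -/
def uPart (U : Opens (Space m)) (k : ℕ) : MultivectorField U k →ₗ[ℝ] Horizontal U k :=
  (LinearMap.id - (SmoothMaps.postcomp U (wedgeDt k)).comp
    (SmoothMaps.postcomp U (contractDt k))).codRestrict _ fun μ =>
      LinearMap.mem_ker.2 (SmoothMaps.ext fun x _ => contractDt_sub_wedgeDt (μ.1 x))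

/-- Every `μ` is `∂_t ∧ a + b` for its two parts. -/
theorem wedgeDt_dtPart_add_uPart (U : Opens (Space m)) (k : ℕ) (μ : MultivectorField U k) :
    SmoothMaps.postcomp U (wedgeDt k) (dtPart U k μ).1 + (uPart U k μ).1 = μ := by
  exact add_sub_cancel _ _

/-- The two parts of `∂_t ∧ a + b` are `a` and `b`. -/
theorem parts_wedgeDt_add (U : Opens (Space m)) (k : ℕ) (a : Horizontal U k)
    (b : Horizontal U (k + 1)) :
    dtPart U (k + 1) (SmoothMaps.postcomp U (wedgeDt (k + 1)) a.1 + b.1) = a ∧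
      uPart U (k + 1) (SmoothMaps.postcomp U (wedgeDt (k + 1)) a.1 + b.1) = b := by
  have ha : dtPart U (k + 1) (SmoothMaps.postcomp U (wedgeDt (k + 1)) a.1 + b.1) = a := by
    refine Subtype.ext (SmoothMaps.ext fun x _ => ?_)
    have h1 : contractDt k (a.1.1 x) = 0 := congrFun (congrArg Subtype.val (LinearMap.mem_ker.1 a.2)) x
    have h2 : contractDt (k + 1) (b.1.1 x) = 0 :=
      congrFun (congrArg Subtype.val (LinearMap.mem_ker.1 b.2)) x
    change contractDt (k + 1) (wedgeDt (k + 1) (a.1.1 x) + b.1.1 x) = a.1.1 x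
    rw [map_add, contractDt_wedgeDt, h1, h2]
    simp
  refine ⟨ha, ?_⟩
  have h := wedgeDt_dtPart_add_uPart U (k + 1) (SmoothMaps.postcomp U (wedgeDt (k + 1)) a.1 + b.1)
  rw [ha] at h
  exact Subtype.ext (add_left_cancel h)

/-! ### The spaces `𝕎^k` -/

/-- The field `(u_{I_1} ∂_{u_{J_1}}) ∧ … ∧ (u_{I_k} ∂_{u_{J_k}}) = u_I ∂_J`. -/
def linearWedge : {k : ℕ} → (Fin k → Fin m) → (Fin k → Fin m) → Space m → Multivector m k
  | 0, _, _ => fun _ => oneVector m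
  | _ + 1, I, J => fun x =>
    wedge (x.2 (I 0) • ddu (J 0)) (linearWedge (Fin.tail I) (Fin.tail J) x)

/-- `𝕎^k`, the degree `k` part of `∧^• span_ℝ {u_i ∂_{u_j}}`, as a space of `k`-vector fields: the
span of all `k`-fold wedge products of the vector fields `u_i ∂_{u_j}`. -/
def WW (m k : ℕ) : Submodule ℝ (Space m → Multivector m k) :=
  Submodule.span ℝ (Set.range fun IJ : (Fin k → Fin m) × (Fin k → Fin m) => linearWedge IJ.1 IJ.2)

theorem linearWedge_mem (I J : Fin k → Fin m) : linearWedge I J ∈ WW m k :=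
  Submodule.subset_span ⟨(I, J), rfl⟩

/-- `𝕎^(k-1)`, which is `0` for `k = 0`. -/
def WWPrev (m : ℕ) : (k : ℕ) → Submodule ℝ (Space m → Multivector m (k - 1))
  | 0 => ⊥
  | k + 1 => WW m k

/-- The operator `E ∧ ⋅` on `k`-vector fields on `ℝ × ℝ^m`. -/
def wedgeEulerField (m k : ℕ) :
    (Space m → Multivector m k) →ₗ[ℝ] (Space m → Multivector m (k + 1)) where
  toFun w x := wedge (euler x) (w x)
  map_add' _ _ := by funext x; simp
  map_smul' _ _ := by funext x; simp

theorem wedge_sum_smul (c : Fin m → ℝ) (v : Fin m → Space m) (μ : Multivector m k) :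
    wedge (∑ i, c i • v i) μ = ∑ i, wedge (c i • v i) μ := by
  simp [wedge]

theorem euler_eq_sum (x : Space m) : euler x = ∑ i, x.2 i • ddu i := by
  apply Prod.ext
  · simp [euler, ddu, Prod.fst_sum]
  · funext j
    simp [euler, ddu, Prod.snd_sum, Pi.single_apply]

theorem wedgeEulerField_mem (w : Space m → Multivector m k) (hw : w ∈ WW m k) :
    wedgeEulerField m k w ∈ WW m (k + 1) := by
  suffices WW m k ≤ (WW m (k + 1)).comap (wedgeEulerField m k) from this hw
  refine Submodule.span_le.2 ?_
  rintro _ ⟨⟨I, J⟩, rfl⟩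
  have : wedgeEulerField m k (linearWedge I J) =
      ∑ i : Fin m, linearWedge (Fin.cons i I) (Fin.cons i J) := by
    funext x
    rw [Finset.sum_apply]
    change wedge (euler x) (linearWedge I J x) = _
    rw [euler_eq_sum, wedge_sum_smul]
    rfl
  change wedgeEulerField m k (linearWedge I J) ∈ WW m (k + 1)
  rw [this]
  exact Submodule.sum_mem _ fun i _ => linearWedge_mem _ _

/-- `E ∧ ⋅ : 𝕎^k → 𝕎^(k+1)`. -/
def wedgeEuler (m k : ℕ) : WW m k →ₗ[ℝ] WW m (k + 1) :=
  (wedgeEulerField m k).restrict wedgeEulerField_mem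

/-- `E ∧ ⋅ : 𝕎^(k-1) → 𝕎^k`. -/
def wedgeEulerPrev (m : ℕ) : (k : ℕ) → WWPrev m k →ₗ[ℝ] WWPrev m (k + 1)
  | 0 => 0
  | k + 1 => wedgeEuler m k

/-! ### The complex `C_𝓘` -/

/-- The derivative `∂_t` on `C^∞(𝓘)`. -/
def ddtSmooth (I : Opens ℝ) : SmoothMaps I ℝ →ₗ[ℝ] SmoothMaps I ℝ where
  toFun f := SmoothMaps.mk I (deriv f.1) ((SmoothMaps.contDiffOn f).deriv_of_isOpen I.isOpen (by simp))
  map_add' f g := SmoothMaps.ext fun x hx => by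
    rw [SmoothMaps.add_apply, SmoothMaps.mk_apply hx, SmoothMaps.mk_apply hx,
      SmoothMaps.mk_apply hx]
    exact deriv_add (SmoothMaps.differentiableAt f hx) (SmoothMaps.differentiableAt g hx)
  map_smul' c f := SmoothMaps.ext fun x hx => by
    rw [RingHom.id_apply, SmoothMaps.smul_apply, SmoothMaps.mk_apply hx, SmoothMaps.mk_apply hx]
    exact deriv_const_smul c (SmoothMaps.differentiableAt f hx)

/-- `C^k_𝓘 = C^∞(𝓘) ⊗ (𝕎^(k-1) ⊕ 𝕎^k)`. -/
abbrev ModelCochains (m : ℕ) (I : Opens ℝ) (k : ℕ) : Type :=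
  SmoothMaps I ℝ ⊗[ℝ] (WWPrev m k × WW m k)

/-- The differential `δ(f ⊗ (a ⊕ b)) = f' ⊗ (E ∧ a ⊕ (-E ∧ b))` of `C_𝓘`, that is,
`δ(α ⊕ β) = E ∧ ∂_t α ⊕ (-E ∧ ∂_t β)`. -/
def modelDifferential (m : ℕ) (I : Opens ℝ) (k : ℕ) :
    ModelCochains m I k →ₗ[ℝ] ModelCochains m I (k + 1) :=
  TensorProduct.map (ddtSmooth I) ((wedgeEulerPrev m k).prodMap (-wedgeEuler m k))

/-! ### The map `𝒯` -/

/-- The fiber `p⁻¹(0)` of the projection `p : U → ℝ^m`, as a subset of the `t`-axis. -/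
def axisFiber (U : Opens (Space m)) : Opens ℝ :=
  ⟨{t | ((t, 0) : Space m) ∈ U}, U.isOpen.preimage (by fun_prop)⟩

theorem contDiffOn_taylor (U : Opens (Space m)) (f : Space m → ℝ) (hf : ContDiffOn ℝ ∞ f U)
    (I : Fin k → Fin m) :
    ContDiffOn ℝ ∞ (fun t : ℝ => (k.factorial : ℝ)⁻¹ *
      iteratedFDeriv ℝ k f (t, 0) fun s => ddu (I s)) (axisFiber U) := by
  have h : ContDiffOn ℝ ∞ (iteratedFDeriv ℝ k f) U := by
    intro x hx
    exact ((hf.contDiffAt (U.isOpen.mem_nhds hx)).iteratedFDeriv_right (m := ∞) (i := k)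
      (by exact_mod_cast le_top)).contDiffWithinAt
  have h2 : ContDiffOn ℝ ∞ (fun t : ℝ => iteratedFDeriv ℝ k f (t, 0)) (axisFiber U) :=
    h.comp (g := iteratedFDeriv ℝ k f) (f := fun t : ℝ => ((t, 0) : Space m))
      (contDiff_id.prodMk contDiff_const).contDiffOn (fun t ht => ht)
  exact contDiffOn_const.mul ((ContinuousMultilinearMap.apply ℝ (fun _ : Fin k => Space m) ℝ
    fun s => ddu (I s)).contDiff.comp_contDiffOn h2)

/-- The coefficient `f_J = μ(du_{j_1}, …, du_{j_k})` of `∂_J` in `μ`. -/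
def coefficient (U : Opens (Space m)) (J : Fin k → Fin m) :
    MultivectorField U k →ₗ[ℝ] SmoothMaps U ℝ :=
  SmoothMaps.postcomp U (ContinuousAlternatingMap.apply ℝ (Covector m) ℝ fun s => du (J s))

/-- The function `t ↦ (1/k!) (∂^k f / ∂u_{i_1} ⋯ ∂u_{i_k})(t, 0)` on `𝓘 = p⁻¹(0)`. -/
def taylorCoefficient (U : Opens (Space m)) (I : Fin k → Fin m) :
    SmoothMaps U ℝ →ₗ[ℝ] SmoothMaps (axisFiber U) ℝ where
  toFun f := SmoothMaps.mk (axisFiber U) (fun t => (k.factorial : ℝ)⁻¹ *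
    iteratedFDeriv ℝ k f.1 (t, 0) fun s => ddu (I s)) (contDiffOn_taylor U f.1 (SmoothMaps.contDiffOn f) I)
  map_add' f g := SmoothMaps.ext fun t ht => by
    have hU : (U : Set (Space m)) ∈ nhds ((t, 0) : Space m) := U.isOpen.mem_nhds ht
    have hf := (((SmoothMaps.contDiffOn f).contDiffAt hU).of_le (m := k) (by exact_mod_cast le_top))
    have hg := (((SmoothMaps.contDiffOn g).contDiffAt hU).of_le (m := k) (by exact_mod_cast le_top))
    rw [SmoothMaps.add_apply, SmoothMaps.mk_apply ht, SmoothMaps.mk_apply ht,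
      SmoothMaps.mk_apply ht, SmoothMaps.add_val, iteratedFDeriv_add_apply hf hg, add_apply, mul_add]
  map_smul' c f := SmoothMaps.ext fun t ht => by
    have hU : (U : Set (Space m)) ∈ nhds ((t, 0) : Space m) := U.isOpen.mem_nhds ht
    have hf := (((SmoothMaps.contDiffOn f).contDiffAt hU).of_le (m := k) (by exact_mod_cast le_top))
    rw [RingHom.id_apply, SmoothMaps.smul_apply, SmoothMaps.mk_apply ht, SmoothMaps.mk_apply ht,
      SmoothMaps.smul_val, iteratedFDeriv_const_smul_apply hf, smul_apply, smul_eq_mul,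
      smul_eq_mul, mul_left_comm]

/-- The Taylor operator `T^k : 𝒲^k(U) → C^∞(𝓘) ⊗ 𝕎^k`, which sends `f_J ∂_J`, `J` increasing, to
`∑_{(i_1, …, i_k)} (1/k!) (∂^k f_J / ∂u_{i_1} ⋯ ∂u_{i_k})(t, 0) ⊗ u_{i_1} ⋯ u_{i_k} ∂_J`. -/
def taylor (U : Opens (Space m)) (k : ℕ) :
    Horizontal U k →ₗ[ℝ] SmoothMaps (axisFiber U) ℝ ⊗[ℝ] WW m k :=
  ∑ J : Fin k ↪o Fin m, ∑ I : Fin k → Fin m,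
    ((TensorProduct.mk ℝ (SmoothMaps (axisFiber U) ℝ) (WW m k)).flip
      ⟨linearWedge I J, linearWedge_mem I J⟩) ∘ₗ
        taylorCoefficient U I ∘ₗ coefficient U J ∘ₗ (Horizontal U k).subtype

/-- `T^(k-1) : 𝒲^(k-1)(U) → C^∞(𝓘) ⊗ 𝕎^(k-1)`. -/
def taylorPrev (U : Opens (Space m)) :
    (k : ℕ) → Horizontal U (k - 1) →ₗ[ℝ] SmoothMaps (axisFiber U) ℝ ⊗[ℝ] WWPrev m k
  | 0 => 0
  | k + 1 => taylor U k

/-- The map `𝒯(∂_t ∧ a + b) = T^(k-1) a ⊕ T^k b` in degree `k`. -/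
def bigT (U : Opens (Space m)) (k : ℕ) :
    MultivectorField U k →ₗ[ℝ] ModelCochains m (axisFiber U) k :=
  (LinearMap.inl ℝ (WWPrev m k) (WW m k)).lTensor _ ∘ₗ taylorPrev U k ∘ₗ dtPart U k +
    (LinearMap.inr ℝ (WWPrev m k) (WW m k)).lTensor _ ∘ₗ taylor U k ∘ₗ uPart U k

/-! ### Complexes -/

section Complexes

variable {X Y : ℕ → Type} [∀ k, AddCommGroup (X k)] [∀ k, Module ℝ (X k)]
  [∀ k, AddCommGroup (Y k)] [∀ k, Module ℝ (Y k)]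

/-- The cochain complex `X 0 → X 1 → ⋯` of real vector spaces with the given differentials. -/
def cochainComplex (d : ∀ k, X k →ₗ[ℝ] X (k + 1)) (hd : ∀ k, d (k + 1) ∘ₗ d k = 0) :
    CochainComplex (ModuleCat.{0} ℝ) ℕ :=
  CochainComplex.of (fun k => ModuleCat.of ℝ (X k)) (fun k => ModuleCat.ofHom (d k)) fun k => by
    rw [← ModuleCat.ofHom_comp, hd]
    rfl

/-- The morphism of cochain complexes with the given components. -/
def cochainMap {d : ∀ k, X k →ₗ[ℝ] X (k + 1)} {hd : ∀ k, d (k + 1) ∘ₗ d k = 0}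
    {e : ∀ k, Y k →ₗ[ℝ] Y (k + 1)} {he : ∀ k, e (k + 1) ∘ₗ e k = 0}
    (f : ∀ k, X k →ₗ[ℝ] Y k) (hf : ∀ k, e k ∘ₗ f k = f (k + 1) ∘ₗ d k) :
    cochainComplex d hd ⟶ cochainComplex e he :=
  CochainComplex.ofHom (X := cochainComplex d hd) (Y := cochainComplex e he)
    (fun k => ModuleCat.ofHom (f k)) fun k => by
      simp only [cochainComplex, CochainComplex.of_d]
      rw [← ModuleCat.ofHom_comp, hf, ModuleCat.ofHom_comp]

end Complexes

end BookPoisson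

end

noncomputable section

namespace BookPoisson

/-! ### Smooth dependence of integrals on parameters -/

section ParametricIntegral

open Set MeasureTheory

variable {V F : Type} [NormedAddCommGroup V] [NormedAddCommGroup F]

/-! Write m = n - 1, let ∂_t and E also act on fields by differentiating coefficients, and let b
have degree k. Everything rests on the formula d(∂_t ∧ a + b) = ∂_t ∧ (E ∧ ∂_t a + (E - k) b) - E ∧
∂_t b (`bookDifferential_horizontal`, `bookDifferential_add`). Take Taylor parts in u along the
axis: E - k kills the part of degree k, wedging with E (linear in u) raises the degree by one, and
∂_t passes through. So the formula becomes δ and 𝒯 is a morphism (`modelDifferential_comp_bigT`).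

Three facts of analysis are needed. Division: a horizontal β with E ∧ β = 0 is E ∧ c with c smooth,
the only obstruction being the values on the axis in the top degree m (`exists_wE_eq`); in degree 0
such a β vanishes. Radial equation: on a star-shaped set (E - k) h = g is solvable up to the degree
k Taylor part of g at 0, and solutions of (E - k) q = 0 equal that part (`exists_euler_sub_eq`,
`eq_taylorPart_of_euler_eq`). Primitives: the fibers of p are intervals, so ∂_t is surjective and
its kernel consists of pullbacks from p(U) (`exists_dT_eq`, `exists_pull_eq`).

Surjectivity on cohomology: E ∧ ⋅ is exact on 𝕎 and ∂_t is onto on C^∞(𝓘), so every model cocycle is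
cohomologous to one constant in t. A constant pair w₁ ⊕ w₂ is the image of the cocycle ∂_t ∧ w₁ +
w₂.

Injectivity: let ∂_t ∧ a + b be a cocycle whose image is exact; then E ∧ ⋅ kills its Taylor parts.
The field E ∧ b does not depend on t and is homogeneous, hence equals its Taylor part, which is 0.
Therefore b = E ∧ c, and subtracting dν with ∂_t ν = -c leaves a cocycle ∂_t ∧ a. Now E ∧ a is
independent of t; solving the radial equation along a smooth section of p gives a pullback h such
that E ∧ ⋅ kills a - (E - k) h. This difference is E ∧ ∂_t A, so ∂_t ∧ a = d(h + ∂_t ∧ A).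

For a of degree m the axis obstruction to division is avoided by taking h = -a/m, since a - (E - m)
h = E(a)/m vanishes on the axis. No Taylor condition is used there, and every n-vector field is ∂_t
∧ a, so H^n = 0. -/

theorem continuous_slice {N : Set V} {W : Set (V × ℝ)} {g : V × ℝ → F} (hg : ContinuousOn g W)
    (hNW : ∀ x ∈ N, ∀ s ∈ Icc (0 : ℝ) 1, (x, s) ∈ W) {x : V} (hx : x ∈ N) :
    ContinuousOn (fun s : ℝ => g (x, s)) (Icc 0 1) :=
  hg.comp (by fun_prop) fun s hs => hNW x hx s hs

theorem intervalIntegrable_slice {N : Set V} {W : Set (V × ℝ)} {g : V × ℝ → F}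
    (hg : ContinuousOn g W) (hNW : ∀ x ∈ N, ∀ s ∈ Icc (0 : ℝ) 1, (x, s) ∈ W) {x : V}
    (hx : x ∈ N) : IntervalIntegrable (fun s : ℝ => g (x, s)) volume 0 1 := by
  apply ContinuousOn.intervalIntegrable
  rw [uIcc_of_le zero_le_one]
  exact continuous_slice hg hNW hx

theorem aestronglyMeasurable_slice {N : Set V} {W : Set (V × ℝ)} {g : V × ℝ → F}
    (hg : ContinuousOn g W) (hNW : ∀ x ∈ N, ∀ s ∈ Icc (0 : ℝ) 1, (x, s) ∈ W) {x : V}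
    (hx : x ∈ N) :
    AEStronglyMeasurable (fun s : ℝ => g (x, s)) (volume.restrict (uIoc (0 : ℝ) 1)) :=
  (intervalIntegrable_slice hg hNW hx).def'.aestronglyMeasurable

/-- Compactness of [0, 1] makes the bound at x₀ persist, up to adding 1, on a neighbourhood uniform
in s. It is the dominating constant for differentiation under the integral sign. -/
theorem exists_bound_slice {N : Set V} {W : Set (V × ℝ)} (hN : IsOpen N) (hW : IsOpen W)
    {g : V × ℝ → F} (hg : ContinuousOn g W)
    (hNW : ∀ x ∈ N, ∀ s ∈ Icc (0 : ℝ) 1, (x, s) ∈ W) {x₀ : V} (hx₀ : x₀ ∈ N) :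
    ∃ C : ℝ, ∀ᶠ x in nhds x₀, x ∈ N ∧ ∀ s ∈ Icc (0 : ℝ) 1, ‖g (x, s)‖ ≤ C := by
  obtain ⟨C, hC⟩ := isCompact_Icc.exists_bound_of_continuousOn (continuous_slice hg hNW hx₀)
  refine ⟨C + 1, Filter.Eventually.and (hN.mem_nhds hx₀) ?_⟩
  refine isCompact_Icc.eventually_forall_of_forall_eventually fun s hs => ?_
  have h1 : ContinuousAt (fun z => ‖g z‖) (x₀, s) :=
    (hg.continuousAt (hW.mem_nhds (hNW x₀ hx₀ s hs))).norm
  have h2 := h1.eventually_lt (continuousAt_const (y := C + 1))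
    (lt_of_le_of_lt (hC s hs) (lt_add_one C))
  exact h2.mono fun z hz => hz.le

variable [NormedSpace ℝ V] [NormedSpace ℝ F]

theorem hasFDerivAt_integral_slice {N : Set V} {W : Set (V × ℝ)} (hN : IsOpen N) (hW : IsOpen W)
    {g : V × ℝ → F} (hg : ContDiffOn ℝ 1 g W)
    (hNW : ∀ x ∈ N, ∀ s ∈ Icc (0 : ℝ) 1, (x, s) ∈ W) {x₀ : V} (hx₀ : x₀ ∈ N) :
    HasFDerivAt (fun x => ∫ s in (0 : ℝ)..1, g (x, s))
      (∫ s in (0 : ℝ)..1, (fderiv ℝ g (x₀, s)).comp (ContinuousLinearMap.inl ℝ V ℝ)) x₀ := by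
  have hD : ContinuousOn (fun z => (fderiv ℝ g z).comp (ContinuousLinearMap.inl ℝ V ℝ)) W :=
    (hg.continuousOn_fderiv_of_isOpen hW le_rfl).clm_comp continuousOn_const
  obtain ⟨C, hC⟩ := exists_bound_slice hN hW hD hNW hx₀
  refine intervalIntegral.hasFDerivAt_integral_of_dominated_of_fderiv_le
    (F := fun x s => g (x, s))
    (F' := fun x s => (fderiv ℝ g (x, s)).comp (ContinuousLinearMap.inl ℝ V ℝ))
    (bound := fun _ => C) hC
    ?_ (intervalIntegrable_slice hg.continuousOn hNW hx₀)
    (aestronglyMeasurable_slice hD hNW hx₀) ?_ intervalIntegrable_const ?_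
  · filter_upwards [hN.mem_nhds hx₀] with x hx
    exact aestronglyMeasurable_slice hg.continuousOn hNW hx
  · refine Filter.Eventually.of_forall fun s hs x hx => ?_
    rw [uIoc_of_le zero_le_one] at hs
    exact hx.2 s ⟨hs.1.le, hs.2⟩
  · refine Filter.Eventually.of_forall fun s hs x hx => ?_
    rw [uIoc_of_le zero_le_one] at hs
    have hz := hNW x hx.1 s ⟨hs.1.le, hs.2⟩
    have h1 : HasFDerivAt g (fderiv ℝ g (x, s)) (x, s) :=
      ((hg.differentiableOn one_ne_zero).differentiableAt (hW.mem_nhds hz)).hasFDerivAt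
    exact h1.comp x (hasFDerivAt_prodMk_left x s)

/-- The integral over `[0, 1]` of a smooth function depends smoothly on parameters. -/
theorem contDiffOn_integral [CompleteSpace F] {N : Set V} {W : Set (V × ℝ)} (hN : IsOpen N)
    (hW : IsOpen W) {g : V × ℝ → F} (hg : ContDiffOn ℝ ∞ g W)
    (hNW : ∀ x ∈ N, ∀ s ∈ Icc (0 : ℝ) 1, (x, s) ∈ W) :
    ContDiffOn ℝ ∞ (fun x => ∫ s in (0 : ℝ)..1, g (x, s)) N := by
  rw [contDiffOn_infty]
  intro n
  -- The derivative of the integral is an integral of the same kind with values in V →L F, so the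
  -- value space must vary in the induction.
  induction n generalizing F with
  | zero =>
    rw [Nat.cast_zero, contDiffOn_zero]
    intro x hx
    exact (hasFDerivAt_integral_slice hN hW (hg.of_le (by simp)) hNW
      hx).continuousAt.continuousWithinAt
  | succ n ih =>
    have hD := fun x (hx : x ∈ N) => hasFDerivAt_integral_slice hN hW (hg.of_le (by simp)) hNW hx
    rw [Nat.cast_succ, contDiffOn_succ_iff_fderiv_of_isOpen hN]
    refine ⟨fun x hx => (hD x hx).differentiableAt.differentiableWithinAt, by simp, ?_⟩
    have h := ih (g := fun z => (fderiv ℝ g z).comp (ContinuousLinearMap.inl ℝ V ℝ))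
      ((hg.fderiv_of_isOpen hW (by simp)).clm_comp contDiffOn_const)
    exact h.congr fun x hx => (hD x hx).fderiv

end ParametricIntegral

/-! ### The homogeneous parts of the Taylor expansion -/

section TaylorPart

variable {V F G : Type} [NormedAddCommGroup V] [NormedSpace ℝ V]
  [NormedAddCommGroup F] [NormedSpace ℝ F] [NormedAddCommGroup G] [NormedSpace ℝ G]

/-- The degree `k` part `D^k f(x)(v, …, v) / k!` of the Taylor expansion of `f` at `x`. -/
def taylorPart (k : ℕ) (f : V → F) (x v : V) : F :=
  (k.factorial : ℝ)⁻¹ • iteratedFDeriv ℝ k f x fun _ => v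

theorem taylorPart_zero (f : V → F) (x v : V) : taylorPart 0 f x v = f x := by
  simp [taylorPart]

theorem taylorPart_congr {k : ℕ} {f g : V → F} {x : V} (h : f =ᶠ[nhds x] g) (v : V) :
    taylorPart k f x v = taylorPart k g x v := by
  unfold taylorPart
  rw [h.iteratedFDeriv ℝ k |>.eq_of_nhds]

theorem taylorPart_congr_of_isOpen {k : ℕ} {U : Set V} (hU : IsOpen U) {f g : V → F}
    (h : ∀ y ∈ U, f y = g y) {x : V} (hx : x ∈ U) (v : V) :
    taylorPart k f x v = taylorPart k g x v :=
  taylorPart_congr (Filter.eventually_of_mem (hU.mem_nhds hx) h) v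

theorem taylorPart_comp {k : ℕ} (L : F →L[ℝ] G) {f : V → F} {x : V} (hf : ContDiffAt ℝ ∞ f x)
    (v : V) : taylorPart k (fun y => L (f y)) x v = L (taylorPart k f x v) := by
  unfold taylorPart
  have := L.iteratedFDeriv_comp_left (hf.of_le (m := k) (by exact_mod_cast le_top))
    (i := k) (le_refl _)
  change (k.factorial : ℝ)⁻¹ • iteratedFDeriv ℝ k (L ∘ f) x _ = _
  rw [this]
  simp

theorem taylorPart_add {k : ℕ} {f g : V → F} {x : V} (hf : ContDiffAt ℝ ∞ f x)
    (hg : ContDiffAt ℝ ∞ g x) (v : V) :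
    taylorPart k (fun y => f y + g y) x v = taylorPart k f x v + taylorPart k g x v := by
  unfold taylorPart
  have := iteratedFDeriv_add_apply (hf.of_le (m := k) (by exact_mod_cast le_top))
    (hg.of_le (m := k) (by exact_mod_cast le_top))
  change (k.factorial : ℝ)⁻¹ • iteratedFDeriv ℝ k (f + g) x _ = _
  rw [this, add_apply, smul_add]

/-- Peels off one derivative in D^(k+1) f(v, …, v), with (k+1)! = (k+1) k!. It drives the inductions
on the degree, at the price of replacing F by V →L F. -/
theorem taylorPart_succ_fderiv (k : ℕ) (f : V → F) (x v : V) :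
    taylorPart (k + 1) f x v = ((k : ℝ) + 1)⁻¹ • taylorPart k (fderiv ℝ f) x v v := by
  unfold taylorPart
  rw [iteratedFDeriv_succ_apply_right, Nat.factorial_succ]
  simp only [smul_apply, smul_smul]
  push_cast
  rw [mul_inv]
  rfl

theorem taylorPart_fderiv_apply {k : ℕ} {f : V → F} {x : V} (hf : ContDiffAt ℝ ∞ f x) (v w : V) :
    taylorPart k (fun y => fderiv ℝ f y w) x v = taylorPart k (fderiv ℝ f) x v w :=
  taylorPart_comp (k := k) (ContinuousLinearMap.apply ℝ F w)
    (f := fderiv ℝ f) (x := x) (hf.fderiv_right (by simp)) v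

/-- The variant with the derivative along the fixed vector v, which keeps the value space F. -/
theorem taylorPart_succ {k : ℕ} {f : V → F} {x : V} (hf : ContDiffAt ℝ ∞ f x) (v : V) :
    taylorPart (k + 1) f x v =
      ((k : ℝ) + 1)⁻¹ • taylorPart k (fun y => fderiv ℝ f y v) x v := by
  rw [taylorPart_fderiv_apply hf, taylorPart_succ_fderiv]

theorem taylorPart_smul_const {k : ℕ} {f : V → F} {x : V} (hf : ContDiffAt ℝ ∞ f x) (c : ℝ)
    (v : V) : taylorPart k (fun y => c • f y) x v = c • taylorPart k f x v :=
  taylorPart_comp (c • ContinuousLinearMap.id ℝ F) hf v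

theorem isSymmSndFDerivAt_of_contDiffAt {f : V → F} {x : V} (hf : ContDiffAt ℝ ∞ f x) :
    IsSymmSndFDerivAt ℝ f x :=
  (contDiffAt_infty.1 hf 2).isSymmSndFDerivAt (by simp)

theorem fderiv_fderiv_comm {f : V → F} {x : V} (hf : ContDiffAt ℝ ∞ f x) (v w : V) :
    fderiv ℝ (fun y => fderiv ℝ f y v) x w = fderiv ℝ (fun y => fderiv ℝ f y w) x v := by
  have hd : DifferentiableAt ℝ (fderiv ℝ f) x :=
    (hf.fderiv_right (m := ∞) (by simp)).differentiableAt (by simp)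
  have h : ∀ v w, fderiv ℝ (fun y => fderiv ℝ f y v) x w = fderiv ℝ (fderiv ℝ f) x w v := by
    intro v w
    rw [fderiv_clm_apply hd (by fun_prop)]
    simp
  rw [h, h]
  exact isSymmSndFDerivAt_of_contDiffAt hf w v

theorem contDiffOn_fderiv_apply {f : V → F} {U : Set V} (hU : IsOpen U)
    (hf : ContDiffOn ℝ ∞ f U) (v : V) : ContDiffOn ℝ ∞ (fun y => fderiv ℝ f y v) U :=
  (hf.fderiv_of_isOpen hU (by simp)).clm_apply contDiffOn_const

theorem contDiffOn_taylorPart {f : V → F} {U : Set V} (hU : IsOpen U)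
    (hf : ContDiffOn ℝ ∞ f U) (k : ℕ) (v : V) :
    ContDiffOn ℝ ∞ (fun y => taylorPart k f y v) U := by
  induction k generalizing f with
  | zero => exact hf.congr fun x _ => taylorPart_zero f x v
  | succ k ih =>
    exact ((ih (contDiffOn_fderiv_apply hU hf v)).const_smul ((k : ℝ) + 1)⁻¹).congr
      fun x hx => taylorPart_succ (hf.contDiffAt (hU.mem_nhds hx)) v

/-- The symmetry of second derivatives lets the derivative along w pass through the k derivatives
along v. It is used with w = ∂_t. -/
theorem fderiv_taylorPart {f : V → F} {U : Set V} (hU : IsOpen U)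
    (hf : ContDiffOn ℝ ∞ f U) (k : ℕ) (v w : V) {x : V} (hx : x ∈ U) :
    fderiv ℝ (fun y => taylorPart k f y v) x w = taylorPart k (fun y => fderiv ℝ f y w) x v := by
  induction k generalizing f with
  | zero => simp only [taylorPart_zero]
  | succ k ih =>
    have h1 : (fun y => taylorPart (k + 1) f y v) =ᶠ[nhds x]
        fun y => ((k : ℝ) + 1)⁻¹ • taylorPart k (fun y => fderiv ℝ f y v) y v :=
      Filter.eventually_of_mem (hU.mem_nhds hx) fun y hy =>
        taylorPart_succ (hf.contDiffAt (hU.mem_nhds hy)) v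
    have hv := contDiffOn_fderiv_apply hU hf v
    rw [h1.fderiv_eq, fderiv_fun_const_smul, smul_apply, ih hv,
      taylorPart_succ ((contDiffOn_fderiv_apply hU hf w).contDiffAt (hU.mem_nhds hx)),
      taylorPart_congr_of_isOpen hU
        (fun y hy => fderiv_fderiv_comm (hf.contDiffAt (hU.mem_nhds hy)) v w) hx]
    exact ((contDiffOn_taylorPart hU hv k v).contDiffAt (hU.mem_nhds hx)).differentiableAt
      (by simp)

theorem taylorPart_comp_clm {W : Type} [NormedAddCommGroup W] [NormedSpace ℝ W] (L : V →L[ℝ] W)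
    {f : W → F} {U : Set W} (hU : IsOpen U) (hf : ContDiffOn ℝ ∞ f U) (k : ℕ) {x : V}
    (hx : L x ∈ U) (v : V) :
    taylorPart k (fun y => f (L y)) x v = taylorPart k f (L x) (L v) := by
  induction k generalizing f with
  | zero => simp only [taylorPart_zero]
  | succ k ih =>
    have hx' : x ∈ L ⁻¹' U := hx
    have hU' : IsOpen (L ⁻¹' U) := hU.preimage L.continuous
    have hfL : ContDiffOn ℝ ∞ (fun y => f (L y)) (L ⁻¹' U) :=
      hf.comp L.contDiff.contDiffOn fun y hy => hy
    rw [taylorPart_succ (hfL.contDiffAt (hU'.mem_nhds hx')), taylorPart_succ (hf.contDiffAt (hU.mem_nhds hx)),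
      ← ih (contDiffOn_fderiv_apply hU hf (L v))]
    congr 1
    refine taylorPart_congr_of_isOpen hU' (fun y hy => ?_) hx' v
    have h1 : DifferentiableAt ℝ f (L y) :=
      (hf.contDiffAt (hU.mem_nhds hy)).differentiableAt (by simp)
    have := (h1.hasFDerivAt.comp y L.hasFDerivAt).fderiv
    change fderiv ℝ (f ∘ L) y v = _
    rw [this]
    rfl

/-- The Taylor expansion of the product of a linear function vanishing at `x` and a function. -/
theorem taylorPart_succ_linear_apply (M : V →L[ℝ] F →L[ℝ] G) {b : V → F} {U : Set V}
    (hU : IsOpen U) (hb : ContDiffOn ℝ ∞ b U) (k : ℕ) {x : V} (hx : x ∈ U) (hM : M x = 0) (v : V) :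
    taylorPart (k + 1) (fun y => M y (b y)) x v = M v (taylorPart k b x v) := by
  have hf : ∀ {b : V → F}, ContDiffOn ℝ ∞ b U → ContDiffOn ℝ ∞ (fun y => M y (b y)) U :=
    fun hb => M.contDiff.contDiffOn.clm_apply hb
  have hD : ∀ {b : V → F}, ContDiffOn ℝ ∞ b U → ∀ y ∈ U,
      fderiv ℝ (fun y => M y (b y)) y v = M v (b y) + M y (fderiv ℝ b y v) := by
    intro b hb y hy
    have h1 : DifferentiableAt ℝ b y := (hb.contDiffAt (hU.mem_nhds hy)).differentiableAt (by simp)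
    rw [fderiv_clm_apply M.differentiableAt h1]
    simp [add_comm]
  induction k generalizing b with
  | zero =>
    rw [taylorPart_succ ((hf hb).contDiffAt (hU.mem_nhds hx)), taylorPart_zero, taylorPart_zero,
      hD hb x hx, hM]
    simp
  -- By Leibniz the derivative along v is M v b + M y (∂_v b). Its degree k + 1 part is (1 + (k +
  -- 1)) M v (T^(k+1) b), because T^k(∂_v b) = (k + 1) T^(k+1) b; the factor 1/(k + 2) cancels.
  | succ k ih =>
    have hv := contDiffOn_fderiv_apply hU hb v
    have hMb : ContDiffOn ℝ ∞ (fun y => M v (b y)) U := (M v).contDiff.comp_contDiffOn hb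
    rw [taylorPart_succ ((hf hb).contDiffAt (hU.mem_nhds hx)),
      taylorPart_congr_of_isOpen hU (hD hb) hx,
      taylorPart_add (hMb.contDiffAt (hU.mem_nhds hx))
        ((hf hv).contDiffAt (hU.mem_nhds hx)),
      taylorPart_comp (M v) (hb.contDiffAt (hU.mem_nhds hx)), ih hv,
      taylorPart_succ (f := b) (hb.contDiffAt (hU.mem_nhds hx)), map_smul, ← map_smul, ← map_add,
      ← map_smul]
    congr 1
    have h2 : ((k : ℝ) + 1) ≠ 0 := by positivity
    have h3 : ((k : ℝ) + 1 + 1) ≠ 0 := by positivity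
    rw [← smul_right_inj h3, smul_smul]
    push_cast
    rw [mul_inv_cancel₀ h3, one_smul, smul_smul]
    rw [← smul_right_inj h2, smul_add, smul_smul, smul_smul, mul_inv_cancel₀ h2, one_smul,
      mul_left_comm, mul_inv_cancel₀ h2, mul_one, add_smul, add_smul, add_smul, one_smul]
    abel

/-- Euler's identity for the Taylor expansion. -/
theorem taylorPart_fderiv_euler (e : V →L[ℝ] V) {b : V → F} {U : Set V}
    (hU : IsOpen U) (hb : ContDiffOn ℝ ∞ b U) (k : ℕ) {x v : V} (hx : x ∈ U) (hex : e x = 0)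
    (hev : e v = v) :
    taylorPart k (fun y => fderiv ℝ b y (e y)) x v = (k : ℝ) • taylorPart k b x v := by
  cases k with
  | zero => simp [taylorPart_zero, hex]
  | succ k =>
    -- D b(y)(e y) is the product of the linear function e y with D b, so its degree k + 1 part is
    -- (T^k D b)(v) applied to e v = v.
    have h := taylorPart_succ_linear_apply ((ContinuousLinearMap.apply ℝ F).comp e)
      (b := fderiv ℝ b) hU (hb.fderiv_of_isOpen hU (by simp)) k hx (by simp [hex]) v
    have h2 : ((k : ℝ) + 1) ≠ 0 := by positivity
    rw [taylorPart_succ_fderiv k b, smul_smul]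
    push_cast
    rw [mul_inv_cancel₀ h2, one_smul]
    simpa [hev] using h

end TaylorPart

/-! ### The operators `E - k` on star-shaped open sets -/

section Radial

open Set

variable {V F : Type} [NormedAddCommGroup V] [NormedSpace ℝ V]
  [NormedAddCommGroup F] [NormedSpace ℝ F]

theorem smul_mem_of_starConvex {P : Set V} (hP : StarConvex ℝ 0 P) {u : V} (hu : u ∈ P) {s : ℝ}
    (hs : s ∈ Icc (0 : ℝ) 1) : s • u ∈ P := by
  have := hP hu (sub_nonneg.2 hs.2) hs.1 (sub_add_cancel 1 s)
  simpa using this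

/-- The mean value of `g` over the segment from `0` to `u`. -/
def radialMean (g : V → F) (u : V) : F := ∫ s in (0 : ℝ)..1, g (s • u)

theorem isOpen_radial {P : Set V} (hP : IsOpen P) : IsOpen {z : V × ℝ | z.2 • z.1 ∈ P} :=
  hP.preimage (by fun_prop)

theorem contDiffOn_radial {P : Set V} {g : V → F} (hg : ContDiffOn ℝ ∞ g P) :
    ContDiffOn ℝ ∞ (fun z : V × ℝ => g (z.2 • z.1)) {z : V × ℝ | z.2 • z.1 ∈ P} :=
  hg.comp (contDiff_snd.smul contDiff_fst).contDiffOn fun _ hz => hz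

theorem continuousOn_radial {F : Type} [TopologicalSpace F] {P : Set V} (hPs : StarConvex ℝ 0 P) {g : V → F}
    (hg : ContinuousOn g P) {u : V} (hu : u ∈ P) :
    ContinuousOn (fun s : ℝ => g (s • u)) (Icc 0 1) :=
  hg.comp (by fun_prop) fun _ hs => smul_mem_of_starConvex hPs hu hs

theorem hasDerivAt_radial {P : Set V} (hP : IsOpen P) {g : V → F}
    (hg : ContDiffOn ℝ ∞ g P) {u : V} {s : ℝ} (hu : s • u ∈ P) :
    HasDerivAt (fun s : ℝ => g (s • u)) (fderiv ℝ g (s • u) u) s := by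
  have h1 : HasFDerivAt g (fderiv ℝ g (s • u)) (s • u) :=
    ((hg.contDiffAt (hP.mem_nhds hu)).differentiableAt (by simp)).hasFDerivAt
  have h2 : HasDerivAt (fun s : ℝ => s • u) u s := by
    simpa using (hasDerivAt_id s).smul_const u
  exact h1.comp_hasDerivAt s h2

variable [CompleteSpace F]

theorem contDiffOn_radialMean {P : Set V} (hP : IsOpen P) (hPs : StarConvex ℝ 0 P) {g : V → F}
    (hg : ContDiffOn ℝ ∞ g P) : ContDiffOn ℝ ∞ (radialMean g) P :=
  contDiffOn_integral hP (isOpen_radial hP) (contDiffOn_radial hg)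
    fun _ hu _ hs => smul_mem_of_starConvex hPs hu hs

/-- Hadamard's lemma. -/
theorem radialMean_fderiv_apply {P : Set V} (hP : IsOpen P) (hPs : StarConvex ℝ 0 P) {g : V → F}
    (hg : ContDiffOn ℝ ∞ g P) {u : V} (hu : u ∈ P) :
    radialMean (fderiv ℝ g) u u = g u - g 0 := by
  have hD : ContinuousOn (fderiv ℝ g) P := hg.continuousOn_fderiv_of_isOpen hP (by simp)
  have hc := continuousOn_radial hPs hD hu
  unfold radialMean
  rw [ContinuousLinearMap.intervalIntegral_apply
    (by apply ContinuousOn.intervalIntegrable; rwa [uIcc_of_le zero_le_one])]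
  have := intervalIntegral.integral_eq_sub_of_hasDerivAt_of_le zero_le_one
    (continuousOn_radial hPs hg.continuousOn hu)
    (fun s hs => hasDerivAt_radial hP hg
      (smul_mem_of_starConvex hPs hu (Ioo_subset_Icc_self hs)))
    (by
      apply ContinuousOn.intervalIntegrable
      rw [uIcc_of_le zero_le_one]
      exact hc.clm_apply continuousOn_const)
  simpa using this

/-- The operator `E + 1` inverts the radial mean. -/
theorem fderiv_radialMean {P : Set V} (hP : IsOpen P) (hPs : StarConvex ℝ 0 P) {g : V → F}
    (hg : ContDiffOn ℝ ∞ g P) {u : V} (hu : u ∈ P) :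
    fderiv ℝ (radialMean g) u u + radialMean g u = g u := by
  have hmem : ∀ x ∈ P, ∀ s ∈ Icc (0 : ℝ) 1, (x, s) ∈ {z : V × ℝ | z.2 • z.1 ∈ P} :=
    fun x hx s hs => smul_mem_of_starConvex hPs hx hs
  have hG := contDiffOn_radial hg
  have h1 := (hasFDerivAt_integral_slice hP (isOpen_radial hP) (hG.of_le (by simp)) hmem hu).fderiv
  have hc : ContinuousOn (fun z => (fderiv ℝ (fun z : V × ℝ => g (z.2 • z.1)) z).comp
      (ContinuousLinearMap.inl ℝ V ℝ)) {z : V × ℝ | z.2 • z.1 ∈ P} :=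
    (hG.continuousOn_fderiv_of_isOpen (isOpen_radial hP) (by simp)).clm_comp continuousOn_const
  change fderiv ℝ (fun u => ∫ s in (0 : ℝ)..1, g (s • u)) u u + ∫ s in (0 : ℝ)..1, g (s • u) = _
  have hi := intervalIntegrable_slice hc hmem hu
  have hi2 : IntervalIntegrable (fun s => (fderiv ℝ (fun z : V × ℝ => g (z.2 • z.1)) (u, s)).comp
      (ContinuousLinearMap.inl ℝ V ℝ) u) MeasureTheory.volume 0 1 :=
    intervalIntegrable_slice (hc.clm_apply continuousOn_const) hmem hu
  have hi' := intervalIntegrable_slice hG.continuousOn hmem hu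
  rw [h1, ContinuousLinearMap.intervalIntegral_apply hi,
    ← intervalIntegral.integral_add hi2 hi']
  have h2 : ∀ s ∈ Ioo (0 : ℝ) 1, HasDerivAt (fun s : ℝ => s • g (s • u))
      ((fderiv ℝ (fun z : V × ℝ => g (z.2 • z.1)) (u, s)).comp (ContinuousLinearMap.inl ℝ V ℝ) u
        + g (s • u)) s := by
    intro s hs
    have hsu := smul_mem_of_starConvex hPs hu (Ioo_subset_Icc_self hs)
    have h3 : HasDerivAt (fun s : ℝ => s • g (s • u))
        (s • fderiv ℝ g (s • u) u + (1 : ℝ) • g (s • u)) s :=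
      (hasDerivAt_id s).smul (hasDerivAt_radial hP hg hsu)
    have h4 : HasFDerivAt g (fderiv ℝ g (s • u)) (s • u) :=
      ((hg.contDiffAt (hP.mem_nhds hsu)).differentiableAt (by simp)).hasFDerivAt
    have h5 : DifferentiableAt ℝ (fun z : V × ℝ => g (z.2 • z.1)) (u, s) :=
      (hG.contDiffAt ((isOpen_radial hP).mem_nhds hsu)).differentiableAt (by simp)
    have h6 : HasFDerivAt (fun x : V => g (s • x))
        ((fderiv ℝ (fun z : V × ℝ => g (z.2 • z.1)) (u, s)).comp (ContinuousLinearMap.inl ℝ V ℝ))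
        u := by
      have h : HasFDerivAt (fun x : V => (x, s)) (ContinuousLinearMap.inl ℝ V ℝ) u :=
        hasFDerivAt_prodMk_left u s
      exact h5.hasFDerivAt.comp u h
    have h7 := h4.comp u ((hasFDerivAt_id u).const_smul s)
    have h8 := congrArg (fun L => L u) (h6.unique h7)
    rw [h8]
    simpa using h3
  have := intervalIntegral.integral_eq_sub_of_hasDerivAt_of_le zero_le_one
    (continuousOn_id.smul (continuousOn_radial hPs hg.continuousOn hu)) h2
    ((hi2).add hi')
  simpa using this

/-- The equation `(E - k) h = g` is solvable up to the degree `k` part of `g` at `0`. -/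
theorem exists_euler_sub_eq {P : Set V} (hP : IsOpen P) (hPs : StarConvex ℝ 0 P) (k : ℕ)
    {g : V → F} (hg : ContDiffOn ℝ ∞ g P) :
    ∃ h : V → F, ContDiffOn ℝ ∞ h P ∧
      ∀ u ∈ P, fderiv ℝ h u u - (k : ℝ) • h u = g u - taylorPart k g 0 u := by
  induction k generalizing F with
  | zero =>
    have h1 := contDiffOn_radialMean hP hPs (hg.fderiv_of_isOpen hP (m := ∞) (by simp))
    have h2 := contDiffOn_radialMean hP hPs h1
    -- Let R be the radial mean. Hadamard gives g - g(0) = R(Dg)(u) u, and E(H(u) u) = ((E + 1)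
    -- H)(u) u. Since E + 1 inverts R, H = R(R(Dg)) works.
    refine ⟨fun u => radialMean (radialMean (fderiv ℝ g)) u u, h2.clm_apply contDiffOn_id,
      fun u hu => ?_⟩
    rw [fderiv_clm_apply ((h2.contDiffAt (hP.mem_nhds hu)).differentiableAt (by simp))
      differentiableAt_fun_id, taylorPart_zero, ← radialMean_fderiv_apply hP hPs hg hu,
      ← fderiv_radialMean hP hPs h1 hu]
    simp [add_comm]
  | succ k ih =>
    obtain ⟨H, hH, hHe⟩ := ih (hg.fderiv_of_isOpen hP (m := ∞) (by simp))
    have hk : ((k : ℝ) + 1) ≠ 0 := by positivity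
    -- With (E - k) H = Dg - T^k(Dg), the operator E - (k + 1) sends H(u) u to E g - (k + 1) T^(k+1)
    -- g. Subtracting its value on g itself leaves (k + 1)(g - T^(k+1) g).
    refine ⟨fun u => ((k : ℝ) + 1)⁻¹ • (H u u - g u),
      ((hH.clm_apply contDiffOn_id).sub hg).const_smul _, fun u hu => ?_⟩
    have hHd : DifferentiableAt ℝ H u := (hH.contDiffAt (hP.mem_nhds hu)).differentiableAt (by simp)
    have hgd : DifferentiableAt ℝ g u := (hg.contDiffAt (hP.mem_nhds hu)).differentiableAt (by simp)
    have hHd' : DifferentiableAt ℝ (fun u => H u u) u := hHd.clm_apply differentiableAt_fun_id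
    rw [fderiv_fun_const_smul (hHd'.fun_sub hgd), fderiv_fun_sub hHd' hgd,
      fderiv_clm_apply hHd differentiableAt_fun_id, taylorPart_succ_fderiv]
    have h := congrArg (fun L => L u) (hHe u hu)
    simp only [sub_apply, smul_apply] at h
    have h' : fderiv ℝ H u u u = fderiv ℝ g u u - taylorPart k (fderiv ℝ g) 0 u u
        + (k : ℝ) • H u u := by rw [← h]; abel
    rw [← smul_right_inj hk]
    simp only [smul_sub, smul_smul, smul_apply, sub_apply, add_apply]
    push_cast
    simp only [mul_inv_cancel₀ hk, one_smul]
    simp [h', add_smul]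
    abel

/-- A smooth function which is homogeneous of degree `k` is its degree `k` part at `0`. -/
theorem eq_taylorPart_of_euler_eq {P : Set V} (hP : IsOpen P) (hPs : StarConvex ℝ 0 P) (k : ℕ)
    {q : V → F} (hq : ContDiffOn ℝ ∞ q P) (hqe : ∀ u ∈ P, fderiv ℝ q u u = (k : ℝ) • q u)
    {u : V} (hu : u ∈ P) : q u = taylorPart k q 0 u := by
  induction k generalizing F u with
  | zero =>
    -- For degree 0 the equation at s u reads s D q(s u) u = 0, so q is constant on the ray from 0
    -- to u.
    have h2 : ∀ s ∈ Ioo (0 : ℝ) 1, HasDerivAt (fun s : ℝ => q (s • u)) 0 s := by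
      intro s hs
      have hsu := smul_mem_of_starConvex hPs hu (Ioo_subset_Icc_self hs)
      have h3 := hasDerivAt_radial hP hq hsu
      have h4 := hqe _ hsu
      rw [map_smul, Nat.cast_zero, zero_smul, smul_eq_zero] at h4
      rwa [h4.resolve_left hs.1.ne'] at h3
    have := intervalIntegral.integral_eq_sub_of_hasDerivAt_of_le zero_le_one
      (continuousOn_radial hPs hq.continuousOn hu) h2 (by simp)
    rw [taylorPart_zero]
    simpa [sub_eq_zero, eq_comm] using this
  | succ k ih =>
    have hk : ((k : ℝ) + 1) ≠ 0 := by positivity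
    have hD : ContDiffOn ℝ ∞ (fderiv ℝ q) P := hq.fderiv_of_isOpen hP (by simp)
    -- Differentiating Euler's relation for q lowers the degree of homogeneity by one. Symmetry of
    -- D²q identifies the derivative of D q along u.
    have hDe : ∀ u ∈ P, fderiv ℝ (fderiv ℝ q) u u = (k : ℝ) • fderiv ℝ q u := by
      intro u hu
      have hd : DifferentiableAt ℝ (fderiv ℝ q) u :=
        (hD.contDiffAt (hP.mem_nhds hu)).differentiableAt (by simp)
      have hd' : DifferentiableAt ℝ q u :=
        (hq.contDiffAt (hP.mem_nhds hu)).differentiableAt (by simp)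
      have he : (fun u => fderiv ℝ q u u) =ᶠ[nhds u] fun u => ((k + 1 : ℕ) : ℝ) • q u :=
        Filter.eventually_of_mem (hP.mem_nhds hu) hqe
      have h := he.fderiv_eq (𝕜 := ℝ)
      rw [fderiv_clm_apply hd differentiableAt_fun_id, fderiv_fun_const_smul hd'] at h
      ext v
      have h' := congrArg (fun L => L v) h
      have hs : fderiv ℝ (fderiv ℝ q) u u v = fderiv ℝ (fderiv ℝ q) u v u :=
        isSymmSndFDerivAt_of_contDiffAt (hq.contDiffAt (hP.mem_nhds hu)) u v
      rw [hs]
      simp [add_smul] at h'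
      simpa [add_comm] using h'
    have h1 := ih hD hDe hu
    have h2 := hqe u hu
    rw [taylorPart_succ_fderiv, ← h1, h2]
    push_cast
    rw [smul_smul, inv_mul_cancel₀ hk, one_smul]

end Radial

/-! ### Algebra of multivectors -/

section Multivectors

variable {m k : ℕ}

/-- The wedge product as a continuous bilinear map. -/
def wedgeL (m k : ℕ) : Space m →L[ℝ] Multivector m k →L[ℝ] Multivector m (k + 1) :=
  (ContinuousLinearMap.compL ℝ (Multivector m k) (Covector m →L[ℝ] Multivector m k)
    (Multivector m (k + 1))
    (ContinuousAlternatingMap.alternatizeUncurryFinCLM ℝ (Covector m) ℝ)).comp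
    ((ContinuousLinearMap.smulRightL ℝ (Covector m) (Multivector m k)).comp
      (ContinuousLinearMap.apply ℝ ℝ))

theorem wedgeL_apply (v : Space m) : wedgeL m k v = wedge v := rfl

theorem wedge_add_left (v w : Space m) (μ : Multivector m k) :
    wedge (v + w) μ = wedge v μ + wedge w μ := by
  simp only [← wedgeL_apply, map_add, add_apply]

theorem wedge_smul_left (c : ℝ) (v : Space m) (μ : Multivector m k) :
    wedge (c • v) μ = c • wedge v μ := by
  simp only [← wedgeL_apply, map_smul, smul_apply]

theorem wedge_zero_left (μ : Multivector m k) : wedge (0 : Space m) μ = 0 := by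
  simp only [← wedgeL_apply, map_zero, zero_apply]

/-- The projection `(t, u) ↦ (0, u)` underlying the Euler vector field. -/
def eulerL (m : ℕ) : Space m →L[ℝ] Space m :=
  (ContinuousLinearMap.inr ℝ ℝ (Fin m → ℝ)).comp (ContinuousLinearMap.snd ℝ ℝ (Fin m → ℝ))

theorem contract_add_left (α β : Covector m) (μ : Multivector m (k + 1)) :
    contract (α + β) μ = contract α μ + contract β μ :=
  map_add μ.curryLeft α β

theorem contract_smul_left (c : ℝ) (α : Covector m) (μ : Multivector m (k + 1)) :
    contract (c • α) μ = c • contract α μ :=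
  map_smul μ.curryLeft c α

theorem contract_sum_left {ι : Type} (s : Finset ι) (α : ι → Covector m)
    (μ : Multivector m (k + 1)) : contract (∑ i ∈ s, α i) μ = ∑ i ∈ s, contract (α i) μ :=
  map_sum μ.curryLeft α s

theorem ext_contract {μ ν : Multivector m (k + 1)} (h : ∀ α, contract α μ = contract α ν) :
    μ = ν := by
  ext β
  have := congrArg (fun ξ => ξ (Fin.tail β)) (h (β 0))
  simp only [contract_apply] at this
  have hβ : Matrix.vecCons (β 0) (Fin.tail β) = β := Fin.cons_self_tail β
  rwa [hβ] at this

/-- Contracting with any α, the Leibniz rule gives α(v) v ∧ μ twice with opposite signs, plus v ∧ v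
∧ ι_α μ of lower degree. -/
theorem wedge_wedge_self (v : Space m) (μ : Multivector m k) : wedge v (wedge v μ) = 0 := by
  induction k with
  | zero =>
    refine ext_contract fun α => ?_
    rw [contract_wedge, contract_wedge_zero, map_smul, sub_self, map_zero]
  | succ k ih =>
    refine ext_contract fun α => ?_
    rw [contract_wedge, contract_wedge, map_sub, ih, map_smul, sub_zero, sub_self, map_zero]

theorem wedge_wedge_comm (v w : Space m) (μ : Multivector m k) :
    wedge v (wedge w μ) = -wedge w (wedge v μ) := by
  have h := wedge_wedge_self (v + w) μ
  simp only [wedge_add_left, map_add, wedge_wedge_self, zero_add, add_zero] at h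
  exact eq_neg_of_add_eq_zero_right h

theorem covector_eq_sum (α : Covector m) :
    α = α (ddt m) • dt m + ∑ i, α (ddu i) • du i := by
  apply ContinuousLinearMap.coe_injective
  refine LinearMap.prod_ext (LinearMap.ext_ring ?_)
    (LinearMap.pi_ext' fun i => LinearMap.ext_ring ?_)
  · simp [dt, du, ddt]
  · simp [dt, du, ddu, Pi.single_apply]

theorem alternatize_smulRight (v : Space m) (μ : Multivector m k) :
    ContinuousAlternatingMap.alternatizeUncurryFinCLM ℝ (Covector m) ℝ
      ((ContinuousLinearMap.apply ℝ ℝ v).smulRight μ) = wedge v μ := rfl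

theorem alternatize_curryLeft (μ : Multivector m (k + 1)) :
    ContinuousAlternatingMap.alternatizeUncurryFinCLM ℝ (Covector m) ℝ μ.curryLeft =
      ((k : ℝ) + 1) • μ := by
  have := ContinuousAlternatingMap.alternatizeUncurryFin_curryLeft μ
  rw [ContinuousAlternatingMap.alternatizeUncurryFinCLM_apply, this]
  ext β
  simp [add_mul]

theorem curryLeft_apply_eq_contract (μ : Multivector m (k + 1)) (α : Covector m) :
    μ.curryLeft α = contract α μ := rfl

/-- The number operator. -/
theorem sum_wedge_contract (μ : Multivector m (k + 1)) :
    wedge (ddt m) (contract (dt m) μ) + ∑ i, wedge (ddu i) (contract (du i) μ) =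
      ((k : ℝ) + 1) • μ := by
  rw [← alternatize_curryLeft]
  simp only [← alternatize_smulRight, ← map_sum, ← map_add]
  congr 1
  ext1 α
  conv_rhs => rw [curryLeft_apply_eq_contract, covector_eq_sum α]
  rw [contract_add_left, contract_smul_left, contract_sum_left]
  simp [contract_smul_left]

/-! ### The book differential in terms of `∂_t` and `E` -/

theorem bookBivector_apply (x : Space m) (α β : Covector m) :
    bookBivector m x ![α, β] = α (ddt m) * β (euler x) - α (euler x) * β (ddt m) := by
  have h : ∀ (v : Space m) (γ : Fin 1 → Covector m), wedge v (oneVector m) γ = γ 0 v := by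
    intro v γ
    rw [wedge_apply]
    simp [oneVector]
  rw [bookBivector, wedge_apply, Fin.sum_univ_two, h, h]
  simp [Fin.removeNth, sub_eq_add_neg, mul_comm]

theorem sharp_bookBivector (x : Space m) (α : Covector m) :
    sharp (bookBivector m x) α = α (ddt m) • euler x - α (euler x) • ddt m := by
  have h : ∀ β : Covector m, β (sharp (bookBivector m x) α) =
      β (α (ddt m) • euler x - α (euler x) • ddt m) := by
    intro β
    rw [apply_sharp, bookBivector_apply]
    simp
  refine Prod.ext (h (dt m)) (funext fun i => h (du i))

/-- The book bivector field as a linear map. -/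
def bookBivectorL (m : ℕ) : Space m →L[ℝ] Multivector m 2 :=
  (wedge (ddt m)).comp (((wedgeL m 0).flip (oneVector m)).comp (eulerL m))

theorem fderiv_bookBivector (x : Space m) : fderiv ℝ (bookBivector m) x = bookBivectorL m :=
  (bookBivectorL m).fderiv

/-- Λ_book has linear coefficients, so linear functions are closed under the bracket; this is the
resulting Lie bracket on covectors. -/
theorem bracketDifferential_book (α β : Covector m) :
    bracketDifferential (bookBivectorL m) α β = α (ddt m) • β - β (ddt m) • α := by
  refine ContinuousLinearMap.ext fun v => ?_
  rw [bracketDifferential_apply]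
  change bookBivector m v ![α, β] = _
  have hv : v = v.1 • ddt m + euler v := by
    apply Prod.ext <;> simp [ddt, euler]
  rw [bookBivector_apply]
  simp only [sub_apply, smul_apply, smul_eq_mul]
  conv_rhs => rw [hv, map_add, map_add, map_smul, map_smul]
  simp only [smul_eq_mul]
  ring

theorem bracketTerm_book (μ : Multivector m k) :
    bracketTerm (bookBivectorL m) μ = -((k : ℝ) • wedge (ddt m) μ) := by
  cases k with
  | zero => simp [bracketTerm]
  | succ k =>
    -- For fixed α, alternating β ↦ α(∂_t) ι_β μ - β(∂_t) ι_α μ gives α(∂_t)(k + 1) μ - ∂_t ∧ ι_α μ,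
    -- which is k α(∂_t) μ + ι_α(∂_t ∧ μ). Alternating over α then yields (k + (k + 2)) ∂_t ∧ μ, and
    -- the factor -1/2 makes it -(k + 1) ∂_t ∧ μ.
    have h1 : (ContinuousAlternatingMap.alternatizeUncurryFinCLM ℝ (Covector m) ℝ).comp
        ((ContinuousLinearMap.compL ℝ (Covector m) (Covector m) (Multivector m k)
          μ.curryLeft).comp (bracketDifferential (bookBivectorL m))) =
        (k : ℝ) • (ContinuousLinearMap.apply ℝ ℝ (ddt m)).smulRight μ +
          (wedge (ddt m) μ).curryLeft := by
      ext1 α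
      have h2 : (ContinuousLinearMap.compL ℝ (Covector m) (Covector m) (Multivector m k)
          μ.curryLeft) (bracketDifferential (bookBivectorL m) α) =
          α (ddt m) • μ.curryLeft -
            (ContinuousLinearMap.apply ℝ ℝ (ddt m)).smulRight (contract α μ) := by
        ext1 β
        change μ.curryLeft (bracketDifferential (bookBivectorL m) α β) = _
        rw [bracketDifferential_book, map_sub, map_smul, map_smul]
        rfl
      change ContinuousAlternatingMap.alternatizeUncurryFinCLM ℝ (Covector m) ℝ
        ((ContinuousLinearMap.compL ℝ (Covector m) (Covector m) (Multivector m k)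
          μ.curryLeft) (bracketDifferential (bookBivectorL m) α)) = _
      rw [h2, map_sub, map_smul, alternatize_curryLeft, alternatize_smulRight, add_apply,
        curryLeft_apply_eq_contract, contract_wedge]
      simp only [smul_apply, ContinuousLinearMap.smulRight_apply, ContinuousLinearMap.apply_apply]
      module
    rw [bracketTerm, h1, ← ContinuousAlternatingMap.alternatizeUncurryFinCLM_apply, map_add,
      map_smul, alternatize_smulRight, alternatize_curryLeft]
    push_cast
    module

/-- The derivative term contributes ∂_t ∧ D(E) - E ∧ D(∂_t), because Λ^♯ α = α(∂_t) E - α(E) ∂_t.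
The bracket term contributes -k ∂_t ∧ μ. -/
theorem poissonValue_book (x : Space m) (μ : Multivector m k) (D : Space m →L[ℝ] Multivector m k) :
    poissonValue (bookBivector m x) (fderiv ℝ (bookBivector m) x) μ D =
      wedge (ddt m) (D (euler x) - (k : ℝ) • μ) - wedge (euler x) (D (ddt m)) := by
  have h : D.comp (sharp (bookBivector m x)) =
      (ContinuousLinearMap.apply ℝ ℝ (ddt m)).smulRight (D (euler x)) -
        (ContinuousLinearMap.apply ℝ ℝ (euler x)).smulRight (D (ddt m)) := by
    ext1 α
    change D (sharp (bookBivector m x) α) = _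
    rw [sharp_bookBivector, map_sub, map_smul, map_smul]
    rfl
  rw [poissonValue, fderiv_bookBivector, bracketTerm_book, h,
    ← ContinuousAlternatingMap.alternatizeUncurryFinCLM_apply, map_sub, alternatize_smulRight,
    alternatize_smulRight, map_sub, map_smul]
  abel

theorem bookDifferential_apply {U : Opens (Space m)} (μ : MultivectorField U k) {x : Space m}
    (hx : x ∈ U) :
    (bookDifferential U k μ).1 x =
      wedge (ddt m) (fderiv ℝ μ.1 x (euler x) - (k : ℝ) • μ.1 x) -
        wedge (euler x) (fderiv ℝ μ.1 x (ddt m)) := by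
  rw [← poissonValue_book]
  exact SmoothMaps.mk_apply (hf := contDiffOn_poissonValue contDiff_bookBivector μ) hx

end Multivectors

/-! ### Operators on multivector fields -/

section Operators

variable {m k : ℕ} {U : Opens (Space m)}
  {F G : Type} [NormedAddCommGroup F] [NormedSpace ℝ F] [NormedAddCommGroup G] [NormedSpace ℝ G]

theorem SmoothMaps.contDiffAt (f : SmoothMaps U F) {x : Space m} (hx : x ∈ U) :
    ContDiffAt ℝ ∞ f.1 x := (SmoothMaps.contDiffOn f).contDiffAt (U.isOpen.mem_nhds hx)

/-- The derivative of vector-valued functions on `U` along a smooth vector field. -/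
def along (U : Opens (Space m)) (F : Type) [NormedAddCommGroup F] [NormedSpace ℝ F]
    (X : Space m → Space m) (hX : ContDiff ℝ ∞ X) : SmoothMaps U F →ₗ[ℝ] SmoothMaps U F where
  toFun f := SmoothMaps.mk U (fun x => fderiv ℝ f.1 x (X x))
    ((SmoothMaps.contDiffOn_fderiv f).clm_apply hX.contDiffOn)
  map_add' f g := SmoothMaps.ext fun x hx => by
    rw [SmoothMaps.add_apply, SmoothMaps.mk_apply hx, SmoothMaps.mk_apply hx,
      SmoothMaps.mk_apply hx, SmoothMaps.add_val,
      fderiv_add (SmoothMaps.differentiableAt f hx) (SmoothMaps.differentiableAt g hx), add_apply]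
  map_smul' c f := SmoothMaps.ext fun x hx => by
    rw [RingHom.id_apply, SmoothMaps.smul_apply, SmoothMaps.mk_apply hx, SmoothMaps.mk_apply hx,
      SmoothMaps.smul_val, fderiv_const_smul (SmoothMaps.differentiableAt f hx), smul_apply]

/-- The derivative `∂_t` of the coefficients. -/
def dT (U : Opens (Space m)) (F : Type) [NormedAddCommGroup F] [NormedSpace ℝ F] :
    SmoothMaps U F →ₗ[ℝ] SmoothMaps U F :=
  along U F (fun _ => ddt m) contDiff_const

/-- The derivative of the coefficients along the Euler vector field. -/
def dE (U : Opens (Space m)) (F : Type) [NormedAddCommGroup F] [NormedSpace ℝ F] :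
    SmoothMaps U F →ₗ[ℝ] SmoothMaps U F :=
  along U F euler contDiff_euler

theorem dT_apply (f : SmoothMaps U F) {x : Space m} (hx : x ∈ U) :
    (dT U F f).1 x = fderiv ℝ f.1 x (ddt m) :=
  SmoothMaps.mk_apply (hf := (SmoothMaps.contDiffOn_fderiv f).clm_apply contDiff_const.contDiffOn) hx

theorem dE_apply (f : SmoothMaps U F) {x : Space m} (hx : x ∈ U) :
    (dE U F f).1 x = fderiv ℝ f.1 x (euler x) :=
  SmoothMaps.mk_apply (hf := (SmoothMaps.contDiffOn_fderiv f).clm_apply contDiff_euler.contDiffOn) hx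

theorem SmoothMaps.fderiv_congr {f : SmoothMaps U F} {g : Space m → F}
    (h : ∀ y ∈ U, f.1 y = g y) {x : Space m} (hx : x ∈ U) : fderiv ℝ f.1 x = fderiv ℝ g x :=
  Filter.EventuallyEq.fderiv_eq (Filter.eventually_of_mem (U.isOpen.mem_nhds hx) h)

theorem SmoothMaps.sub_apply (f g : SmoothMaps U F) (x : Space m) :
    (f - g).1 x = f.1 x - g.1 x := rfl

theorem SmoothMaps.neg_apply (f : SmoothMaps U F) (x : Space m) : (-f).1 x = -f.1 x := rfl

theorem SmoothMaps.zero_apply (x : Space m) : (0 : SmoothMaps U F).1 x = 0 := rfl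

theorem SmoothMaps.postcomp_apply (L : F →L[ℝ] G) (f : SmoothMaps U F) (x : Space m) :
    (SmoothMaps.postcomp U L f).1 x = L (f.1 x) := rfl

theorem SmoothMaps.fderiv_postcomp (L : F →L[ℝ] G) (f : SmoothMaps U F) {x : Space m}
    (hx : x ∈ U) (v : Space m) :
    fderiv ℝ (SmoothMaps.postcomp U L f).1 x v = L (fderiv ℝ f.1 x v) := by
  have := (L.hasFDerivAt.comp x (SmoothMaps.differentiableAt f hx).hasFDerivAt).fderiv
  exact congrArg (fun A => A v) this

theorem dT_postcomp (L : F →L[ℝ] G) (f : SmoothMaps U F) :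
    dT U G (SmoothMaps.postcomp U L f) = SmoothMaps.postcomp U L (dT U F f) :=
  SmoothMaps.ext fun x hx => by
    rw [dT_apply _ hx, SmoothMaps.fderiv_postcomp L f hx, SmoothMaps.postcomp_apply, dT_apply _ hx]

theorem dE_postcomp (L : F →L[ℝ] G) (f : SmoothMaps U F) :
    dE U G (SmoothMaps.postcomp U L f) = SmoothMaps.postcomp U L (dE U F f) :=
  SmoothMaps.ext fun x hx => by
    rw [dE_apply _ hx, SmoothMaps.fderiv_postcomp L f hx, SmoothMaps.postcomp_apply, dE_apply _ hx]

theorem eulerL_ddt : eulerL m (ddt m) = 0 := rfl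

theorem eulerL_euler (x : Space m) : eulerL m (euler x) = euler x := rfl

/-- The fields ∂_t and E commute. -/
theorem dT_dE (f : SmoothMaps U F) : dT U F (dE U F f) = dE U F (dT U F f) :=
  SmoothMaps.ext fun x hx => by
    have hd : DifferentiableAt ℝ (fderiv ℝ f.1) x :=
      ((SmoothMaps.contDiffAt f hx).fderiv_right (m := ∞) (by simp)).differentiableAt (by simp)
    have he : HasFDerivAt (euler : Space m → Space m) (eulerL m) x := (eulerL m).hasFDerivAt
    rw [dT_apply _ hx, dE_apply _ hx, SmoothMaps.fderiv_congr (fun y hy => dE_apply f hy) hx,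
      SmoothMaps.fderiv_congr (fun y hy => dT_apply f hy) hx,
      fderiv_clm_apply hd he.differentiableAt, fderiv_clm_apply hd (by fun_prop), he.fderiv]
    simp only [add_apply, ContinuousLinearMap.comp_apply, ContinuousLinearMap.flip_apply,
      eulerL_ddt, map_zero, zero_add, fderiv_fun_const, Pi.zero_apply, zero_apply]
    exact isSymmSndFDerivAt_of_contDiffAt (SmoothMaps.contDiffAt f hx) _ _

/-- The operator `E ∧ ⋅` on multivector fields on `U`. -/
def wE (U : Opens (Space m)) (k : ℕ) : MultivectorField U k →ₗ[ℝ] MultivectorField U (k + 1) where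
  toFun f := ⟨fun x => wedge (euler x) (f.1 x),
    (contDiff_wedge contDiff_euler).contDiffOn.clm_apply f.2.1, fun x hx => by simp [f.2.2 x hx]⟩
  map_add' f g := Subtype.ext (by funext x; simp)
  map_smul' c f := Subtype.ext (by funext x; simp)

/-- The operator `∂_t ∧ ⋅` on multivector fields on `U`. -/
def wT (U : Opens (Space m)) (k : ℕ) : MultivectorField U k →ₗ[ℝ] MultivectorField U (k + 1) :=
  SmoothMaps.postcomp U (wedge (ddt m))

/-- The contraction with `dt` on multivector fields on `U`. -/
def iT (U : Opens (Space m)) (k : ℕ) : MultivectorField U (k + 1) →ₗ[ℝ] MultivectorField U k :=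
  SmoothMaps.postcomp U (contract (dt m))

theorem wE_apply (f : MultivectorField U k) (x : Space m) :
    (wE U k f).1 x = wedge (euler x) (f.1 x) := rfl

theorem wT_apply (f : MultivectorField U k) (x : Space m) :
    (wT U k f).1 x = wedge (ddt m) (f.1 x) := rfl

theorem iT_apply (f : MultivectorField U (k + 1)) (x : Space m) :
    (iT U k f).1 x = contract (dt m) (f.1 x) := rfl

theorem fderiv_wedge_euler {f : Space m → Multivector m k} {x : Space m}
    (hf : DifferentiableAt ℝ f x) (v : Space m) :
    fderiv ℝ (fun y => wedge (euler y) (f y)) x v =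
      wedge (euler x) (fderiv ℝ f x v) + wedge (eulerL m v) (f x) := by
  have h := fderiv_clm_apply (c := fun y => ((wedgeL m k).comp (eulerL m)) y) (u := f) (x := x)
    ((wedgeL m k).comp (eulerL m)).differentiableAt hf
  rw [ContinuousLinearMap.fderiv] at h
  exact congrArg (fun A => A v) h

theorem dT_wE (f : MultivectorField U k) : dT U _ (wE U k f) = wE U k (dT U _ f) :=
  SmoothMaps.ext fun x hx => by
    rw [dT_apply _ hx, wE_apply, dT_apply _ hx]
    refine (fderiv_wedge_euler (SmoothMaps.differentiableAt f hx) _).trans ?_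
    rw [eulerL_ddt, wedge_zero_left, add_zero]

/-- Only coefficients are differentiated, and those of E are linear in u; hence the extra summand E
∧ f. -/
theorem dE_wE (f : MultivectorField U k) :
    dE U _ (wE U k f) = wE U k (dE U _ f) + wE U k f :=
  SmoothMaps.ext fun x hx => by
    rw [SmoothMaps.add_apply, dE_apply _ hx, wE_apply, wE_apply, dE_apply _ hx]
    exact fderiv_wedge_euler (SmoothMaps.differentiableAt f hx) _

theorem dT_wT (f : MultivectorField U k) : dT U _ (wT U k f) = wT U k (dT U _ f) :=
  dT_postcomp _ f

theorem dE_wT (f : MultivectorField U k) : dE U _ (wT U k f) = wT U k (dE U _ f) :=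
  dE_postcomp _ f

theorem wE_wE (f : MultivectorField U k) : wE U _ (wE U k f) = 0 :=
  SmoothMaps.ext fun _ _ => wedge_wedge_self _ _

theorem wT_wT (f : MultivectorField U k) : wT U _ (wT U k f) = 0 :=
  SmoothMaps.ext fun _ _ => wedge_wedge_self _ _

theorem wE_wT (f : MultivectorField U k) : wE U _ (wT U k f) = -wT U _ (wE U k f) :=
  SmoothMaps.ext fun _ _ => wedge_wedge_comm _ _ _

theorem iT_wE (f : MultivectorField U (k + 1)) :
    iT U _ (wE U _ f) = -wE U k (iT U k f) :=
  SmoothMaps.ext fun x _ => by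
    rw [SmoothMaps.neg_apply, iT_apply, wE_apply, wE_apply, iT_apply, contract_wedge]
    simp [dt, euler]

theorem iT_wE_zero (f : MultivectorField U 0) : iT U 0 (wE U 0 f) = 0 :=
  SmoothMaps.ext fun x _ => by
    rw [iT_apply, wE_apply, contract_wedge_zero]
    simp [dt, euler, SmoothMaps.zero_apply]

theorem bookDifferential_eq (μ : MultivectorField U k) :
    bookDifferential U k μ =
      wT U k (dE U _ μ - (k : ℝ) • μ) - wE U k (dT U _ μ) :=
  SmoothMaps.ext fun x hx => by
    rw [bookDifferential_apply μ hx, SmoothMaps.sub_apply, wT_apply, wE_apply,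
      SmoothMaps.sub_apply, dE_apply _ hx, dT_apply _ hx, SmoothMaps.smul_apply]

theorem bookDifferential_comp (U : Opens (Space m)) (k : ℕ) :
    bookDifferential U (k + 1) ∘ₗ bookDifferential U k = 0 := by
  refine LinearMap.ext fun μ => ?_
  rw [LinearMap.comp_apply, bookDifferential_eq, bookDifferential_eq]
  -- The surviving terms are ∂_t ∧ E ∧ (E - k) ∂_t μ with both signs: the extra summand of `dE_wE`
  -- turns the factor k + 1 of the outer differential into k.
  simp only [map_sub, map_smul, dE_wT, dE_wE, dT_wT, dT_wE, wT_wT, wE_wE, map_add, wE_wT, dT_dE]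
  rw [LinearMap.zero_apply]
  push_cast
  module

theorem wedgeEuler_comp (m k : ℕ) : wedgeEuler m (k + 1) ∘ₗ wedgeEuler m k = 0 :=
  LinearMap.ext fun _ => Subtype.ext (funext fun _ => wedge_wedge_self _ _)

theorem wedgeEulerPrev_comp (m : ℕ) : ∀ k, wedgeEulerPrev m (k + 1) ∘ₗ wedgeEulerPrev m k = 0
  | 0 => LinearMap.comp_zero _
  | k + 1 => wedgeEuler_comp m k

/-- The differential of the complex `𝕎^(k-1) ⊕ 𝕎^k`. -/
def pairWedgeEuler (m k : ℕ) : (WWPrev m k × WW m k) →ₗ[ℝ] (WWPrev m (k + 1) × WW m (k + 1)) :=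
  (wedgeEulerPrev m k).prodMap (-wedgeEuler m k)

theorem pairWedgeEuler_comp (m k : ℕ) : pairWedgeEuler m (k + 1) ∘ₗ pairWedgeEuler m k = 0 := by
  refine LinearMap.ext fun w => Prod.ext ?_ ?_
  · exact congrArg (fun L => L w.1) (wedgeEulerPrev_comp m k)
  · have := congrArg (fun L => L w.2) (wedgeEuler_comp m k)
    simpa [pairWedgeEuler] using this

theorem modelDifferential_comp (m : ℕ) (I : Opens ℝ) (k : ℕ) :
    modelDifferential m I (k + 1) ∘ₗ modelDifferential m I k = 0 := by
  unfold modelDifferential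
  rw [← TensorProduct.map_comp]
  change TensorProduct.map _ (pairWedgeEuler m (k + 1) ∘ₗ pairWedgeEuler m k) = 0
  rw [pairWedgeEuler_comp, TensorProduct.map_zero_right]

end Operators

/-! ### The multivectors `∂_J` -/

section Basis

variable {m k : ℕ}

/-- The multivector `∂_{u_{J_1}} ∧ ⋯ ∧ ∂_{u_{J_k}}`. -/
def basisWedge : {k : ℕ} → (Fin k → Fin m) → Multivector m k
  | 0, _ => oneVector m
  | _ + 1, J => wedge (ddu (J 0)) (basisWedge (Fin.tail J))

theorem linearWedge_apply (I J : Fin k → Fin m) (x : Space m) :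
    linearWedge I J x = (∏ s, x.2 (I s)) • basisWedge J := by
  induction k with
  | zero => simp [linearWedge, basisWedge]
  | succ k ih =>
    change wedge (x.2 (I 0) • ddu (J 0)) (linearWedge (Fin.tail I) (Fin.tail J) x) = _
    rw [basisWedge, ih, Fin.prod_univ_succ, wedge_smul_left, map_smul, smul_smul]
    rfl

theorem contractDt_wedge_ddu (i : Fin m) {μ : Multivector m k} (h : contractDt k μ = 0) :
    contractDt (k + 1) (wedge (ddu i) μ) = 0 := by
  cases k with
  | zero =>
    change contract (dt m) (wedge (ddu i) μ) = 0
    rw [contract_wedge_zero]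
    simp [dt, ddu]
  | succ k =>
    change contract (dt m) (wedge (ddu i) μ) = 0
    have h' : contract (dt m) μ = 0 := h
    rw [contract_wedge, h', map_zero]
    simp [dt, ddu]

theorem contractDt_basisWedge (J : Fin k → Fin m) : contractDt k (basisWedge J) = 0 := by
  induction k with
  | zero => rfl
  | succ k ih => exact contractDt_wedge_ddu _ (ih _)

theorem du_ddu (i j : Fin m) : du i (ddu j) = if i = j then 1 else 0 := by
  simp [du, ddu, Pi.single_apply]

/-- With `basisWedge_apply_self` this gives the duality of the ∂_J and the du_K for increasing
tuples: if J ≠ K have equal length, some entry of K is missing from J. -/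
theorem basisWedge_apply_of_notMem {J K : Fin k → Fin m} (s : Fin k) (hs : K s ∉ Set.range J) :
    basisWedge J (fun r => du (K r)) = 0 := by
  induction k with
  | zero => exact s.elim0
  | succ k ih =>
    rw [basisWedge, wedge_apply]
    refine Finset.sum_eq_zero fun i _ => ?_
    by_cases his : i = s
    · have : K i ≠ J 0 := fun h => hs ⟨0, by rw [← h, his]⟩
      rw [du_ddu, if_neg this, zero_mul, mul_zero]
    · obtain ⟨r, hr⟩ := Fin.exists_succAbove_eq (Ne.symm his)
      have h0 := ih (J := Fin.tail J) (K := i.removeNth K) r (by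
        rintro ⟨q, hq⟩
        refine hs ⟨q.succ, ?_⟩
        rw [← hr]
        exact hq)
      have h1 : i.removeNth (fun r => du (K r)) = fun r => (du (i.removeNth K r) : Covector m) :=
        rfl
      rw [h1, h0, mul_zero, mul_zero]

theorem basisWedge_apply_self {J : Fin k → Fin m} (hJ : Function.Injective J) :
    basisWedge J (fun r => du (J r)) = 1 := by
  induction k with
  | zero => simp [basisWedge, oneVector]
  | succ k ih =>
    rw [basisWedge, wedge_apply, Fin.sum_univ_succ, Finset.sum_eq_zero, add_zero]
    · have h1 : (0 : Fin (k + 1)).removeNth (fun r => du (J r)) =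
        fun r => (du (Fin.tail J r) : Covector m) := rfl
      rw [h1, ih (J := Fin.tail J) (hJ.comp (Fin.succ_injective _)), du_ddu]
      simp
    · intro i _
      have : J i.succ ≠ J 0 := fun h => Fin.succ_ne_zero i (hJ h)
      rw [du_ddu, if_neg this, zero_mul, mul_zero]

/-- A transposition moves dt into the first slot, where the contraction vanishes. -/
theorem apply_eq_zero_of_eq_dt {ν : Multivector m k} (hν : contractDt k ν = 0)
    {α : Fin k → Covector m} (s : Fin k) (hs : α s = dt m) : ν α = 0 := by
  cases k with
  | zero => exact s.elim0
  | succ k =>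
    have hν' : contract (dt m) ν = 0 := hν
    have h1 : ν (α ∘ Equiv.swap 0 s) = 0 := by
      have h2 := contract_apply (dt m) ν (Fin.tail (α ∘ Equiv.swap 0 s))
      have h3 : Matrix.vecCons (dt m) (Fin.tail (α ∘ Equiv.swap 0 s)) = α ∘ Equiv.swap 0 s := by
        have : dt m = (α ∘ Equiv.swap 0 s) 0 := by simp [hs]
        rw [this]
        exact Fin.cons_self_tail _
      rw [hν', h3] at h2
      exact h2.symm
    have h4 := ν.toAlternatingMap.map_perm α (Equiv.swap 0 s)
    change ν (α ∘ Equiv.swap 0 s) = _ • ν α at h4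
    rw [h1] at h4
    exact (smul_eq_zero_iff_eq _).1 h4.symm

/-- The coordinates of a covector. -/
def covectorEquiv (m : ℕ) : Covector m ≃ₗ[ℝ] (Option (Fin m) → ℝ) where
  toFun α o := o.elim (α (ddt m)) fun i => α (ddu i)
  map_add' α β := by funext o; cases o <;> rfl
  map_smul' c α := by funext o; cases o <;> rfl
  invFun c := c none • dt m + ∑ i, c (some i) • du i
  left_inv α := (covector_eq_sum α).symm
  right_inv c := by
    funext o
    cases o with
    | none => simp [dt, ddt, du]
    | some j => simp [dt, ddu, du, Pi.single_apply]

/-- The basis `dt, du_1, …, du_m` of the space of covectors. -/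
def covectorBasis (m : ℕ) : Module.Basis (Option (Fin m)) ℝ (Covector m) :=
  Module.Basis.ofEquivFun (covectorEquiv m)

theorem covectorBasis_none (m : ℕ) : covectorBasis m none = dt m := by
  rw [covectorBasis, Module.Basis.coe_ofEquivFun, LinearEquiv.symm_apply_eq]
  funext o
  cases o <;> simp [covectorEquiv, dt, ddt, ddu]

theorem covectorBasis_some (i : Fin m) : covectorBasis m (some i) = du i := by
  rw [covectorBasis, Module.Basis.coe_ofEquivFun, LinearEquiv.symm_apply_eq]
  funext o
  cases o <;> simp [covectorEquiv, ddt, du, Pi.single_apply, ddu, eq_comm]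

theorem ext_horizontal {μ ν : Multivector m k} (hμ : contractDt k μ = 0) (hν : contractDt k ν = 0)
    (h : ∀ J : Fin k ↪o Fin m, μ (fun s => du (J s)) = ν (fun s => du (J s))) : μ = ν := by
  apply ContinuousAlternatingMap.toAlternatingMap_injective
  refine Module.Basis.ext_alternating (covectorBasis m) fun v hv => ?_
  change μ (fun i => covectorBasis m (v i)) = ν (fun i => covectorBasis m (v i))
  by_cases hn : ∃ s, v s = none
  · obtain ⟨s, hs⟩ := hn
    have hs' : covectorBasis m (v s) = dt m := by rw [hs, covectorBasis_none]
    rw [apply_eq_zero_of_eq_dt hμ s hs', apply_eq_zero_of_eq_dt hν s hs']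
  · push Not at hn
    choose K hK using fun s => Option.ne_none_iff_exists'.1 (hn s)
    have hKi : Function.Injective K := fun a b hab => hv (by rw [hK, hK, hab])
    have hα : (fun i => covectorBasis m (v i)) = fun i => du (K i) := by
      funext i
      rw [hK, covectorBasis_some]
    rw [hα]
    -- Alternating maps are determined on increasing tuples: sorting K changes both values by the
    -- same sign.
    let σ := Tuple.sort K
    have hmono : StrictMono (K ∘ σ) :=
      (Tuple.monotone_sort K).strictMono_of_injective (hKi.comp σ.injective)
    have hJ := h (OrderEmbedding.ofStrictMono _ hmono)
    have h1 := μ.toAlternatingMap.map_perm (fun i => (du (K i) : Covector m)) σ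
    have h2 := ν.toAlternatingMap.map_perm (fun i => (du (K i) : Covector m)) σ
    change μ (fun s => du (K (σ s))) = _ • μ (fun i => du (K i)) at h1
    change ν (fun s => du (K (σ s))) = _ • ν (fun i => du (K i)) at h2
    change μ (fun s => du (K (σ s))) = ν (fun s => du (K (σ s))) at hJ
    rw [h1, h2] at hJ
    exact smul_left_cancel _ hJ

/-- A multivector annihilated by `dt` is a combination of the multivectors `∂_J`. -/
theorem sum_smul_basisWedge {ν : Multivector m k} (hν : contractDt k ν = 0) :
    ∑ J : Fin k ↪o Fin m, ν (fun s => du (J s)) • basisWedge J = ν := by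
  refine ext_horizontal ?_ hν fun K => ?_
  · rw [map_sum]
    exact Finset.sum_eq_zero fun J _ => by rw [map_smul, contractDt_basisWedge, smul_zero]
  · rw [ContinuousAlternatingMap.sum_apply, Finset.sum_eq_single K]
    · rw [ContinuousAlternatingMap.smul_apply, basisWedge_apply_self K.injective, smul_eq_mul,
        mul_one]
    · intro J _ hJK
      have : ∃ s, K s ∉ Set.range J := by
        by_contra! hs
        have hsub : Finset.univ.image K ⊆ Finset.univ.image J := by
          intro i hi
          simp only [Finset.mem_image, Finset.mem_univ, true_and] at hi ⊢
          obtain ⟨s, rfl⟩ := hi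
          exact hs s
        have heq := Finset.eq_of_subset_of_card_le hsub (by
          rw [Finset.card_image_of_injective _ J.injective,
            Finset.card_image_of_injective _ K.injective])
        apply hJK
        have hr : Set.range J = Set.range K := by
          have := congrArg (fun s : Finset (Fin m) => (s : Set (Fin m))) heq
          simpa using this.symm
        exact DFunLike.coe_injective ((StrictMono.range_inj J.strictMono K.strictMono).1 hr)
      obtain ⟨s, hs⟩ := this
      rw [ContinuousAlternatingMap.smul_apply, basisWedge_apply_of_notMem s hs, smul_zero]
    · exact fun h => absurd (Finset.mem_univ _) h

theorem eq_zero_of_lt {ν : Multivector m k} (hν : contractDt k ν = 0) (h : m < k) : ν = 0 := by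
  have : IsEmpty (Fin k ↪o Fin m) :=
    ⟨fun J => by simpa [h.not_ge] using Fintype.card_le_of_injective J J.injective⟩
  rw [← sum_smul_basisWedge hν, Finset.univ_eq_empty, Finset.sum_empty]

end Basis

/-! ### Evaluation of tensors at points of `𝓘` -/

section TensorEval

variable {I : Opens ℝ} {V W : Type} [AddCommGroup V] [Module ℝ V] [AddCommGroup W] [Module ℝ W]

/-- The map `f ⊗ v ↦ (t ↦ f(t) v)`. -/
def tensorEval (I : Opens ℝ) (V : Type) [AddCommGroup V] [Module ℝ V] :
    SmoothMaps I ℝ ⊗[ℝ] V →ₗ[ℝ] (ℝ → V) :=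
  TensorProduct.lift (LinearMap.mk₂ ℝ (fun f v t => f.1 t • v)
    (fun f g v => by funext t; exact add_smul _ _ _)
    (fun c f v => by funext t; exact mul_smul _ _ _)
    (fun f v w => by funext t; exact smul_add _ _ _)
    (fun c f v => by funext t; exact smul_comm _ _ _))

theorem tensorEval_tmul (f : SmoothMaps I ℝ) (v : V) (t : ℝ) :
    tensorEval I V (f ⊗ₜ v) t = f.1 t • v := rfl

/-- In a basis of V a tensor is a finite sum of terms c_i ⊗ e_i, and its values determine all
c_i(t). Identities in the algebraic tensor product can therefore be checked pointwise on 𝓘. -/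
theorem tensorEval_injective (I : Opens ℝ) (V : Type) [AddCommGroup V] [Module ℝ V] :
    Function.Injective (tensorEval I V) := by
  rw [injective_iff_map_eq_zero]
  intro z hz
  let b := Module.Basis.ofVectorSpace ℝ V
  obtain ⟨c, rfl⟩ := TensorProduct.eq_repr_basis_right b z
  suffices h : ∀ i, c i = 0 by
    rw [Finsupp.sum]
    exact Finset.sum_eq_zero fun i _ => by rw [h i, TensorProduct.zero_tmul]
  intro i
  apply Subtype.ext
  funext t
  have ht := congrFun hz t
  rw [Finsupp.sum, map_sum, Finset.sum_apply] at ht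
  simp only [tensorEval_tmul] at ht
  by_cases hi : i ∈ c.support
  · exact linearIndependent_iff'.1 b.linearIndependent c.support (fun i => (c i).1 t) ht i hi
  · rw [Finsupp.notMem_support_iff.1 hi]

theorem tensorEval_of_notMem (z : SmoothMaps I ℝ ⊗[ℝ] V) {t : ℝ} (ht : t ∉ I) :
    tensorEval I V z t = 0 := by
  induction z with
  | zero => simp
  | tmul f v => rw [tensorEval_tmul, f.2.2 t ht, zero_smul]
  | add z w hz hw => rw [map_add, Pi.add_apply, hz, hw, add_zero]

theorem ext_tensorEval {z w : SmoothMaps I ℝ ⊗[ℝ] V}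
    (h : ∀ t ∈ I, tensorEval I V z t = tensorEval I V w t) : z = w := by
  apply tensorEval_injective
  funext t
  by_cases ht : t ∈ I
  · exact h t ht
  · rw [tensorEval_of_notMem z ht, tensorEval_of_notMem w ht]

theorem tensorEval_lTensor (L : V →ₗ[ℝ] W) (z : SmoothMaps I ℝ ⊗[ℝ] V) (t : ℝ) :
    tensorEval I W (L.lTensor _ z) t = L (tensorEval I V z t) := by
  induction z with
  | zero => simp
  | tmul f v => rw [LinearMap.lTensor_tmul, tensorEval_tmul, tensorEval_tmul, map_smul]
  | add z w hz hw => rw [map_add, map_add, map_add, Pi.add_apply, Pi.add_apply, hz, hw, map_add]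

/-- V carries no topology, so the derivative in t is taken after a linear map φ into a normed space:
an evaluation of fields at a point, or a linear functional. -/
theorem hasDerivAt_tensorEval {F : Type} [NormedAddCommGroup F] [NormedSpace ℝ F] (φ : V →ₗ[ℝ] F)
    (z : SmoothMaps I ℝ ⊗[ℝ] V) {t : ℝ} (ht : t ∈ I) :
    HasDerivAt (fun s => φ (tensorEval I V z s))
      (φ (tensorEval I V ((ddtSmooth I).rTensor V z) t)) t := by
  induction z with
  | zero => simpa using hasDerivAt_const t (0 : F)
  | tmul f v =>
    have h := (SmoothMaps.differentiableAt f ht).hasDerivAt.smul_const (φ v)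
    rw [LinearMap.rTensor_tmul, tensorEval_tmul, map_smul]
    have h2 : (ddtSmooth I f).1 t = deriv f.1 t :=
      SmoothMaps.mk_apply (hf := (SmoothMaps.contDiffOn f).deriv_of_isOpen I.isOpen (by simp)) ht
    rw [h2]
    simpa only [tensorEval_tmul, map_smul] using h
  | add z w hz hw =>
    simp only [map_add, Pi.add_apply]
    exact hz.add hw

end TensorEval

/-! ### The Taylor operator -/

section Taylor

variable {m k : ℕ} {U : Opens (Space m)}

theorem horizontal_apply (b : Horizontal U k) (x : Space m) : contractDt k (b.1.1 x) = 0 :=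
  congrFun (congrArg Subtype.val (LinearMap.mem_ker.1 b.2)) x

theorem mem_horizontal {f : MultivectorField U k} (h : ∀ x ∈ U, contractDt k (f.1 x) = 0) :
    f ∈ Horizontal U k :=
  LinearMap.mem_ker.2 (SmoothMaps.ext h)

/-- The condition ι_dt b = 0 is linear with constant coefficients, so it is inherited by all
derivatives, which can then be expanded in the ∂_J. -/
theorem contractDt_iteratedFDeriv (b : Horizontal U k) (j : ℕ) {x : Space m} (hx : x ∈ U)
    (v : Fin j → Space m) : contractDt k (iteratedFDeriv ℝ j b.1.1 x v) = 0 := by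
  have h := (contractDt (m := m) k).iteratedFDeriv_comp_left
    ((SmoothMaps.contDiffAt b.1 hx).of_le (m := j) (by exact_mod_cast le_top)) (le_refl (j : ℕ∞ω))
  have h0 : (contractDt (m := m) k ∘ b.1.1) = fun _ => 0 := funext (horizontal_apply b)
  rw [h0] at h
  have h1 := congrArg (fun A => A v) h
  rw [iteratedFDeriv_fun_zero] at h1
  exact h1.symm

theorem taylorCoefficient_coefficient (b : MultivectorField U k) (I J : Fin k → Fin m) {t : ℝ}
    (ht : t ∈ axisFiber U) :
    (taylorCoefficient U I (coefficient U J b)).1 t = (k.factorial : ℝ)⁻¹ *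
      (iteratedFDeriv ℝ k b.1 (t, 0) fun s => ddu (I s)) fun s => du (J s) := by
  have h1 : (taylorCoefficient U I (coefficient U J b)).1 t = (k.factorial : ℝ)⁻¹ *
      iteratedFDeriv ℝ k (coefficient U J b).1 (t, 0) fun s => ddu (I s) :=
    SmoothMaps.mk_apply (hf := contDiffOn_taylor U _
      (SmoothMaps.contDiffOn (coefficient U J b)) I) ht
  have h := (ContinuousAlternatingMap.apply ℝ (Covector m) ℝ
    fun s => du (J s)).iteratedFDeriv_comp_left
    ((SmoothMaps.contDiffAt b (x := (t, 0)) ht).of_le (m := k) (by exact_mod_cast le_top))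
    (le_refl (k : ℕ∞ω))
  have h2 : (coefficient U J b).1 = ContinuousAlternatingMap.apply ℝ (Covector m) ℝ
    (fun s => du (J s)) ∘ b.1 := rfl
  rw [h1, h2, h]
  rfl

/-- The Taylor operator computes the degree `k` part of the Taylor expansion. -/
theorem tensorEval_taylor (b : Horizontal U k) {t : ℝ} (ht : t ∈ axisFiber U) (x : Space m) :
    (tensorEval _ _ (taylor U k b) t).1 x = taylorPart k b.1.1 (t, 0) (euler x) := by
  have h1 : (tensorEval _ _ (taylor U k b) t).1 x =
      ∑ J : Fin k ↪o Fin m, ∑ I : Fin k → Fin m,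
        (taylorCoefficient U I (coefficient U J b.1)).1 t • linearWedge I J x := by
    unfold taylor
    simp only [LinearMap.sum_apply, map_sum, Finset.sum_apply]
    rw [Submodule.coe_sum, Finset.sum_apply]
    refine Finset.sum_congr rfl fun J _ => ?_
    rw [Submodule.coe_sum, Finset.sum_apply]
    rfl
  -- Expanding D^k b(E, …, E) with E = ∑ u_i ∂_{u_i} by multilinearity produces the sum over tuples
  -- I; expanding each value in the ∂_J produces the sum over J.
  rw [h1, Finset.sum_comm, taylorPart, euler_eq_sum,
    ContinuousMultilinearMap.map_sum, Finset.smul_sum]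
  refine Finset.sum_congr rfl fun I _ => ?_
  rw [ContinuousMultilinearMap.map_smul_univ, ← sum_smul_basisWedge
    (contractDt_iteratedFDeriv b k (x := (t, 0)) ht fun s => ddu (I s)), Finset.smul_sum,
    Finset.smul_sum]
  refine Finset.sum_congr rfl fun J _ => ?_
  rw [taylorCoefficient_coefficient b.1 I J ht, linearWedge_apply, smul_smul, smul_smul, smul_smul]
  congr 1
  ring

theorem taylorPart_mem_WW (b : Horizontal U k) {t : ℝ} (ht : t ∈ axisFiber U) :
    (fun x => taylorPart k b.1.1 (t, 0) (euler x)) ∈ WW m k := by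
  have : (fun x => taylorPart k b.1.1 (t, 0) (euler x)) =
      (tensorEval _ _ (taylor U k b) t).1 :=
    funext fun x => (tensorEval_taylor b ht x).symm
  rw [this]
  exact (tensorEval _ _ (taylor U k b) t).2

theorem eulerL_axis (t : ℝ) : eulerL m (t, 0) = 0 := rfl

/-- E is linear in u and vanishes on the axis, so E ∧ ⋅ raises the Taylor degree by exactly one. -/
theorem taylorPart_wE (f : MultivectorField U k) {t : ℝ} (ht : t ∈ axisFiber U) (x : Space m) :
    taylorPart (k + 1) (wE U k f).1 (t, 0) (euler x) =
      wedge (euler x) (taylorPart k f.1 (t, 0) (euler x)) :=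
  taylorPart_succ_linear_apply ((wedgeL m k).comp (eulerL m)) U.isOpen (SmoothMaps.contDiffOn f) k
    (x := (t, 0)) ht (by rw [ContinuousLinearMap.comp_apply, eulerL_axis, map_zero]) (euler x)

theorem taylorPart_dE {F : Type} [NormedAddCommGroup F] [NormedSpace ℝ F] (f : SmoothMaps U F)
    (j : ℕ) {t : ℝ} (ht : t ∈ axisFiber U) (x : Space m) :
    taylorPart j (dE U F f).1 (t, 0) (euler x) = (j : ℝ) • taylorPart j f.1 (t, 0) (euler x) := by
  rw [taylorPart_congr_of_isOpen U.isOpen (fun y hy => dE_apply f hy) (x := (t, 0)) ht]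
  exact taylorPart_fderiv_euler (eulerL m) U.isOpen (SmoothMaps.contDiffOn f) j (x := (t, 0)) ht
    (eulerL_axis t) (eulerL_euler x)

theorem hasDerivAt_taylorPart {F : Type} [NormedAddCommGroup F] [NormedSpace ℝ F]
    (f : SmoothMaps U F) (j : ℕ) {t : ℝ} (ht : t ∈ axisFiber U) (v : Space m) :
    HasDerivAt (fun s => taylorPart j f.1 (s, 0) v) (taylorPart j (dT U F f).1 (t, 0) v) t := by
  rw [taylorPart_congr_of_isOpen U.isOpen (fun y hy => dT_apply f hy) (x := (t, 0)) ht,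
    ← fderiv_taylorPart U.isOpen (SmoothMaps.contDiffOn f) j v (ddt m) ht]
  have h1 : DifferentiableAt ℝ (fun y => taylorPart j f.1 y v) (t, 0) :=
    ((contDiffOn_taylorPart U.isOpen (SmoothMaps.contDiffOn f) j v).contDiffAt
      (U.isOpen.mem_nhds ht)).differentiableAt (by simp)
  have h2 : HasDerivAt (fun s : ℝ => ((s, 0) : Space m)) (ddt m) t :=
    (hasDerivAt_id t).prodMk (hasDerivAt_const t 0)
  exact h1.hasFDerivAt.comp_hasDerivAt t h2

theorem taylorPart_field_add {F : Type} [NormedAddCommGroup F] [NormedSpace ℝ F]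
    (f g : SmoothMaps U F) (j : ℕ) {t : ℝ} (ht : t ∈ axisFiber U) (v : Space m) :
    taylorPart j (f + g).1 (t, 0) v = taylorPart j f.1 (t, 0) v + taylorPart j g.1 (t, 0) v :=
  taylorPart_add (SmoothMaps.contDiffAt f ht) (SmoothMaps.contDiffAt g ht) v

theorem taylorPart_field_smul {F : Type} [NormedAddCommGroup F] [NormedSpace ℝ F]
    (c : ℝ) (f : SmoothMaps U F) (j : ℕ) {t : ℝ} (ht : t ∈ axisFiber U) (v : Space m) :
    taylorPart j (c • f).1 (t, 0) v = c • taylorPart j f.1 (t, 0) v :=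
  taylorPart_smul_const (SmoothMaps.contDiffAt f ht) c v

theorem taylorPart_field_neg {F : Type} [NormedAddCommGroup F] [NormedSpace ℝ F]
    (f : SmoothMaps U F) (j : ℕ) {t : ℝ} (ht : t ∈ axisFiber U) (v : Space m) :
    taylorPart j (-f).1 (t, 0) v = -taylorPart j f.1 (t, 0) v :=
  taylorPart_comp (-ContinuousLinearMap.id ℝ F) (SmoothMaps.contDiffAt f ht) v

theorem taylorPart_field_sub {F : Type} [NormedAddCommGroup F] [NormedSpace ℝ F]
    (f g : SmoothMaps U F) (j : ℕ) {t : ℝ} (ht : t ∈ axisFiber U) (v : Space m) :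
    taylorPart j (f - g).1 (t, 0) v = taylorPart j f.1 (t, 0) v - taylorPart j g.1 (t, 0) v := by
  rw [sub_eq_add_neg, taylorPart_field_add _ _ _ ht, taylorPart_field_neg _ _ ht, sub_eq_add_neg]

end Taylor

/-! ### The book differential of `∂_t ∧ a + b` -/

section Parts

variable {m k : ℕ} {U : Opens (Space m)}

theorem mem_horizontal_zero (f : MultivectorField U 0) : f ∈ Horizontal U 0 :=
  mem_horizontal fun _ _ => rfl

theorem mem_horizontal_succ {f : MultivectorField U (k + 1)} :
    f ∈ Horizontal U (k + 1) ↔ iT U k f = 0 := Iff.rfl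

theorem wE_mem_horizontal {f : MultivectorField U k} (h : f ∈ Horizontal U k) :
    wE U k f ∈ Horizontal U (k + 1) := by
  rw [mem_horizontal_succ]
  cases k with
  | zero => exact iT_wE_zero f
  | succ k => rw [iT_wE, mem_horizontal_succ.1 h, map_zero, neg_zero]

theorem dT_mem_horizontal {f : MultivectorField U k} (h : f ∈ Horizontal U k) :
    dT U _ f ∈ Horizontal U k := by
  have h' : SmoothMaps.postcomp U (contractDt k) f = 0 := h
  change SmoothMaps.postcomp U (contractDt k) (dT U _ f) = 0
  rw [← dT_postcomp, h', map_zero]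

theorem dE_mem_horizontal {f : MultivectorField U k} (h : f ∈ Horizontal U k) :
    dE U _ f ∈ Horizontal U k := by
  have h' : SmoothMaps.postcomp U (contractDt k) f = 0 := h
  change SmoothMaps.postcomp U (contractDt k) (dE U _ f) = 0
  rw [← dE_postcomp, h', map_zero]

/-- The book differential of a horizontal field. -/
theorem bookDifferential_horizontal (b : MultivectorField U k) :
    bookDifferential U k b = wT U k (dE U _ b - (k : ℝ) • b) + -wE U k (dT U _ b) := by
  rw [bookDifferential_eq, sub_eq_add_neg]

set_option synthInstance.maxHeartbeats 200000 in
theorem bookDifferential_wT (a : MultivectorField U k) :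
    bookDifferential U (k + 1) (wT U k a) = wT U _ (wE U k (dT U _ a)) := by
  rw [bookDifferential_eq, map_sub, map_smul, dE_wT, wT_wT, wT_wT, dT_wT, wE_wT, smul_zero, sub_zero,
    zero_sub, neg_neg]

/-- The horizontal part of the result depends on b alone. This triangular shape lets cocycles be
treated by removing b first and then a. -/
theorem bookDifferential_add (a : MultivectorField U k) (b : MultivectorField U (k + 1)) :
    bookDifferential U (k + 1) (wT U k a + b) =
      wT U _ (wE U k (dT U _ a) + (dE U _ b - ((k + 1 : ℕ) : ℝ) • b)) + -wE U _ (dT U _ b) := by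
  rw [map_add, bookDifferential_wT, bookDifferential_horizontal, map_add]
  exact (add_assoc _ _ _).symm

theorem parts_eq {a : MultivectorField U k} {b : MultivectorField U (k + 1)}
    (ha : a ∈ Horizontal U k) (hb : b ∈ Horizontal U (k + 1)) :
    (dtPart U (k + 1) (wT U k a + b)).1 = a ∧ (uPart U (k + 1) (wT U k a + b)).1 = b := by
  have h := parts_wedgeDt_add U k ⟨a, ha⟩ ⟨b, hb⟩
  exact ⟨congrArg Subtype.val h.1, congrArg Subtype.val h.2⟩

theorem eq_wT_add (μ : MultivectorField U (k + 1)) :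
    μ = wT U k (dtPart U (k + 1) μ).1 + (uPart U (k + 1) μ).1 :=
  (wedgeDt_dtPart_add_uPart U (k + 1) μ).symm

theorem uPart_zero (μ : MultivectorField U 0) : (uPart U 0 μ).1 = μ := sub_zero μ

theorem euler_part_mem {b : MultivectorField U k} (hb : b ∈ Horizontal U k) :
    dE U _ b - (k : ℝ) • b ∈ Horizontal U k :=
  Submodule.sub_mem _ (dE_mem_horizontal hb) (Submodule.smul_mem _ _ hb)

theorem uPart_bookDifferential (μ : MultivectorField U k) :
    (uPart U (k + 1) (bookDifferential U k μ)).1 = -wE U k (dT U _ (uPart U k μ).1) := by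
  cases k with
  | zero =>
    rw [bookDifferential_horizontal, uPart_zero]
    exact (parts_eq (mem_horizontal_zero _) (Submodule.neg_mem _ (wE_mem_horizontal
      (mem_horizontal_zero _)))).2
  | succ k =>
    conv_lhs => rw [eq_wT_add μ, bookDifferential_add]
    exact (parts_eq (Submodule.add_mem _ (wE_mem_horizontal (dT_mem_horizontal (dtPart U _ μ).2))
      (euler_part_mem (uPart U _ μ).2))
      (Submodule.neg_mem _ (wE_mem_horizontal (dT_mem_horizontal (uPart U _ μ).2)))).2

theorem dtPart_bookDifferential_zero (μ : MultivectorField U 0) :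
    (dtPart U 1 (bookDifferential U 0 μ)).1 = dE U _ μ - ((0 : ℕ) : ℝ) • μ := by
  rw [bookDifferential_horizontal]
  exact (parts_eq (mem_horizontal_zero _) (Submodule.neg_mem _ (wE_mem_horizontal
    (mem_horizontal_zero _)))).1

theorem dtPart_bookDifferential_succ (μ : MultivectorField U (k + 1)) :
    (dtPart U (k + 2) (bookDifferential U (k + 1) μ)).1 =
      wE U k (dT U _ (dtPart U (k + 1) μ).1) +
        (dE U _ (uPart U (k + 1) μ).1 - ((k + 1 : ℕ) : ℝ) • (uPart U (k + 1) μ).1) := by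
  conv_lhs => rw [eq_wT_add μ, bookDifferential_add]
  exact (parts_eq (Submodule.add_mem _ (wE_mem_horizontal (dT_mem_horizontal (dtPart U _ μ).2))
    (euler_part_mem (uPart U _ μ).2))
    (Submodule.neg_mem _ (wE_mem_horizontal (dT_mem_horizontal (uPart U _ μ).2)))).1

end Parts

/-! ### The map `𝒯` is a morphism of complexes -/

section Morphism

variable {m k : ℕ} {U : Opens (Space m)}

theorem tensorEval_bigT (μ : MultivectorField U k) (t : ℝ) :
    tensorEval _ _ (bigT U k μ) t =
      (tensorEval _ _ (taylorPrev U k (dtPart U k μ)) t,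
        tensorEval _ _ (taylor U k (uPart U k μ)) t) := by
  unfold bigT
  simp only [LinearMap.add_apply, LinearMap.comp_apply, map_add, Pi.add_apply, tensorEval_lTensor]
  simp

theorem modelDifferential_eq (I : Opens ℝ) (z : ModelCochains m I k) :
    modelDifferential m I k z =
      (pairWedgeEuler m k).lTensor _ ((ddtSmooth I).rTensor _ z) := by
  rw [← LinearMap.comp_apply, LinearMap.lTensor_comp_rTensor]
  rfl

/-- E has eigenvalue k on the degree k part. This is why the term (E - k) b of the book differential
leaves no trace in δ. -/
theorem taylorPart_euler_sub (b : MultivectorField U k) {t : ℝ} (ht : t ∈ axisFiber U)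
    (x : Space m) : taylorPart k (dE U _ b - (k : ℝ) • b).1 (t, 0) (euler x) = 0 := by
  rw [taylorPart_field_sub _ _ _ ht, taylorPart_field_smul _ _ _ ht, taylorPart_dE _ _ ht, sub_self]

/-- Both sides are the t-derivative of the same function near t, so uniqueness of derivatives
identifies ∂_t on C^∞(𝓘) with ∂_t on fields. -/
theorem taylorPart_dT_uPart (μ : MultivectorField U k) {t : ℝ} (ht : t ∈ axisFiber U)
    (x : Space m) :
    taylorPart k (dT U _ (uPart U k μ).1).1 (t, 0) (euler x) =
      (tensorEval _ _ ((ddtSmooth _).rTensor _ (bigT U k μ)) t).2.1 x := by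
  let φ : (WWPrev m k × WW m k) →ₗ[ℝ] Multivector m k :=
    (LinearMap.proj x).comp ((WW m k).subtype.comp (LinearMap.snd ℝ _ _))
  have h1 := hasDerivAt_tensorEval φ (bigT U k μ) ht
  have h2 := hasDerivAt_taylorPart (uPart U k μ).1 k ht (euler x)
  have h3 : (fun s => φ (tensorEval _ _ (bigT U k μ) s)) =ᶠ[nhds t]
      fun s => taylorPart k (uPart U k μ).1.1 (s, 0) (euler x) := by
    filter_upwards [(axisFiber U).isOpen.mem_nhds ht] with s hs
    rw [tensorEval_bigT]
    exact tensorEval_taylor _ hs x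
  exact (h3.hasDerivAt_iff.1 h1).unique h2 |>.symm

theorem taylorPart_dT_dtPart (μ : MultivectorField U (k + 1)) {t : ℝ} (ht : t ∈ axisFiber U)
    (x : Space m) :
    taylorPart k (dT U _ (dtPart U (k + 1) μ).1).1 (t, 0) (euler x) =
      (tensorEval _ _ ((ddtSmooth _).rTensor _ (bigT U (k + 1) μ)) t).1.1 x := by
  let φ : (WWPrev m (k + 1) × WW m (k + 1)) →ₗ[ℝ] Multivector m k :=
    (LinearMap.proj x).comp ((WW m k).subtype.comp (LinearMap.fst ℝ _ _))
  have h1 := hasDerivAt_tensorEval φ (bigT U (k + 1) μ) ht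
  have h2 := hasDerivAt_taylorPart (dtPart U (k + 1) μ).1 k ht (euler x)
  have h3 : (fun s => φ (tensorEval _ _ (bigT U (k + 1) μ) s)) =ᶠ[nhds t]
      fun s => taylorPart k (dtPart U (k + 1) μ).1.1 (s, 0) (euler x) := by
    filter_upwards [(axisFiber U).isOpen.mem_nhds ht] with s hs
    rw [tensorEval_bigT]
    exact tensorEval_taylor (dtPart U (k + 1) μ) hs x
  exact (h3.hasDerivAt_iff.1 h1).unique h2 |>.symm

/-- After evaluation at t both sides are Taylor parts of the components of d_book μ: (E - k) b drops
out, E ∧ ⋅ comes out by the degree shift, and ∂_t passes through. -/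
theorem modelDifferential_comp_bigT (U : Opens (Space m)) (k : ℕ) :
    modelDifferential m (axisFiber U) k ∘ₗ bigT U k =
      bigT U (k + 1) ∘ₗ bookDifferential U k := by
  refine LinearMap.ext fun μ => ext_tensorEval fun t ht => ?_
  rw [LinearMap.comp_apply, LinearMap.comp_apply, modelDifferential_eq, tensorEval_lTensor,
    tensorEval_bigT (bookDifferential U k μ)]
  refine Prod.ext ?_ (Subtype.ext (funext fun x => ?_))
  · change wedgeEulerPrev m k _ = tensorEval _ _ (taylor U k (dtPart U (k + 1) _)) t
    refine Subtype.ext (funext fun x => ?_)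
    refine Eq.trans ?_ (tensorEval_taylor (dtPart U (k + 1) (bookDifferential U k μ)) ht x).symm
    cases k with
    -- For functions there is no a; the ∂_t-component of the differential is E(μ), whose value on
    -- the axis vanishes.
    | zero =>
      have h := taylorPart_euler_sub μ ht x
      rw [← dtPart_bookDifferential_zero] at h
      exact h.symm
    | succ k =>
      have h : taylorPart (k + 1) (dtPart U (k + 2) (bookDifferential U (k + 1) μ)).1.1 (t, 0)
          (euler x) = wedge (euler x)
            ((tensorEval _ _ ((ddtSmooth _).rTensor _ (bigT U (k + 1) μ)) t).1.1 x) := by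
        rw [dtPart_bookDifferential_succ, taylorPart_field_add _ _ _ ht, taylorPart_euler_sub _ ht,
          add_zero, taylorPart_wE _ ht]
        exact congrArg (wedge (euler x)) (taylorPart_dT_dtPart μ ht x)
      exact h.symm
  · change -wedge (euler x)
      ((tensorEval _ _ ((ddtSmooth _).rTensor _ (bigT U k μ)) t).2.1 x) = _
    refine Eq.trans ?_ (tensorEval_taylor (uPart U (k + 1) (bookDifferential U k μ)) ht x).symm
    rw [uPart_bookDifferential, taylorPart_field_neg _ _ ht, taylorPart_wE _ ht,
      taylorPart_dT_uPart _ ht]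

end Morphism

/-! ### Gluing smooth sections of families of convex sets -/

section Gluing

open scoped Manifold

variable {V F : Type} [NormedAddCommGroup V] [NormedSpace ℝ V] [FiniteDimensional ℝ V]
  [NormedAddCommGroup F] [NormedSpace ℝ F]

/-- Partition of unity on U. It is applied to solution sets of a linear equation and to the fibers
of p, both convex. -/
theorem exists_contDiffOn_forall_mem_convex (U : Opens V) (t : V → Set F)
    (ht : ∀ x, Convex ℝ (t x))
    (hloc : ∀ x ∈ U, ∃ N ∈ nhds x, ∃ g : V → F, ContDiffOn ℝ ∞ g N ∧ ∀ y ∈ N, g y ∈ t y) :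
    ∃ g : V → F, ContDiffOn ℝ ∞ g U ∧ ∀ x ∈ U, g x ∈ t x := by
  classical
  have : ProperSpace V := FiniteDimensional.proper ℝ V
  have : LocallyCompactSpace U := U.isOpen.locallyCompactSpace
  have : SecondCountableTopology V := secondCountable_of_proper
  obtain ⟨g, hg⟩ := exists_contMDiffMap_forall_mem_convex_of_local (M := U) (n := ⊤) 𝓘(ℝ, V)
    (t := fun x : U => t x) (fun x => ht x) (by
      rintro ⟨x, hx⟩
      obtain ⟨N, hN, g, hg, hgt⟩ := hloc x hx
      refine ⟨Subtype.val ⁻¹' N, continuous_subtype_val.continuousAt.preimage_mem_nhds hN,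
        fun y => g y, ?_, fun y hy => hgt y hy⟩
      exact (contMDiffOn_iff_contDiffOn.2 hg).comp contMDiff_subtype_val.contMDiffOn
        fun _ hy => hy)
  refine ⟨fun x => if hx : x ∈ U then g ⟨x, hx⟩ else 0, fun x hx => ?_, fun x hx => ?_⟩
  · refine ContDiffAt.contDiffWithinAt (contMDiffAt_iff_contDiffAt.1 ?_)
    refine (contMDiffAt_subtype_iff (U := U) (x := ⟨x, hx⟩)).1 ?_
    have h := g.contMDiff ⟨x, hx⟩
    convert h using 1
    funext y
    exact dif_pos y.2
  · change (if hx : x ∈ U then g ⟨x, hx⟩ else 0) ∈ t x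
    rw [dif_pos hx]
    exact hg ⟨x, hx⟩

end Gluing

/-! ### Division by the Euler vector field -/

section Division

open Set

variable {m k : ℕ} {U : Opens (Space m)}

theorem eulerL_ddu (i : Fin m) : eulerL m (ddu i) = ddu i := rfl

theorem du_euler (i : Fin m) (x : Space m) : du i (euler x) = x.2 i := rfl

/-- The derivative of E ∧ β = 0 along ∂_{u_i}, where E itself contributes ∂_{u_i} ∧ β. -/
theorem wedge_euler_fderiv {β : MultivectorField U k} (hβ : wE U k β = 0) {x : Space m}
    (hx : x ∈ U) (i : Fin m) :
    wedge (euler x) (fderiv ℝ β.1 x (ddu i)) = -wedge (ddu i) (β.1 x) := by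
  have h := fderiv_wedge_euler (SmoothMaps.differentiableAt β hx) (ddu i)
  have h0 : (fun y => wedge (euler y) (β.1 y)) = fun _ => 0 := congrArg Subtype.val hβ
  rw [h0, eulerL_ddu] at h
  refine eq_neg_of_add_eq_zero_left (h.symm.trans ?_)
  rw [fderiv_fun_const]
  rfl

/-- The divergence `∑_i ι_{du_i} ∂_{u_i}`. -/
def divergence (β : Space m → Multivector m (k + 1)) (x : Space m) : Multivector m k :=
  ∑ i, contract (du i) (fderiv ℝ β x (ddu i))

theorem contDiffOn_divergence (β : MultivectorField U (k + 1)) :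
    ContDiffOn ℝ ∞ (divergence β.1) U :=
  ContDiffOn.sum fun _ _ => (ContinuousLinearMap.contDiff _).comp_contDiffOn
    ((SmoothMaps.contDiffOn_fderiv β).clm_apply contDiffOn_const)

/-- The Koszul identity for the divergence. -/
theorem wedge_euler_divergence {β : MultivectorField U (k + 1)} (hh : β ∈ Horizontal U (k + 1))
    (hβ : wE U _ β = 0) {x : Space m} (hx : x ∈ U) :
    wedge (euler x) (divergence β.1 x) =
      fderiv ℝ β.1 x (euler x) + ((m : ℝ) - ((k : ℝ) + 1)) • β.1 x := by
  -- Contract `wedge_euler_fderiv` with du_i. Summing over i, the terms ∂_{u_i} ∧ ι_{du_i} β add up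
  -- to (k + 1) β, and the m copies of β give the coefficient m - (k + 1).
  have h1 : ∀ i, wedge (euler x) (contract (du i) (fderiv ℝ β.1 x (ddu i))) =
      x.2 i • fderiv ℝ β.1 x (ddu i) + (β.1 x - wedge (ddu i) (contract (du i) (β.1 x))) := by
    intro i
    have h2 := contract_wedge (du i) (euler x) (fderiv ℝ β.1 x (ddu i))
    rw [wedge_euler_fderiv hβ hx, map_neg, contract_wedge, du_ddu, if_pos rfl, one_smul,
      du_euler] at h2
    rw [eq_sub_iff_add_eq] at h2
    rw [← h2]
    abel
  have h3 := sum_wedge_contract (β.1 x)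
  have h4 : contract (dt m) (β.1 x) = 0 := horizontal_apply ⟨β, hh⟩ x
  rw [h4, map_zero, zero_add] at h3
  have h5 : fderiv ℝ β.1 x (euler x) = ∑ i, x.2 i • fderiv ℝ β.1 x (ddu i) := by
    rw [euler_eq_sum, map_sum]
    simp only [map_smul]
  rw [divergence, map_sum, Finset.sum_congr rfl fun i _ => h1 i, Finset.sum_add_distrib,
    Finset.sum_sub_distrib, h3, h5, Finset.sum_const, Finset.card_univ, Fintype.card_fin,
    sub_smul, ← Nat.cast_smul_eq_nsmul ℝ]

/-- The point `(t, s u)`. -/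
def squeeze (z : Space m × ℝ) : Space m := (z.1.1, z.2 • z.1.2)

theorem contDiff_squeeze : ContDiff ℝ ∞ (squeeze : Space m × ℝ → Space m) := by
  unfold squeeze
  fun_prop

theorem squeeze_mem_ball {x y : Space m} (hx : x.2 = 0) {r : ℝ} (hy : y ∈ Metric.ball x r) {s : ℝ}
    (hs : s ∈ Icc (0 : ℝ) 1) : squeeze (y, s) ∈ Metric.ball x r := by
  rw [Metric.mem_ball, Prod.dist_eq, max_lt_iff, hx, dist_zero_right] at hy ⊢
  refine ⟨hy.1, lt_of_le_of_lt ?_ hy.2⟩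
  change ‖s • y.2‖ ≤ ‖y.2‖
  rw [norm_smul, Real.norm_of_nonneg hs.1]
  exact mul_le_of_le_one_left (norm_nonneg _) hs.2

/-- Put M = m - (k + 1). By the Koszul identity d/ds (s^M β(t, s u)) = E ∧ s^M (div β)(t, s u), so
integrating over [0, 1] writes β as E ∧ c with c a smooth integral. Balls of the maximum norm around
axis points are stable under u ↦ s u. -/
theorem exists_wedge_euler_eq_near_axis {β : MultivectorField U (k + 1)}
    (hh : β ∈ Horizontal U (k + 1)) (hβ : wE U _ β = 0) (hk : k + 1 ≤ m)
    (hax : k + 1 = m → ∀ t : ℝ, β.1 (t, 0) = 0) {x : Space m} (hx : x ∈ U) (hx0 : x.2 = 0) :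
    ∃ N ∈ nhds x, ∃ g : Space m → Multivector m k, ContDiffOn ℝ ∞ g N ∧
      ∀ y ∈ N, wedge (euler y) (g y) = β.1 y := by
  obtain ⟨r, hr, hrU⟩ := Metric.isOpen_iff.1 U.isOpen x hx
  obtain ⟨M, hM⟩ := Nat.exists_eq_add_of_le hk
  have hmem : ∀ y ∈ Metric.ball x r, ∀ s ∈ Icc (0 : ℝ) 1,
      (y, s) ∈ (squeeze ⁻¹' (U : Set (Space m)) : Set (Space m × ℝ)) :=
    fun y hy s hs => hrU (squeeze_mem_ball hx0 hy hs)
  have hWo : IsOpen (squeeze ⁻¹' (U : Set (Space m)) : Set (Space m × ℝ)) :=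
    U.isOpen.preimage contDiff_squeeze.continuous
  have hG : ContDiffOn ℝ ∞ (fun z : Space m × ℝ => z.2 ^ M • divergence β.1 (squeeze z))
      (squeeze ⁻¹' (U : Set (Space m))) :=
    (contDiff_snd.pow M).contDiffOn.smul
      ((contDiffOn_divergence β).comp contDiff_squeeze.contDiffOn fun _ hz => hz)
  refine ⟨Metric.ball x r, Metric.ball_mem_nhds x hr,
    fun y => ∫ s in (0 : ℝ)..1, s ^ M • divergence β.1 (squeeze (y, s)),
    contDiffOn_integral Metric.isOpen_ball hWo hG hmem, fun y hy => ?_⟩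
  have hint := intervalIntegrable_slice hG.continuousOn hmem hy
  rw [← ContinuousLinearMap.intervalIntegral_comp_comm _ hint]
  have hcont : ContinuousOn (fun s : ℝ => s ^ M • β.1 (squeeze (y, s))) (Icc 0 1) :=
    (continuous_pow M).continuousOn.smul ((SmoothMaps.contDiffOn β).continuousOn.comp
      (contDiff_squeeze.continuous.comp (by fun_prop)).continuousOn
      fun s hs => hmem y hy s hs)
  have hderiv : ∀ s ∈ Ioo (0 : ℝ) 1, HasDerivAt (fun s : ℝ => s ^ M • β.1 (squeeze (y, s)))
      (wedge (euler y) (s ^ M • divergence β.1 (squeeze (y, s)))) s := by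
    intro s hs
    have hsU : squeeze (y, s) ∈ U := hmem y hy s (Ioo_subset_Icc_self hs)
    have h1 : HasDerivAt (fun s : ℝ => squeeze (y, s)) (euler y) s := by
      refine (hasDerivAt_const s y.1).prodMk ?_
      simpa using (hasDerivAt_id s).smul_const y.2
    have h2 : HasDerivAt (fun s : ℝ => β.1 (squeeze (y, s)))
        (fderiv ℝ β.1 (squeeze (y, s)) (euler y)) s :=
      (SmoothMaps.differentiableAt β hsU).hasFDerivAt.comp_hasDerivAt s h1
    have h3 := (hasDerivAt_pow M s).smul h2
    have h4 := wedge_euler_divergence hh hβ hsU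
    have h5 : euler (squeeze (y, s)) = s • euler y := by
      apply Prod.ext <;> simp [euler, squeeze]
    have h6 : (m : ℝ) - ((k : ℝ) + 1) = M := by
      rw [hM]
      push_cast
      ring
    rw [h5, h6, wedge_smul_left, map_smul] at h4
    -- The Euler field at (t, s u) is s times the one at y; this absorbs the power s^(M-1) of the
    -- product rule. The identity is checked after multiplication by s ≠ 0.
    have h7 : wedge (euler y) (s ^ M • divergence β.1 (squeeze (y, s))) =
        s ^ M • fderiv ℝ β.1 (squeeze (y, s)) (euler y) +
          ((M : ℝ) * s ^ (M - 1)) • β.1 (squeeze (y, s)) := by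
      have h8 : s ^ M * (M : ℝ) = s * ((M : ℝ) * s ^ (M - 1)) := by
        rcases M with _ | M
        · simp
        · rw [Nat.add_sub_cancel, pow_succ]
          ring
      rw [map_smul, ← smul_right_inj hs.1.ne', smul_comm, h4, smul_add, smul_add,
        smul_comm (s ^ M) s, smul_smul (s ^ M) (M : ℝ), h8, ← smul_smul s]
    rw [h7]
    exact h3
  rw [intervalIntegral.integral_eq_sub_of_hasDerivAt_of_le zero_le_one hcont hderiv]
  -- The boundary term at s = 0 vanishes for M > 0. For M = 0, the top degree, 0^0 = 1 and the
  -- vanishing of β on the axis is needed.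
  · have h0 : (0 : ℝ) ^ M • β.1 (squeeze (y, 0)) = 0 := by
      rcases Nat.eq_zero_or_pos M with h | h
      · have : squeeze (y, 0) = (y.1, 0) := by simp [squeeze]
        rw [this, hax (by omega), smul_zero]
      · rw [zero_pow h.ne', zero_smul]
    rw [h0, sub_zero, one_pow, one_smul]
    simp [squeeze]
  · apply ContinuousOn.intervalIntegrable
    rw [uIcc_of_le zero_le_one]
    exact (wedge (euler y)).continuous.comp_continuousOn (continuous_slice hG.continuousOn hmem hy)

/-- Where u_i ≠ 0, contracting E ∧ β = 0 with du_i gives u_i β = E ∧ ι_{du_i} β. -/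
theorem exists_wedge_euler_eq_off_axis {β : MultivectorField U (k + 1)} (hβ : wE U _ β = 0)
    {x : Space m} (hx : x ∈ U) (hx0 : x.2 ≠ 0) :
    ∃ N ∈ nhds x, ∃ g : Space m → Multivector m k, ContDiffOn ℝ ∞ g N ∧
      ∀ y ∈ N, wedge (euler y) (g y) = β.1 y := by
  obtain ⟨i, hi⟩ := Function.ne_iff.1 hx0
  have hcoord : Continuous fun y : Space m => y.2 i := by fun_prop
  refine ⟨(U : Set (Space m)) ∩ {y | y.2 i ≠ 0}, Filter.inter_mem (U.isOpen.mem_nhds hx)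
    ((isOpen_ne_fun hcoord continuous_const).mem_nhds hi),
    fun y => (y.2 i)⁻¹ • contract (du i) (β.1 y), ?_, fun y hy => ?_⟩
  · have h1 : ContDiffOn ℝ ∞ (fun y : Space m => (y.2 i)⁻¹)
        ((U : Set (Space m)) ∩ {y | y.2 i ≠ 0}) :=
      ContDiffOn.inv (ContDiff.contDiffOn (by fun_prop)) fun y hy => hy.2
    have h2 : ContDiffOn ℝ ∞ (fun y => contract (du i) (β.1 y))
        ((U : Set (Space m)) ∩ {y | y.2 i ≠ 0}) :=
      (ContinuousLinearMap.contDiff _).comp_contDiffOn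
        ((SmoothMaps.contDiffOn β).mono inter_subset_left)
    exact h1.smul h2
  · have h := contract_wedge (du i) (euler y) (β.1 y)
    have h0 : wedge (euler y) (β.1 y) = 0 := congrFun (congrArg Subtype.val hβ) y
    rw [h0, map_zero, du_euler] at h
    rw [map_smul, ← sub_eq_zero.1 h.symm, smul_smul, inv_mul_cancel₀ hy.2, one_smul]

/-- Division by the Euler vector field in positive degree. -/
theorem exists_wE_eq {β : MultivectorField U (k + 1)} (hh : β ∈ Horizontal U (k + 1))
    (hβ : wE U _ β = 0) (hax : k + 1 = m → ∀ t : ℝ, β.1 (t, 0) = 0) :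
    ∃ c : MultivectorField U k, wE U k c = β := by
  -- Above degree m there are no nonzero horizontal multivectors; up to degree m the exponent M of
  -- the radial integral is a natural number.
  rcases lt_or_ge m (k + 1) with hk | hk
  · refine ⟨0, SmoothMaps.ext fun x _ => ?_⟩
    rw [eq_zero_of_lt (horizontal_apply ⟨β, hh⟩ x) hk, map_zero]
    rfl
  obtain ⟨g, hg, hgt⟩ := exists_contDiffOn_forall_mem_convex U
    (fun x => {c : Multivector m k | wedge (euler x) c = β.1 x})
    (fun x c hc d hd a b ha hb hab => by
      simp only [mem_ofPred_eq] at hc hd ⊢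
      rw [map_add, map_smul, map_smul, hc, hd, ← add_smul, hab, one_smul])
    (fun x hx => by
      by_cases hx0 : x.2 = 0
      · exact exists_wedge_euler_eq_near_axis hh hβ hk hax hx hx0
      · exact exists_wedge_euler_eq_off_axis hβ hx hx0)
  refine ⟨SmoothMaps.mk U g hg, SmoothMaps.ext fun x hx => ?_⟩
  rw [wE_apply, SmoothMaps.mk_apply hx]
  exact hgt x hx

/-- Division by the Euler vector field in degree `0`. -/
theorem eq_zero_of_wE_eq_zero (hm : 0 < m) {β : MultivectorField U 0} (hβ : wE U 0 β = 0) :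
    β = 0 := by
  refine SmoothMaps.ext fun x hx => ?_
  rw [SmoothMaps.zero_apply]
  by_cases hx0 : x.2 = 0
  -- On the axis E vanishes, and the first derivative of E ∧ β = 0 in one u-direction shows ∂_{u_0}
  -- ∧ β = 0.
  · have h := wedge_euler_fderiv hβ hx ⟨0, hm⟩
    have he : euler x = 0 := by rw [euler, hx0]; rfl
    have h2 := contract_wedge_zero (du ⟨0, hm⟩) (ddu ⟨0, hm⟩) (β.1 x)
    rw [he, wedge_zero_left, eq_comm, neg_eq_zero] at h
    rwa [h, map_zero, du_ddu, if_pos rfl, one_smul, eq_comm] at h2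
  · obtain ⟨i, hi⟩ := Function.ne_iff.1 hx0
    have h := contract_wedge_zero (du i) (euler x) (β.1 x)
    have h0 : wedge (euler x) (β.1 x) = 0 := congrFun (congrArg Subtype.val hβ) x
    rw [h0, map_zero, du_euler, eq_comm, smul_eq_zero] at h
    exact h.resolve_left hi

end Division

/-! ### The projection to the `u`-space -/

section Projection

open Set

variable {m k : ℕ} {U : Opens (Space m)}
  {F : Type} [NormedAddCommGroup F] [NormedSpace ℝ F]

/-- The image `p(U)`. -/
def projImage (U : Opens (Space m)) : Opens (Fin m → ℝ) :=
  ⟨Prod.snd '' (U : Set (Space m)), isOpenMap_snd _ U.isOpen⟩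

theorem snd_mem_projImage {x : Space m} (hx : x ∈ U) : x.2 ∈ projImage U := ⟨x, hx, rfl⟩

theorem exists_of_mem_projImage {u : Fin m → ℝ} (hu : u ∈ projImage U) : ∃ t : ℝ, (t, u) ∈ U := by
  obtain ⟨x, hx, rfl⟩ := hu
  exact ⟨x.1, hx⟩

theorem convex_fiber (u : Fin m → ℝ)
    (hfib : IsPreconnected ((U : Set (Space m)) ∩ Prod.snd ⁻¹' {u})) :
    Convex ℝ {t : ℝ | (t, u) ∈ U} := by
  have h := hfib.image Prod.fst continuous_fst.continuousOn
  have heq : Prod.fst '' ((U : Set (Space m)) ∩ Prod.snd ⁻¹' {u}) = {t : ℝ | (t, u) ∈ U} := by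
    ext t
    constructor
    · rintro ⟨⟨s, v⟩, ⟨h1, h2⟩, rfl⟩
      obtain rfl : v = u := h2
      exact h1
    · exact fun ht => ⟨(t, u), ⟨ht, rfl⟩, rfl⟩
  rw [heq] at h
  exact h.ordConnected.convex

/-- Openness of U gives constant local sections, and convexity of the fibers allows them to be
glued. -/
theorem exists_smooth_section (hconv : ∀ u : Fin m → ℝ, Convex ℝ {t : ℝ | (t, u) ∈ U}) :
    ∃ σ : (Fin m → ℝ) → ℝ, ContDiffOn ℝ ∞ σ (projImage U) ∧ ∀ u ∈ projImage U, (σ u, u) ∈ U := by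
  refine exists_contDiffOn_forall_mem_convex (projImage U) (fun u => {t : ℝ | (t, u) ∈ U}) hconv
    fun u hu => ?_
  obtain ⟨t, ht⟩ := exists_of_mem_projImage hu
  have hc : Continuous fun v : Fin m → ℝ => ((t, v) : Space m) := by fun_prop
  exact ⟨_, (U.isOpen.preimage hc).mem_nhds ht, fun _ => t, contDiffOn_const, fun y hy => hy⟩

theorem segment_mem (hconv : ∀ u : Fin m → ℝ, Convex ℝ {t : ℝ | (t, u) ∈ U}) {a b : ℝ}
    {u : Fin m → ℝ} (ha : (a, u) ∈ U) (hb : (b, u) ∈ U) {s : ℝ} (hs : s ∈ Icc (0 : ℝ) 1) :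
    (a + s * (b - a), u) ∈ U := by
  have h := hconv u ha hb (sub_nonneg.2 hs.2) hs.1 (sub_add_cancel 1 s)
  have he : (1 - s) • a + s • b = a + s * (b - a) := by
    simp only [smul_eq_mul]
    ring
  rwa [he] at h

theorem hasDerivAt_slice (f : SmoothMaps U F) {t : ℝ} {u : Fin m → ℝ} (h : (t, u) ∈ U) :
    HasDerivAt (fun s : ℝ => f.1 (s, u)) (fderiv ℝ f.1 (t, u) (ddt m)) t := by
  have h2 : HasDerivAt (fun s : ℝ => ((s, u) : Space m)) (ddt m) t :=
    (hasDerivAt_id t).prodMk (hasDerivAt_const t u)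
  exact (SmoothMaps.differentiableAt f h).hasFDerivAt.comp_hasDerivAt t h2

theorem isOpen_fiber (U : Opens (Space m)) (u : Fin m → ℝ) : IsOpen {t : ℝ | (t, u) ∈ U} :=
  U.isOpen.preimage (by fun_prop : Continuous fun t : ℝ => ((t, u) : Space m))

/-- Smooth functions on `U` have primitives with respect to `t`. -/
theorem exists_dT_eq [CompleteSpace F]
    (hconv : ∀ u : Fin m → ℝ, Convex ℝ {t : ℝ | (t, u) ∈ U}) (f : SmoothMaps U F) :
    ∃ g : SmoothMaps U F, dT U F g = f := by
  obtain ⟨σ, hσ, hσU⟩ := exists_smooth_section hconv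
  -- The primitive is the integral over r from σ(u) to t; substituting r = σ(u) + s (t - σ(u)) fixes
  -- the interval to [0, 1], where smooth dependence on parameters applies.
  let path : Space m × ℝ → Space m := fun z => (σ z.1.2 + z.2 * (z.1.1 - σ z.1.2), z.1.2)
  let D : Set (Space m × ℝ) := (U : Set (Space m)) ×ˢ univ
  have hD : IsOpen D := U.isOpen.prod isOpen_univ
  have hσD : ContDiffOn ℝ ∞ (fun z : Space m × ℝ => σ z.1.2) D :=
    hσ.comp (by fun_prop) fun z hz => snd_mem_projImage hz.1
  have hpath : ContDiffOn ℝ ∞ path D := by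
    refine ContDiffOn.prodMk (hσD.add (ContDiffOn.mul ?_ (ContDiffOn.sub ?_ hσD))) ?_ <;>
      exact ContDiff.contDiffOn (by fun_prop)
  have hW : IsOpen (D ∩ path ⁻¹' U) := hpath.continuousOn.isOpen_inter_preimage hD U.isOpen
  have hmem : ∀ x ∈ (U : Set (Space m)), ∀ s ∈ Icc (0 : ℝ) 1, (x, s) ∈ D ∩ path ⁻¹' U :=
    fun x hx s hs => ⟨⟨hx, mem_univ s⟩, segment_mem hconv (hσU _ (snd_mem_projImage hx)) hx hs⟩
  have hsm : ContDiffOn ℝ ∞ (fun x : Space m => ∫ s in (0 : ℝ)..1, f.1 (path (x, s))) U :=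
    contDiffOn_integral (g := fun z => f.1 (path z)) U.isOpen hW
      ((SmoothMaps.contDiffOn f).comp (hpath.mono inter_subset_left) fun z hz => hz.2) hmem
  have hσU' : ContDiffOn ℝ ∞ (fun x : Space m => x.1 - σ x.2) U :=
    contDiff_fst.contDiffOn.sub (hσ.comp contDiff_snd.contDiffOn fun x hx => snd_mem_projImage hx)
  let G : SmoothMaps U F := SmoothMaps.mk U
    (fun x => (x.1 - σ x.2) • ∫ s in (0 : ℝ)..1, f.1 (path (x, s))) (hσU'.smul hsm)
  refine ⟨G, SmoothMaps.ext fun x hx => ?_⟩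
  obtain ⟨t, u⟩ := x
  have hu := snd_mem_projImage hx
  have hG : ∀ s : ℝ, (s, u) ∈ U → G.1 (s, u) = ∫ r in (σ u)..s, f.1 (r, u) := by
    intro s hs
    have h1 : G.1 (s, u) = (s - σ u) • ∫ r in (0 : ℝ)..1, f.1 (path ((s, u), r)) :=
      SmoothMaps.mk_apply (hf := hσU'.smul hsm) hs
    have h2 := intervalIntegral.smul_integral_comp_add_mul (a := 0) (b := 1)
      (fun r => f.1 (r, u)) (s - σ u) (σ u)
    rw [mul_zero, add_zero, mul_one, add_sub_cancel] at h2
    rw [h1, ← h2]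
    simp only [path, mul_comm]
  have hcont : ContinuousOn (fun r : ℝ => f.1 (r, u)) {r : ℝ | (r, u) ∈ U} :=
    fun r hr => (hasDerivAt_slice f hr).continuousAt.continuousWithinAt
  have hsub : uIcc (σ u) t ⊆ {r : ℝ | (r, u) ∈ U} :=
    (hconv u).ordConnected.uIcc_subset (hσU u hu) hx
  have h3 : HasDerivAt (fun s => ∫ r in (σ u)..s, f.1 (r, u)) (f.1 (t, u)) t :=
    intervalIntegral.integral_hasDerivAt_right (hcont.mono hsub).intervalIntegrable
      (hcont.stronglyMeasurableAtFilter (isOpen_fiber U u) t hx)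
      (hasDerivAt_slice f hx).continuousAt
  have h4 := hasDerivAt_slice G hx
  have h5 : (fun s : ℝ => G.1 (s, u)) =ᶠ[nhds t] fun s => ∫ r in (σ u)..s, f.1 (r, u) :=
    Filter.eventually_of_mem ((isOpen_fiber U u).mem_nhds hx) hG
  rw [dT_apply _ hx]
  exact (h5.hasDerivAt_iff.1 h4).unique h3

theorem eq_of_dT_eq_zero (hconv : ∀ u : Fin m → ℝ, Convex ℝ {t : ℝ | (t, u) ∈ U})
    {f : SmoothMaps U F} (hf : dT U F f = 0) {a b : ℝ} {u : Fin m → ℝ} (ha : (a, u) ∈ U)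
    (hb : (b, u) ∈ U) : f.1 (a, u) = f.1 (b, u) := by
  refine (isOpen_fiber U u).is_const_of_deriv_eq_zero (hconv u).isPreconnected
    (f := fun s => f.1 (s, u))
    (fun r hr => (hasDerivAt_slice f hr).differentiableAt.differentiableWithinAt)
    (fun r hr => ?_) ha hb
  rw [(hasDerivAt_slice f hr).deriv, ← dT_apply f hr, hf]
  rfl

/-- The pullback of a smooth function on `p(U)`. -/
def pull {g : (Fin m → ℝ) → F} (hg : ContDiffOn ℝ ∞ g (projImage U)) : SmoothMaps U F :=
  SmoothMaps.mk U (fun x => g x.2)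
    (hg.comp contDiff_snd.contDiffOn fun _ hx => snd_mem_projImage hx)

variable {g : (Fin m → ℝ) → F} (hg : ContDiffOn ℝ ∞ g (projImage U))

theorem pull_apply {x : Space m} (hx : x ∈ U) : (pull hg).1 x = g x.2 :=
  SmoothMaps.mk_apply
    (hf := hg.comp contDiff_snd.contDiffOn fun _ hx => snd_mem_projImage hx) hx

theorem fderiv_pull {x : Space m} (hx : x ∈ U) (v : Space m) :
    fderiv ℝ (pull hg).1 x v = fderiv ℝ g x.2 v.2 := by
  rw [SmoothMaps.fderiv_congr (fun y hy => pull_apply hg hy) hx]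
  have h1 : HasFDerivAt g (fderiv ℝ g x.2) x.2 :=
    ((hg.contDiffAt ((projImage U).isOpen.mem_nhds (snd_mem_projImage hx))).differentiableAt
      (by simp)).hasFDerivAt
  have h2 := (h1.comp x (hasFDerivAt_snd (𝕜 := ℝ) (p := x))).fderiv
  exact congrArg (fun A => A v) h2

theorem dT_pull : dT U F (pull hg) = 0 :=
  SmoothMaps.ext fun x hx => by
    rw [dT_apply _ hx, fderiv_pull hg hx]
    exact map_zero _

theorem dE_pull_apply {x : Space m} (hx : x ∈ U) :
    (dE U F (pull hg)).1 x = fderiv ℝ g x.2 x.2 := by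
  rw [dE_apply _ hx, fderiv_pull hg hx]
  rfl

theorem taylorPart_pull (j : ℕ) {t : ℝ} (ht : t ∈ axisFiber U) (x : Space m) :
    taylorPart j (pull hg).1 (t, 0) (euler x) = taylorPart j g 0 x.2 := by
  rw [taylorPart_congr_of_isOpen U.isOpen (fun y hy => pull_apply hg hy) (x := (t, 0)) ht]
  exact taylorPart_comp_clm (ContinuousLinearMap.snd ℝ ℝ (Fin m → ℝ)) (projImage U).isOpen hg j
    (x := (t, 0)) (snd_mem_projImage (U := U) ht) (euler x)

/-- A smooth function which does not depend on `t` is pulled back from `p(U)`. -/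
theorem exists_pull_eq (hconv : ∀ u : Fin m → ℝ, Convex ℝ {t : ℝ | (t, u) ∈ U})
    {f : SmoothMaps U F} (hf : dT U F f = 0) :
    ∃ (g : (Fin m → ℝ) → F) (hg : ContDiffOn ℝ ∞ g (projImage U)), f = pull hg := by
  obtain ⟨σ, hσ, hσU⟩ := exists_smooth_section hconv
  have hg : ContDiffOn ℝ ∞ (fun u => f.1 (σ u, u)) (projImage U) :=
    (SmoothMaps.contDiffOn f).comp (hσ.prodMk contDiffOn_id) hσU
  refine ⟨_, hg, SmoothMaps.ext fun x hx => ?_⟩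
  rw [pull_apply hg hx]
  exact eq_of_dT_eq_zero hconv hf hx (hσU _ (snd_mem_projImage hx))

/-- A homogeneous field not depending on `t` vanishes if its Taylor part of the same degree
does. -/
theorem eq_zero_of_homogeneous [CompleteSpace F]
    (hconv : ∀ u : Fin m → ℝ, Convex ℝ {t : ℝ | (t, u) ∈ U})
    (hstar : StarConvex ℝ 0 (projImage U : Set (Fin m → ℝ))) {j : ℕ} {q : SmoothMaps U F}
    (hT : dT U F q = 0) (hE : dE U F q = (j : ℝ) • q) {t : ℝ} (ht : t ∈ axisFiber U)
    (h0 : ∀ x, taylorPart j q.1 (t, 0) (euler x) = 0) : q = 0 := by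
  -- The field descends to the star-shaped set p(U), where homogeneity forces it to equal its Taylor
  -- part at 0.
  obtain ⟨g, hg, rfl⟩ := exists_pull_eq hconv hT
  refine SmoothMaps.ext fun x hx => ?_
  rw [pull_apply hg hx, eq_taylorPart_of_euler_eq (projImage U).isOpen hstar j hg
    (fun u hu => ?_) (snd_mem_projImage hx), ← taylorPart_pull hg j ht, h0]
  · rfl
  · obtain ⟨s, hs⟩ := exists_of_mem_projImage hu
    have h1 := dE_pull_apply hg hs
    rw [hE, SmoothMaps.smul_apply, pull_apply hg hs] at h1
    exact h1.symm

end Projection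

/-! ### Exactness of cocycles with trivial Taylor class -/

section Exactness

variable {m k : ℕ} {U : Opens (Space m)}

/-- The horizontal part `b` of `μ = ∂_t ∧ a + b`. -/
def hor (U : Opens (Space m)) (k : ℕ) : MultivectorField U k →ₗ[ℝ] MultivectorField U k :=
  (Horizontal U k).subtype ∘ₗ uPart U k

theorem hor_mem (f : MultivectorField U k) : hor U k f ∈ Horizontal U k := (uPart U k f).2

theorem hor_zero (f : MultivectorField U 0) : hor U 0 f = f := uPart_zero f

theorem hor_succ (f : MultivectorField U (k + 1)) : hor U (k + 1) f = f - wT U k (iT U k f) := rfl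

theorem hor_of_mem {f : MultivectorField U k} (h : f ∈ Horizontal U k) : hor U k f = f := by
  cases k with
  | zero => exact hor_zero f
  | succ k => rw [hor_succ, mem_horizontal_succ.1 h, map_zero, sub_zero]

/-- Quotients and primitives obtained by gluing and integration need not be horizontal. Projecting
them does not affect ∂_t ∧ f, and it commutes with E ∧ ⋅. -/
theorem wT_hor (f : MultivectorField U k) : wT U k (hor U k f) = wT U k f := by
  cases k with
  | zero => rw [hor_zero]
  | succ k => rw [hor_succ, map_sub, wT_wT, sub_zero]

theorem wE_hor (f : MultivectorField U k) : wE U k (hor U k f) = hor U (k + 1) (wE U k f) := by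
  cases k with
  | zero => rw [hor_zero, hor_of_mem (wE_mem_horizontal (mem_horizontal_zero f))]
  | succ k => rw [hor_succ, hor_succ, map_sub, wE_wT, iT_wE, map_neg]

theorem wT_injective_of_mem {f : MultivectorField U k} (hf : f ∈ Horizontal U k)
    (h : wT U k f = 0) : f = 0 := by
  have h1 := (parts_eq hf (Submodule.zero_mem (Horizontal U (k + 1)))).1
  rw [add_zero, h, map_zero] at h1
  exact h1.symm

theorem eq_zero_of_degree_gt {f : MultivectorField U k} (hf : f ∈ Horizontal U k) (h : m < k) :
    f = 0 :=
  SmoothMaps.ext fun x _ => eq_zero_of_lt (horizontal_apply ⟨f, hf⟩ x) h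

theorem wE_axis (f : MultivectorField U k) (t : ℝ) : (wE U k f).1 (t, 0) = 0 := by
  rw [wE_apply]
  exact wedge_zero_left _

theorem dE_axis {F : Type} [NormedAddCommGroup F] [NormedSpace ℝ F] (f : SmoothMaps U F) (t : ℝ) :
    (dE U F f).1 (t, 0) = 0 := by
  by_cases ht : ((t, 0) : Space m) ∈ U
  · rw [dE_apply _ ht]
    exact map_zero _
  · exact (dE U F f).2.2 _ ht

/-- The differential of h accounts for (E - k) h. The remainder a' is E ∧ c by division, and with
∂_t A = c the field ∂_t ∧ A has differential ∂_t ∧ E ∧ c. In degree 0 division makes the remainder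
zero. -/
theorem exists_bookDifferential_eq_wT_of_homotopy (hm : 0 < m)
    (hconv : ∀ u : Fin m → ℝ, Convex ℝ {t : ℝ | (t, u) ∈ U})
    {a a' h : MultivectorField U k} (hh : wE U k (dT U _ h) = 0)
    (ha' : a = (dE U _ h - (k : ℝ) • h) + a') (hE : wE U k a' = 0)
    (hax : k = m → ∀ t : ℝ, (hor U k a').1 (t, 0) = 0) :
    ∃ ν : MultivectorField U k, bookDifferential U k ν = wT U k a := by
  have h1 : bookDifferential U k h = wT U k (dE U _ h - (k : ℝ) • h) := by
    rw [bookDifferential_eq, hh, sub_zero]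
  suffices ∃ ν : MultivectorField U k, bookDifferential U k ν = wT U k a' by
    obtain ⟨ν, hν⟩ := this
    exact ⟨h + ν, by rw [map_add, h1, hν, ha', map_add]⟩
  have hE' : wE U k (hor U k a') = 0 := by rw [wE_hor, hE, map_zero]
  rw [← wT_hor]
  cases k with
  | zero => exact ⟨0, by rw [eq_zero_of_wE_eq_zero hm hE', map_zero, map_zero]⟩
  | succ k =>
    obtain ⟨c, hc⟩ := exists_wE_eq (hor_mem a') hE' hax
    obtain ⟨A, hA⟩ := exists_dT_eq hconv c
    exact ⟨wT U k A, by rw [bookDifferential_wT, hA, hc]⟩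

/-- In degree m wedging with E kills every horizontal field, but division also requires vanishing on
the axis. With h = -a/m the remainder is E(a)/m, which does vanish there. -/
theorem exists_bookDifferential_eq_wT_top (hm : 0 < m)
    (hconv : ∀ u : Fin m → ℝ, Convex ℝ {t : ℝ | (t, u) ∈ U}) {a : MultivectorField U m}
    (ha : a ∈ Horizontal U m) : ∃ ν : MultivectorField U m, bookDifferential U m ν = wT U m a := by
  have hm' : (m : ℝ) ≠ 0 := by exact_mod_cast hm.ne'
  have hdE : (m : ℝ)⁻¹ • dE U _ a ∈ Horizontal U m :=
    Submodule.smul_mem _ _ (dE_mem_horizontal ha)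
  refine exists_bookDifferential_eq_wT_of_homotopy hm hconv (h := -((m : ℝ)⁻¹ • a))
    (a' := (m : ℝ)⁻¹ • dE U _ a) ?_ ?_ ?_ fun _ t => ?_
  · exact eq_zero_of_degree_gt (wE_mem_horizontal (dT_mem_horizontal
      (Submodule.neg_mem _ (Submodule.smul_mem _ _ ha)))) (Nat.lt_succ_self m)
  · rw [map_neg, map_smul, smul_neg, smul_smul, mul_inv_cancel₀ hm', one_smul]
    abel
  · exact eq_zero_of_degree_gt (wE_mem_horizontal hdE) (Nat.lt_succ_self m)
  · rw [hor_of_mem hdE, SmoothMaps.smul_apply, dE_axis, smul_zero]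

theorem exists_bookDifferential_eq_wT (hm : 0 < m)
    (hconv : ∀ u : Fin m → ℝ, Convex ℝ {t : ℝ | (t, u) ∈ U})
    (hstar : StarConvex ℝ 0 (projImage U : Set (Fin m → ℝ))) {a : MultivectorField U k}
    (ha : a ∈ Horizontal U k) (haE : wE U k (dT U _ a) = 0) {t : ℝ} (ht : t ∈ axisFiber U)
    (h0 : ∀ x, wedge (euler x) (taylorPart k a.1 (t, 0) (euler x)) = 0) :
    ∃ ν : MultivectorField U k, bookDifferential U k ν = wT U k a := by
  by_cases hkm : k = m
  · subst hkm
    exact exists_bookDifferential_eq_wT_top hm hconv ha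
  obtain ⟨σ, hσ, hσU⟩ := exists_smooth_section hconv
  have hg : ContDiffOn ℝ ∞ (fun u => a.1 (σ u, u)) (projImage U) :=
    (SmoothMaps.contDiffOn a).comp (hσ.prodMk contDiffOn_id) hσU
  obtain ⟨h, hh, hhe⟩ := exists_euler_sub_eq (projImage U).isOpen hstar k hg
  -- E ∧ a does not depend on t, so it may be computed from the values of a along the section σ.
  have hEa : wE U k a = wE U k (pull hg) := by
    refine SmoothMaps.ext fun x hx => ?_
    have h1 : dT U _ (wE U k a) = 0 := by rw [dT_wE, haE]
    rw [wE_apply, wE_apply, pull_apply hg hx]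
    exact eq_of_dT_eq_zero hconv h1 (a := x.1) (u := x.2) hx (hσU _ (snd_mem_projImage hx))
  -- Although g need not have the Taylor part of a on the axis, E ∧ T^k g and E ∧ T^k a are both the
  -- degree k + 1 part of E ∧ a.
  have hw : ∀ x, wedge (euler x) (taylorPart k (fun u => a.1 (σ u, u)) 0 x.2) = 0 := by
    intro x
    rw [← taylorPart_pull hg k ht, ← taylorPart_wE _ ht, ← hEa, taylorPart_wE _ ht, h0]
  refine exists_bookDifferential_eq_wT_of_homotopy hm hconv (h := pull hh)
    (a' := a - (dE U _ (pull hh) - (k : ℝ) • pull hh)) ?_ (add_sub_cancel _ _).symm ?_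
    fun h => absurd h hkm
  · rw [dT_pull, map_zero]
  · rw [map_sub, hEa, ← map_sub]
    refine SmoothMaps.ext fun x hx => ?_
    rw [wE_apply, SmoothMaps.sub_apply, SmoothMaps.sub_apply, SmoothMaps.smul_apply,
      pull_apply hg hx, pull_apply hh hx, dE_pull_apply hh hx, hhe _ (snd_mem_projImage hx),
      sub_sub_cancel, hw]
    rfl

/-- The cocycle equations make E ∧ b independent of t and homogeneous of degree k + 1, one more than
k because E differentiates the coefficients of E too. It is thus its own Taylor part, E ∧ T^k b = 0.
-/
theorem wE_eq_zero_of_cocycle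
    (hconv : ∀ u : Fin m → ℝ, Convex ℝ {t : ℝ | (t, u) ∈ U})
    (hstar : StarConvex ℝ 0 (projImage U : Set (Fin m → ℝ))) {b : MultivectorField U k}
    (hb : wE U k (dT U _ b) = 0) (hbE : wE U k (dE U _ b) = (k : ℝ) • wE U k b) {t : ℝ}
    (ht : t ∈ axisFiber U)
    (h0 : ∀ x, wedge (euler x) (taylorPart k b.1 (t, 0) (euler x)) = 0) : wE U k b = 0 := by
  refine eq_zero_of_homogeneous hconv hstar (j := k + 1) (by rw [dT_wE, hb]) ?_ ht fun x => ?_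
  · rw [dE_wE, hbE, Nat.cast_succ, add_smul, one_smul]
  · rw [taylorPart_wE _ ht, h0]

/-- In degree 0 there are no coboundaries, so triviality of the class means vanishing: E ∧ μ = 0 by
homogeneity, and division in degree 0 applies. -/
theorem eq_zero_of_cocycle_zero (hm : 0 < m)
    (hconv : ∀ u : Fin m → ℝ, Convex ℝ {t : ℝ | (t, u) ∈ U})
    (hstar : StarConvex ℝ 0 (projImage U : Set (Fin m → ℝ))) {μ : MultivectorField U 0}
    (hμ : bookDifferential U 0 μ = 0) {t : ℝ} (ht : t ∈ axisFiber U)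
    (h0 : ∀ x, wedge (euler x) (taylorPart 0 (uPart U 0 μ).1.1 (t, 0) (euler x)) = 0) :
    μ = 0 := by
  have h1 := uPart_bookDifferential μ
  have h2 := dtPart_bookDifferential_zero μ
  rw [hμ, map_zero, uPart_zero, eq_comm, ZeroMemClass.coe_zero, neg_eq_zero] at h1
  rw [hμ, map_zero, ZeroMemClass.coe_zero, eq_comm, sub_eq_zero] at h2
  rw [uPart_zero] at h0
  refine eq_zero_of_wE_eq_zero hm (wE_eq_zero_of_cocycle hconv hstar h1 ?_ ht h0)
  rw [h2, map_smul]

theorem exists_sub_eq_wT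
    (hconv : ∀ u : Fin m → ℝ, Convex ℝ {t : ℝ | (t, u) ∈ U})
    (hstar : StarConvex ℝ 0 (projImage U : Set (Fin m → ℝ))) {μ : MultivectorField U (k + 1)}
    (hμ : bookDifferential U (k + 1) μ = 0) {t : ℝ} (ht : t ∈ axisFiber U)
    (h0 : ∀ x, wedge (euler x) (taylorPart (k + 1) (uPart U (k + 1) μ).1.1 (t, 0) (euler x)) = 0) :
    ∃ (ν a : MultivectorField U k), μ - bookDifferential U k ν = wT U k a := by
  have h1 := uPart_bookDifferential μ
  have h2 := dtPart_bookDifferential_succ μ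
  rw [hμ, map_zero, eq_comm, ZeroMemClass.coe_zero, neg_eq_zero] at h1
  rw [hμ, map_zero, ZeroMemClass.coe_zero] at h2
  have hbE : wE U (k + 1) (dE U _ (uPart U (k + 1) μ).1) =
      ((k + 1 : ℕ) : ℝ) • wE U (k + 1) (uPart U (k + 1) μ).1 := by
    have h3 := congrArg (wE U (k + 1)) h2
    rw [map_add, wE_wE, zero_add, map_sub, map_smul, map_zero, eq_comm, sub_eq_zero] at h3
    exact h3
  have hEb := wE_eq_zero_of_cocycle hconv hstar h1 hbE ht h0
  -- On the axis E ∧ ∂_t a and E(b) vanish, so the ∂_t-component of the cocycle equation leaves only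
  -- -(k + 1) b = 0.
  have hax : ∀ t : ℝ, (uPart U (k + 1) μ).1.1 (t, 0) = 0 := by
    intro s
    have h3 := congrArg (fun f => f.1 (s, 0)) h2
    simp only [SmoothMaps.add_apply, SmoothMaps.sub_apply, SmoothMaps.smul_apply] at h3
    rw [wE_axis, dE_axis, zero_add, zero_sub, SmoothMaps.zero_apply, eq_comm, neg_eq_zero,
      smul_eq_zero] at h3
    exact h3.resolve_left (by positivity)
  obtain ⟨c, hc⟩ := exists_wE_eq (uPart U (k + 1) μ).2 hEb fun _ => hax
  -- With ∂_t ν = -c the term -E ∧ ∂_t ν of the differential equals E ∧ c = b.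
  obtain ⟨ν, hν⟩ := exists_dT_eq hconv (-c)
  obtain ⟨a, ha⟩ : ∃ a : MultivectorField U k, a = (dtPart U (k + 1) μ).1 := ⟨_, rfl⟩
  refine ⟨ν, a - (dE U _ ν - (k : ℝ) • ν), ?_⟩
  conv_lhs => rw [eq_wT_add μ]
  rw [bookDifferential_eq, hν, map_neg, hc, ← ha, map_sub, map_sub, map_sub]
  abel

/-- A cocycle whose Taylor part is annihilated by `E ∧ ⋅` is exact. -/
theorem exists_bookDifferential_eq (hm : 0 < m)
    (hconv : ∀ u : Fin m → ℝ, Convex ℝ {t : ℝ | (t, u) ∈ U})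
    (hstar : StarConvex ℝ 0 (projImage U : Set (Fin m → ℝ))) {μ : MultivectorField U (k + 1)}
    (hμ : bookDifferential U (k + 1) μ = 0) {t : ℝ} (ht : t ∈ axisFiber U)
    (hb : ∀ x, wedge (euler x) (taylorPart (k + 1) (uPart U (k + 1) μ).1.1 (t, 0) (euler x)) = 0)
    (ha : ∀ x, wedge (euler x) (taylorPart k (dtPart U (k + 1) μ).1.1 (t, 0) (euler x)) = 0) :
    ∃ ν : MultivectorField U k, bookDifferential U k ν = μ := by
  obtain ⟨ν, a₀, hν⟩ := exists_sub_eq_wT hconv hstar hμ ht hb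
  rw [← wT_hor] at hν
  have hdt : hor U k a₀ =
      (dtPart U (k + 1) μ).1 - (dtPart U (k + 1) (bookDifferential U k ν)).1 := by
    have h1 := (parts_eq (hor_mem a₀) (Submodule.zero_mem (Horizontal U (k + 1)))).1
    rw [add_zero, ← hν, map_sub] at h1
    exact h1.symm
  have hd : wE U k (dT U _ (hor U k a₀)) = 0 := by
    refine wT_injective_of_mem (wE_mem_horizontal (dT_mem_horizontal (hor_mem a₀))) ?_
    rw [← bookDifferential_wT, ← hν, map_sub, hμ, zero_sub, neg_eq_zero]
    exact LinearMap.congr_fun (bookDifferential_comp U k) ν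
  -- Subtracting dν preserves the Taylor hypothesis on a: the degree k part of the ∂_t-component of
  -- dν is 0 or of the form E ∧ ⋅, and E ∧ E = 0.
  have htaylor : ∀ x, wedge (euler x)
      (taylorPart k (dtPart U (k + 1) (bookDifferential U k ν)).1.1 (t, 0) (euler x)) = 0 := by
    intro x
    cases k with
    | zero =>
      rw [dtPart_bookDifferential_zero, taylorPart_euler_sub ν ht, map_zero]
    | succ k =>
      have h1 : taylorPart (k + 1) (dtPart U (k + 2) (bookDifferential U (k + 1) ν)).1.1 (t, 0)
          (euler x) = wedge (euler x)
            (taylorPart k (dT U _ (dtPart U (k + 1) ν).1).1 (t, 0) (euler x)) := by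
        rw [dtPart_bookDifferential_succ, taylorPart_field_add _ _ _ ht, taylorPart_euler_sub _ ht,
          add_zero, taylorPart_wE _ ht]
        rfl
      exact (congrArg (wedge (euler x)) h1).trans (wedge_wedge_self _ _)
  obtain ⟨ν', hν'⟩ := exists_bookDifferential_eq_wT hm hconv hstar (hor_mem a₀) hd ht fun x => by
    rw [hdt]
    have h1 := taylorPart_field_sub (dtPart U (k + 1) μ).1
      (dtPart U (k + 1) (bookDifferential U k ν)).1 k ht (euler x)
    refine (congrArg (wedge (euler x)) h1).trans ?_
    rw [map_sub]
    exact (congrArg₂ _ (ha x) (htaylor x)).trans (sub_zero 0)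
  exact ⟨ν + ν', by rw [map_add, hν', ← hν, add_sub_cancel]⟩

theorem exists_bookDifferential_eq_top (hm : 0 < m)
    (hconv : ∀ u : Fin m → ℝ, Convex ℝ {t : ℝ | (t, u) ∈ U}) (μ : MultivectorField U (m + 1)) :
    ∃ ν : MultivectorField U m, bookDifferential U m ν = μ := by
  obtain ⟨ν, hν⟩ := exists_bookDifferential_eq_wT_top hm hconv (dtPart U (m + 1) μ).2
  refine ⟨ν, hν.trans ?_⟩
  conv_rhs => rw [eq_wT_add μ, eq_zero_of_degree_gt (uPart U (m + 1) μ).2 (Nat.lt_succ_self m),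
    add_zero]

end Exactness

/-! ### Cohomology of complexes of real vector spaces, in terms of elements -/

section Cohomology

variable {K L : CochainComplex (ModuleCat.{0} ℝ) ℕ} (φ : K ⟶ L)

/-- The criterion tests cocycles with values in a module A, up to an epimorphism onto A. The
pullback P of pairs (element of A, primitive of its image) surjects onto A, so primitives need not
be chosen linearly. The epimorphism criterion works in the same way. -/
theorem mono_homologyMap_of_forall (i j k : ℕ) (hi : (ComplexShape.up ℕ).prev j = i)
    (hk : (ComplexShape.up ℕ).next j = k)
    (h : ∀ x : K.X j, K.d j k x = 0 → ∀ y : L.X i, φ.f j x = L.d i j y →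
      ∃ x' : K.X i, K.d i j x' = x) : Mono (HomologicalComplex.homologyMap φ j) := by
  rw [HomologicalComplex.mono_homologyMap_iff_up_to_refinements φ i j k hi hk]
  intro A x hx y hxy
  let P : Submodule ℝ (A × K.X i) := LinearMap.eqLocus
    (x.hom ∘ₗ LinearMap.fst ℝ A (K.X i)) ((K.d i j).hom ∘ₗ LinearMap.snd ℝ A (K.X i))
  let p : P →ₗ[ℝ] A := LinearMap.fst ℝ A (K.X i) ∘ₗ P.subtype
  let q : P →ₗ[ℝ] K.X i := LinearMap.snd ℝ A (K.X i) ∘ₗ P.subtype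
  refine ⟨ModuleCat.of ℝ P, ModuleCat.ofHom p, ?_, ModuleCat.ofHom q, ?_⟩
  · rw [ModuleCat.epi_iff_surjective]
    intro a
    obtain ⟨x', hx'⟩ := h (x a) (by simpa using ConcreteCategory.congr_hom hx a) (y a)
      (by simpa using ConcreteCategory.congr_hom hxy a)
    exact ⟨⟨(a, x'), hx'.symm⟩, rfl⟩
  · ext a
    exact a.2

theorem epi_homologyMap_of_forall (i j k : ℕ) (hi : (ComplexShape.up ℕ).prev j = i)
    (hk : (ComplexShape.up ℕ).next j = k)
    (h : ∀ y : L.X j, L.d j k y = 0 → ∃ x : K.X j, K.d j k x = 0 ∧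
      ∃ y' : L.X i, y = φ.f j x + L.d i j y') : Epi (HomologicalComplex.homologyMap φ j) := by
  rw [HomologicalComplex.epi_homologyMap_iff_up_to_refinements φ i j k hi hk]
  intro A y hy
  let p₁ : A × K.X j × L.X i →ₗ[ℝ] A := LinearMap.fst ℝ _ _
  let p₂ : A × K.X j × L.X i →ₗ[ℝ] K.X j := LinearMap.fst ℝ _ _ ∘ₗ LinearMap.snd ℝ _ _
  let p₃ : A × K.X j × L.X i →ₗ[ℝ] L.X i := LinearMap.snd ℝ _ _ ∘ₗ LinearMap.snd ℝ _ _
  let P : Submodule ℝ (A × K.X j × L.X i) := LinearMap.ker ((K.d j k).hom ∘ₗ p₂) ⊓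
    LinearMap.eqLocus (y.hom ∘ₗ p₁) ((φ.f j).hom ∘ₗ p₂ + (L.d i j).hom ∘ₗ p₃)
  refine ⟨ModuleCat.of ℝ P, ModuleCat.ofHom (p₁ ∘ₗ P.subtype), ?_,
    ModuleCat.ofHom (p₂ ∘ₗ P.subtype), ?_, ModuleCat.ofHom (p₃ ∘ₗ P.subtype), ?_⟩
  · rw [ModuleCat.epi_iff_surjective]
    intro a
    obtain ⟨x, hx, y', hy'⟩ := h (y a) (by simpa using ConcreteCategory.congr_hom hy a)
    exact ⟨⟨(a, x, y'), hx, hy'⟩, rfl⟩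
  · ext a
    exact a.2.1
  · ext a
    exact a.2.2

theorem isZero_homology_of_forall (i j k : ℕ) (hi : (ComplexShape.up ℕ).prev j = i)
    (hk : (ComplexShape.up ℕ).next j = k)
    (h : ∀ x : K.X j, K.d j k x = 0 → ∃ x' : K.X i, K.d i j x' = x) :
    Limits.IsZero (K.homology j) := by
  rw [← HomologicalComplex.exactAt_iff_isZero_homology, K.exactAt_iff' i j k hi hk,
    ShortComplex.moduleCat_exact_iff]
  exact h

variable {X Y : ℕ → Type} [∀ k, AddCommGroup (X k)] [∀ k, Module ℝ (X k)]
  [∀ k, AddCommGroup (Y k)] [∀ k, Module ℝ (Y k)]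
  {d : ∀ k, X k →ₗ[ℝ] X (k + 1)} {hd : ∀ k, d (k + 1) ∘ₗ d k = 0}
  {e : ∀ k, Y k →ₗ[ℝ] Y (k + 1)} {he : ∀ k, e (k + 1) ∘ₗ e k = 0}

theorem cochainComplex_d (k : ℕ) : (cochainComplex d hd).d k (k + 1) = ModuleCat.ofHom (d k) := by
  simp only [cochainComplex, CochainComplex.of_d]

theorem isZero_homology_cochainComplex_succ (k : ℕ)
    (h : ∀ x, d (k + 1) x = 0 → ∃ x', d k x' = x) :
    Limits.IsZero ((cochainComplex d hd).homology (k + 1)) := by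
  refine isZero_homology_of_forall k (k + 1) (k + 2) (by simp) (by simp) ?_
  rw [cochainComplex_d, cochainComplex_d]
  exact h

theorem quasiIso_cochainMap (f : ∀ k, X k →ₗ[ℝ] Y k) (hf : ∀ k, e k ∘ₗ f k = f (k + 1) ∘ₗ d k)
    (hinj₀ : ∀ x, d 0 x = 0 → f 0 x = 0 → x = 0)
    (hinj : ∀ k x, d (k + 1) x = 0 → ∀ y, f (k + 1) x = e k y → ∃ x', d k x' = x)
    (hsurj₀ : ∀ y, e 0 y = 0 → ∃ x, d 0 x = 0 ∧ f 0 x = y)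
    (hsurj : ∀ k y, e (k + 1) y = 0 → ∃ x, d (k + 1) x = 0 ∧ ∃ y', y = f (k + 1) x + e k y') :
    QuasiIso (cochainMap (hd := hd) (he := he) f hf) := by
  rw [quasiIso_iff]
  intro j
  rw [quasiIsoAt_iff_isIso_homologyMap]
  suffices Mono (HomologicalComplex.homologyMap (cochainMap (hd := hd) (he := he) f hf) j) ∧
      Epi (HomologicalComplex.homologyMap (cochainMap (hd := hd) (he := he) f hf) j) by
    obtain ⟨_, _⟩ := this
    exact isIso_of_mono_of_epi _
  cases j with
  | zero =>
    -- `ComplexShape.prev` sends 0 to 0, so the incoming differential in degree 0 is this zero map.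
    have hX : (cochainComplex d hd).d 0 0 = 0 := HomologicalComplex.shape _ _ _ (by simp)
    have hY : (cochainComplex e he).d 0 0 = 0 := HomologicalComplex.shape _ _ _ (by simp)
    constructor
    · refine mono_homologyMap_of_forall _ 0 0 1 (by simp) (by simp) ?_
      rw [cochainComplex_d, hX, hY]
      intro x hx y hxy
      exact ⟨0, (hinj₀ x hx hxy).symm⟩
    · refine epi_homologyMap_of_forall _ 0 0 1 (by simp) (by simp) ?_
      rw [cochainComplex_d, cochainComplex_d, hY]
      intro y hy
      obtain ⟨x, hx, hxy⟩ := hsurj₀ y hy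
      exact ⟨x, hx, 0, hxy.symm.trans (add_zero _).symm⟩
  | succ k =>
    constructor
    · refine mono_homologyMap_of_forall _ k (k + 1) (k + 2) (by simp) (by simp) ?_
      rw [cochainComplex_d, cochainComplex_d, cochainComplex_d]
      exact hinj k
    · refine epi_homologyMap_of_forall _ k (k + 1) (k + 2) (by simp) (by simp) ?_
      rw [cochainComplex_d, cochainComplex_d, cochainComplex_d]
      exact hsurj k

end Cohomology

/-! ### The fields in `𝕎^k` -/

section LinearFields

variable {m k : ℕ} {U : Opens (Space m)}

theorem contDiff_of_mem_WW {w : Space m → Multivector m k} (hw : w ∈ WW m k) : ContDiff ℝ ∞ w := by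
  induction hw using Submodule.span_induction with
  | mem _ h =>
    obtain ⟨⟨I, J⟩, rfl⟩ := h
    have : linearWedge I J = fun x => (∏ s, x.2 (I s)) • basisWedge J :=
      funext (linearWedge_apply I J)
    change ContDiff ℝ ∞ (linearWedge I J)
    rw [this]
    fun_prop
  | zero => exact contDiff_const
  | add _ _ _ _ h₁ h₂ => exact h₁.add h₂
  | smul c _ _ h => exact contDiff_const.smul h

theorem contractDt_of_mem_WW {w : Space m → Multivector m k} (hw : w ∈ WW m k) (x : Space m) :
    contractDt k (w x) = 0 := by
  induction hw using Submodule.span_induction with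
  | mem _ h =>
    obtain ⟨⟨I, J⟩, rfl⟩ := h
    change contractDt k (linearWedge I J x) = 0
    rw [linearWedge_apply, map_smul, contractDt_basisWedge, smul_zero]
  | zero => exact map_zero _
  | add _ _ _ _ h₁ h₂ => rw [Pi.add_apply, map_add, h₁, h₂, add_zero]
  | smul c _ _ h => rw [Pi.smul_apply, map_smul, h, smul_zero]

theorem apply_euler_of_mem_WW {w : Space m → Multivector m k} (hw : w ∈ WW m k) (x : Space m) :
    w (euler x) = w x := by
  induction hw using Submodule.span_induction with
  | mem _ h =>
    obtain ⟨⟨I, J⟩, rfl⟩ := h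
    change linearWedge I J (euler x) = linearWedge I J x
    rw [linearWedge_apply, linearWedge_apply]
    rfl
  | zero => rfl
  | add _ _ _ _ h₁ h₂ => rw [Pi.add_apply, Pi.add_apply, h₁, h₂]
  | smul c _ _ h => rw [Pi.smul_apply, Pi.smul_apply, h]

/-- The coefficients are monomials of degree k in u and do not involve t, so scaling t as well does
no harm. -/
theorem apply_smul_of_mem_WW {w : Space m → Multivector m k} (hw : w ∈ WW m k) (s : ℝ)
    (x : Space m) : w (s • x) = s ^ k • w x := by
  induction hw using Submodule.span_induction with
  | mem _ h =>
    obtain ⟨⟨I, J⟩, rfl⟩ := h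
    change linearWedge I J (s • x) = s ^ k • linearWedge I J x
    rw [linearWedge_apply, linearWedge_apply, smul_smul]
    simp [Finset.prod_mul_distrib]
  | zero => exact (smul_zero _).symm
  | add _ _ _ _ h₁ h₂ => rw [Pi.add_apply, Pi.add_apply, h₁, h₂, smul_add]
  | smul c _ _ h => rw [Pi.smul_apply, Pi.smul_apply, h, smul_comm]

theorem contDiff_WW_slice (w : WW m k) : ContDiff ℝ ∞ fun u : Fin m → ℝ => w.1 (0, u) :=
  (contDiff_of_mem_WW w.2).comp (contDiff_const.prodMk contDiff_id)

theorem fderiv_WW_slice (w : WW m k) (u : Fin m → ℝ) :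
    fderiv ℝ (fun u : Fin m → ℝ => w.1 (0, u)) u u = (k : ℝ) • w.1 (0, u) := by
  have h1 : HasDerivAt (fun s : ℝ => w.1 (0, s • u)) (fderiv ℝ (fun u => w.1 (0, u)) u u) 1 := by
    have h2 : HasDerivAt (fun s : ℝ => s • u) u 1 := by
      simpa using (hasDerivAt_id (1 : ℝ)).smul_const u
    have h3 := ((contDiff_WW_slice w).differentiable (by simp) ((1 : ℝ) • u)).hasFDerivAt
    rw [one_smul] at h3
    -- Euler's relation is the derivative at s = 1 of the homogeneity in s.
    exact HasFDerivAt.comp_hasDerivAt (1 : ℝ) (by rwa [one_smul]) h2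
  have h4 : (fun s : ℝ => w.1 (0, s • u)) = fun s : ℝ => s ^ k • w.1 (0, u) := by
    funext s
    rw [← apply_smul_of_mem_WW w.2, Prod.smul_mk, smul_zero]
  rw [h4] at h1
  have h5 : HasDerivAt (fun s : ℝ => s ^ k • w.1 (0, u)) ((k : ℝ) • w.1 (0, u)) 1 := by
    simpa using (hasDerivAt_pow k (1 : ℝ)).smul_const (w.1 (0, u))
  exact h1.unique h5

/-- The restriction to `U` of an element of `𝕎^k`. -/
def linearField (U : Opens (Space m)) (w : WW m k) : MultivectorField U k :=
  pull (contDiff_WW_slice w).contDiffOn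

theorem linearField_apply (w : WW m k) {x : Space m} (hx : x ∈ U) :
    (linearField U w).1 x = w.1 x := by
  rw [linearField, pull_apply _ hx, ← apply_euler_of_mem_WW w.2 x]
  rfl

theorem linearField_mem_horizontal (w : WW m k) : linearField U w ∈ Horizontal U k :=
  mem_horizontal fun x hx => by rw [linearField_apply w hx, contractDt_of_mem_WW w.2]

theorem dT_linearField (w : WW m k) : dT U _ (linearField U w) = 0 := dT_pull _

theorem dE_linearField (w : WW m k) : dE U _ (linearField U w) = (k : ℝ) • linearField U w :=
  SmoothMaps.ext fun x hx => by
    rw [linearField, dE_pull_apply _ hx, fderiv_WW_slice, SmoothMaps.smul_apply, pull_apply _ hx]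

theorem taylorPart_linearField (w : WW m k) {t : ℝ} (ht : t ∈ axisFiber U) (x : Space m) :
    taylorPart k (linearField U w).1 (t, 0) (euler x) = w.1 x := by
  rw [linearField, taylorPart_pull _ k ht, ← eq_taylorPart_of_euler_eq isOpen_univ (starConvex_univ _) k
    (contDiff_WW_slice w).contDiffOn (fun u _ => fderiv_WW_slice w u) (Set.mem_univ _),
    ← apply_euler_of_mem_WW w.2 x]
  rfl

/-! ### Exactness of `E ∧ ⋅` -/

theorem wE_linearField (w : WW m k) : wE U k (linearField U w) = linearField U (wedgeEuler m k w) :=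
  SmoothMaps.ext fun x hx => by
    rw [wE_apply, linearField_apply _ hx, linearField_apply _ hx]
    rfl

theorem linearField_zero : linearField U (0 : WW m k) = 0 :=
  SmoothMaps.ext fun _ hx => linearField_apply _ hx

theorem wedgeEuler_eq_zero (hm : 0 < m) {w : WW m 0} (hw : wedgeEuler m 0 w = 0) : w = 0 := by
  have h := eq_zero_of_wE_eq_zero (U := ⊤) hm (β := linearField ⊤ w)
    (by rw [wE_linearField, hw, linearField_zero])
  refine Subtype.ext (funext fun x => ?_)
  rw [← linearField_apply (U := ⊤) w (Set.mem_univ x), h]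
  rfl

/-- Smooth division on the whole space yields only a smooth quotient c. Since E ∧ ⋅ raises the
Taylor degree by one, the degree k part of c at the origin is a quotient inside 𝕎^k. -/
theorem exists_wedgeEuler_eq {w : WW m (k + 1)} (hw : wedgeEuler m (k + 1) w = 0) :
    ∃ w' : WW m k, wedgeEuler m k w' = w := by
  have ht : (0 : ℝ) ∈ axisFiber (⊤ : Opens (Space m)) := Set.mem_univ _
  -- The condition on the axis is automatic: w is homogeneous in u of degree k + 1 > 0.
  obtain ⟨c, hc⟩ := exists_wE_eq (U := ⊤) (linearField_mem_horizontal w)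
    (by rw [wE_linearField, hw, linearField_zero]) fun _ t => by
      rw [linearField_apply w (Set.mem_univ _), ← apply_euler_of_mem_WW w.2,
        show euler ((t, 0) : Space m) = (0 : ℝ) • 0 from (smul_zero _).symm,
        apply_smul_of_mem_WW w.2, zero_pow (Nat.succ_ne_zero k), zero_smul]
  have hc' : wE ⊤ k (hor ⊤ k c) = linearField ⊤ w := by
    rw [wE_hor, hc, hor_of_mem (linearField_mem_horizontal w)]
  refine ⟨⟨_, taylorPart_mem_WW ⟨hor ⊤ k c, hor_mem c⟩ ht⟩, Subtype.ext (funext fun x => ?_)⟩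
  rw [← taylorPart_linearField w ht x, ← hc', taylorPart_wE _ ht]
  rfl

theorem pairWedgeEuler_eq_zero (hm : 0 < m) {w : WWPrev m 0 × WW m 0}
    (hw : pairWedgeEuler m 0 w = 0) : w = 0 := by
  refine Prod.ext (Subtype.ext w.1.2) (wedgeEuler_eq_zero hm ?_)
  exact neg_eq_zero.1 (congrArg Prod.snd hw)

theorem exact_pairWedgeEuler (m k : ℕ) (hm : 0 < m) :
    Function.Exact (pairWedgeEuler m k) (pairWedgeEuler m (k + 1)) := by
  refine fun w => ⟨fun hw => ?_, ?_⟩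
  · obtain ⟨w₂, h₂⟩ := exists_wedgeEuler_eq (neg_eq_zero.1 (congrArg Prod.snd hw))
    have h₁ : ∃ w₁, wedgeEulerPrev m k w₁ = w.1 := by
      have hw₁ : wedgeEuler m k w.1 = 0 := congrArg Prod.fst hw
      cases k with
      | zero => exact ⟨0, (map_zero _).trans (wedgeEuler_eq_zero hm hw₁).symm⟩
      | succ k => exact exists_wedgeEuler_eq hw₁
    obtain ⟨w₁, h₁⟩ := h₁
    refine ⟨(w₁, -w₂), Prod.ext h₁ ?_⟩
    change -wedgeEuler m k (-w₂) = w.2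
    rw [map_neg, neg_neg, h₂]
    rfl
  · rintro ⟨w, rfl⟩
    exact LinearMap.congr_fun (pairWedgeEuler_comp m k) w

/-! ### Derivatives on `𝓘` -/

theorem ddtSmooth_surjective {I : Opens ℝ} (hI : Convex ℝ (I : Set ℝ)) {t₀ : ℝ} (h₀ : t₀ ∈ I) :
    Function.Surjective (ddtSmooth I) := by
  intro f
  have hf : ContinuousOn f.1 I := (SmoothMaps.contDiffOn f).continuousOn
  have hder : ∀ t ∈ I, HasDerivAt (fun t => ∫ s in t₀..t, f.1 s) (f.1 t) t := by
    intro t ht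
    have hsub : Set.uIcc t₀ t ⊆ (I : Set ℝ) := by
      rw [← segment_eq_uIcc]
      exact hI.segment_subset h₀ ht
    exact intervalIntegral.integral_hasDerivAt_right (hf.mono hsub).intervalIntegrable
      (hf.stronglyMeasurableAtFilter I.isOpen t ht) (hf.continuousAt (I.isOpen.mem_nhds ht))
  have hF : ContDiffOn ℝ ∞ (fun t => ∫ s in t₀..t, f.1 s) I :=
    (contDiffOn_infty_iff_deriv_of_isOpen I.isOpen).2
      ⟨fun t ht => (hder t ht).differentiableAt.differentiableWithinAt,
        (SmoothMaps.contDiffOn f).congr fun t ht => (hder t ht).deriv⟩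
  refine ⟨SmoothMaps.mk I _ hF, SmoothMaps.ext fun t ht => ?_⟩
  refine (SmoothMaps.mk_apply (hf := (SmoothMaps.contDiffOn _).deriv_of_isOpen I.isOpen (by simp))
    ht).trans ?_
  refine (Filter.EventuallyEq.deriv_eq ?_).trans (hder t ht).deriv
  filter_upwards [I.isOpen.mem_nhds ht] with s hs using SmoothMaps.mk_apply hs

/-- Every linear functional of the value has zero derivative on the interval, and functionals
separate points of V. -/
theorem tensorEval_eq_of_rTensor_eq_zero {I : Opens ℝ} (hI : Convex ℝ (I : Set ℝ)) {V : Type}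
    [AddCommGroup V] [Module ℝ V] {z : SmoothMaps I ℝ ⊗[ℝ] V} (hz : (ddtSmooth I).rTensor V z = 0)
    {s t : ℝ} (hs : s ∈ I) (ht : t ∈ I) : tensorEval I V z s = tensorEval I V z t := by
  rw [← sub_eq_zero, ← Module.forall_dual_apply_eq_zero_iff ℝ]
  intro φ
  rw [map_sub, sub_eq_zero]
  have hd : ∀ r ∈ (I : Set ℝ), HasDerivAt (fun r => φ (tensorEval I V z r)) 0 r := by
    intro r hr
    have h := hasDerivAt_tensorEval φ z hr
    rwa [hz, map_zero, Pi.zero_apply, map_zero] at h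
  exact I.isOpen.is_const_of_deriv_eq_zero hI.isPreconnected
    (fun r hr => (hd r hr).differentiableAt.differentiableWithinAt)
    (fun r hr => (hd r hr).deriv) hs ht

/-! ### Classes of the model complex -/

/-- The field ∂_t ∧ w₁ + w₂ is closed because nothing depends on t and (E - k) w₂ = 0. Homogeneous
fields are their own Taylor parts, so its image is constant in t. -/
theorem exists_cocycle (U : Opens (Space m)) (w : WWPrev m k × WW m k) :
    ∃ μ : MultivectorField U k, bookDifferential U k μ = 0 ∧
      ∀ t ∈ axisFiber U, tensorEval _ _ (bigT U k μ) t = w := by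
  have hlin : ∀ {j : ℕ} (w : WW m j), bookDifferential U j (linearField U w) = 0 := fun w => by
    rw [bookDifferential_eq, dE_linearField, dT_linearField, sub_self, map_zero, map_zero, sub_zero]
  cases k with
  | zero =>
    refine ⟨linearField U w.2, hlin w.2, fun t ht => ?_⟩
    rw [tensorEval_bigT]
    refine Prod.ext (Subtype.ext ?_) (Subtype.ext (funext fun x => ?_))
    · exact Eq.trans (map_zero (tensorEval _ (WWPrev m 0)) ▸ rfl) w.1.2.symm
    · rw [tensorEval_taylor _ ht, uPart_zero, taylorPart_linearField w.2 ht]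
  | succ k =>
    obtain ⟨w₁, w₂⟩ := w
    change WW m k at w₁
    obtain ⟨ha, hb⟩ := parts_eq (U := U) (linearField_mem_horizontal w₁)
      (linearField_mem_horizontal w₂)
    refine ⟨wT U k (linearField U w₁) + linearField U w₂, ?_, fun t ht => ?_⟩
    · rw [map_add, hlin, bookDifferential_wT, dT_linearField, map_zero, map_zero, add_zero]
    · rw [tensorEval_bigT]
      refine Prod.ext (Subtype.ext (funext fun x => ?_)) (Subtype.ext (funext fun x => ?_))
      · refine (tensorEval_taylor (dtPart U (k + 1) _) ht x).trans ?_
        exact (congrArg (fun f : MultivectorField U k => taylorPart k f.1 (t, 0) (euler x)) ha).trans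
          (taylorPart_linearField w₁ ht x)
      · rw [tensorEval_taylor _ ht, hb, taylorPart_linearField w₂ ht]

theorem exists_cocycle_bigT_eq (hI : Convex ℝ (axisFiber U : Set ℝ)) {t₀ : ℝ}
    (h₀ : t₀ ∈ axisFiber U) {c : ModelCochains m (axisFiber U) k}
    (hc : (ddtSmooth _).rTensor _ c = 0) :
    ∃ μ : MultivectorField U k, bookDifferential U k μ = 0 ∧ bigT U k μ = c := by
  obtain ⟨μ, hμ, h⟩ := exists_cocycle U (tensorEval _ _ c t₀)
  exact ⟨μ, hμ, ext_tensorEval fun t ht => by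
    rw [h t ht, tensorEval_eq_of_rTensor_eq_zero hI hc h₀ ht]⟩

theorem exists_cocycle_bigT_eq_zero (hm : 0 < m) (hI : Convex ℝ (axisFiber U : Set ℝ)) {t₀ : ℝ}
    (h₀ : t₀ ∈ axisFiber U) {c : ModelCochains m (axisFiber U) 0}
    (hc : modelDifferential m (axisFiber U) 0 c = 0) :
    ∃ μ : MultivectorField U 0, bookDifferential U 0 μ = 0 ∧ bigT U 0 μ = c := by
  refine exists_cocycle_bigT_eq hI h₀ (ext_tensorEval fun t _ => ?_)
  rw [map_zero, Pi.zero_apply]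
  refine pairWedgeEuler_eq_zero hm ?_
  rw [← tensorEval_lTensor, ← modelDifferential_eq, hc, map_zero, Pi.zero_apply]

theorem exists_cocycle_eq_bigT_add (hm : 0 < m) (hI : Convex ℝ (axisFiber U : Set ℝ)) {t₀ : ℝ}
    (h₀ : t₀ ∈ axisFiber U) {c : ModelCochains m (axisFiber U) (k + 1)}
    (hc : modelDifferential m (axisFiber U) (k + 1) c = 0) :
    ∃ μ : MultivectorField U (k + 1), bookDifferential U (k + 1) μ = 0 ∧
      ∃ γ, c = bigT U (k + 1) μ + modelDifferential m (axisFiber U) k γ := by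
  have hsurj := ddtSmooth_surjective hI h₀
  rw [modelDifferential_eq] at hc
  -- Exactness of E ∧ ⋅ survives tensoring and gives ∂_t c = (E ∧) g. Integrating g twice to γ gives
  -- ∂_t(δγ) = (E ∧) ∂_t² γ = ∂_t c, so c - δγ is constant in t.
  obtain ⟨g, hg⟩ := (Module.Flat.lTensor_exact (SmoothMaps (axisFiber U) ℝ)
    (exact_pairWedgeEuler m k hm) _).1 hc
  obtain ⟨γ', hγ'⟩ := LinearMap.rTensor_surjective (WWPrev m k × WW m k) hsurj g
  obtain ⟨γ, hγ⟩ := LinearMap.rTensor_surjective (WWPrev m k × WW m k) hsurj γ'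
  obtain ⟨μ, hμ, h⟩ := exists_cocycle_bigT_eq hI h₀
    (c := c - modelDifferential m (axisFiber U) k γ) (by
      rw [map_sub, modelDifferential_eq, hγ, ← hg, sub_eq_zero, ← hγ', ← LinearMap.comp_apply,
        ← LinearMap.comp_apply, LinearMap.lTensor_comp_rTensor, LinearMap.rTensor_comp_lTensor])
  exact ⟨μ, hμ, γ, by rw [h, sub_add_cancel]⟩

/-- The Taylor part of a cocycle with exact image is annihilated by `E ∧ ⋅`. -/
theorem pairWedgeEuler_tensorEval_eq_zero {I : Opens ℝ} (γ : ModelCochains m I k) (t : ℝ) :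
    pairWedgeEuler m (k + 1) (tensorEval _ _ (modelDifferential m I k γ) t) = 0 := by
  rw [modelDifferential_eq, tensorEval_lTensor]
  exact LinearMap.congr_fun (pairWedgeEuler_comp m k) _

/-- Exactness of the image is used only through E ∧ ⋅ killing both Taylor parts at the single point
t₀; this suffices because E ∧ b and, after removing b, E ∧ a are independent of t. -/
theorem exists_bookDifferential_eq_of_bigT_eq (hm : 0 < m)
    (hconv : ∀ u : Fin m → ℝ, Convex ℝ {t : ℝ | (t, u) ∈ U})
    (hstar : StarConvex ℝ 0 (projImage U : Set (Fin m → ℝ))) {t₀ : ℝ} (h₀ : t₀ ∈ axisFiber U)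
    {μ : MultivectorField U (k + 1)} (hμ : bookDifferential U (k + 1) μ = 0)
    {γ : ModelCochains m (axisFiber U) k}
    (h : bigT U (k + 1) μ = modelDifferential m (axisFiber U) k γ) :
    ∃ ν : MultivectorField U k, bookDifferential U k ν = μ := by
  have h1 := pairWedgeEuler_tensorEval_eq_zero γ t₀
  rw [← h, tensorEval_bigT] at h1
  refine exists_bookDifferential_eq hm hconv hstar hμ h₀ (fun x => ?_) fun x => ?_
  · rw [← tensorEval_taylor (uPart U (k + 1) μ) h₀]
    have h2 := congrArg (fun w => w.1 x) (neg_eq_zero.1 (congrArg Prod.snd h1))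
    exact h2
  · have h2 := congrArg (fun w => w.1 x) (congrArg Prod.fst h1)
    exact (congrArg (wedge (euler x)) (tensorEval_taylor (dtPart U (k + 1) μ) h₀ x)).symm.trans h2

theorem eq_zero_of_bigT_eq_zero (hm : 0 < m)
    (hconv : ∀ u : Fin m → ℝ, Convex ℝ {t : ℝ | (t, u) ∈ U})
    (hstar : StarConvex ℝ 0 (projImage U : Set (Fin m → ℝ))) {t₀ : ℝ} (h₀ : t₀ ∈ axisFiber U)
    {μ : MultivectorField U 0} (hμ : bookDifferential U 0 μ = 0) (h : bigT U 0 μ = 0) : μ = 0 := by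
  refine eq_zero_of_cocycle_zero hm hconv hstar hμ h₀ fun x => ?_
  have h1 := tensorEval_bigT μ t₀
  rw [h, map_zero] at h1
  have h2 : tensorEval _ _ (taylor U 0 (uPart U 0 μ)) t₀ = 0 := (congrArg Prod.snd h1).symm
  rw [← tensorEval_taylor (uPart U 0 μ) h₀, h2]
  exact map_zero _

/-- The Taylor map is a quasi-isomorphism and the cohomology in degree `m + 1` vanishes. -/
theorem quasiIso_bigT_and_isZero_homology (hm : 0 < m) (hne : (U : Set (Space m)).Nonempty)
    (hfib : ∀ u : Fin m → ℝ, IsPreconnected ((U : Set (Space m)) ∩ Prod.snd ⁻¹' {u}))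
    (hstar : StarConvex ℝ 0 (Prod.snd '' (U : Set (Space m)))) :
    QuasiIso (cochainMap (hd := bookDifferential_comp U)
      (he := modelDifferential_comp m (axisFiber U)) (bigT U) (modelDifferential_comp_bigT U)) ∧
      Limits.IsZero ((cochainComplex (bookDifferential U) (bookDifferential_comp U)).homology
        (m + 1)) := by
  have hconv : ∀ u : Fin m → ℝ, Convex ℝ {t : ℝ | (t, u) ∈ U} := fun u =>
    convex_fiber u (hfib u)
  have hstar' : StarConvex ℝ 0 (projImage U : Set (Fin m → ℝ)) := hstar
  -- A nonempty star-shaped set contains its center, so U meets the axis.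
  obtain ⟨t₀, h₀⟩ : ∃ t₀ : ℝ, t₀ ∈ axisFiber U :=
    exists_of_mem_projImage (hstar.mem (hne.image _))
  have hI : Convex ℝ (axisFiber U : Set ℝ) := hconv 0
  constructor
  · exact quasiIso_cochainMap _ _
      (fun μ hμ h => eq_zero_of_bigT_eq_zero hm hconv hstar' h₀ hμ h)
      (fun k μ hμ γ h =>
        exists_bookDifferential_eq_of_bigT_eq hm hconv hstar' h₀ hμ h)
      (fun c hc => exists_cocycle_bigT_eq_zero hm hI h₀ hc)
      (fun k c hc => exists_cocycle_eq_bigT_add hm hI h₀ hc)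
  · exact isZero_homology_cochainComplex_succ m fun μ _ =>
      exists_bookDifferential_eq_top hm hconv μ

end LinearFields

end BookPoisson

end

theorem proposition3p3 (n : ℕ) (hn : 2 ≤ n) (U : TopologicalSpace.Opens (BookPoisson.Space (n - 1)))
    (hne : (U : Set (BookPoisson.Space (n - 1))).Nonempty)
    (hfib : ∀ u : Fin (n - 1) → ℝ,
      IsPreconnected ((U : Set (BookPoisson.Space (n - 1))) ∩ Prod.snd ⁻¹' {u}))
    (hstar : StarConvex ℝ 0 (Prod.snd '' (U : Set (BookPoisson.Space (n - 1))))) :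
    ∃ (hd : ∀ k, BookPoisson.bookDifferential U (k + 1) ∘ₗ BookPoisson.bookDifferential U k = 0)
      (hδ : ∀ k, BookPoisson.modelDifferential (n - 1) (BookPoisson.axisFiber U) (k + 1) ∘ₗ
        BookPoisson.modelDifferential (n - 1) (BookPoisson.axisFiber U) k = 0)
      (hT : ∀ k, BookPoisson.modelDifferential (n - 1) (BookPoisson.axisFiber U) k ∘ₗ
        BookPoisson.bigT U k = BookPoisson.bigT U (k + 1) ∘ₗ BookPoisson.bookDifferential U k),
      QuasiIso (BookPoisson.cochainMap (hd := hd) (he := hδ) (BookPoisson.bigT U) hT) ∧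
        CategoryTheory.Limits.IsZero
          ((BookPoisson.cochainComplex (BookPoisson.bookDifferential U) hd).homology n) := by
  obtain ⟨m, rfl⟩ : ∃ m, n = m + 1 := ⟨n - 1, by omega⟩
  have hm : 0 < m := by omega
  exact ⟨BookPoisson.bookDifferential_comp U, BookPoisson.modelDifferential_comp _ _,
    BookPoisson.modelDifferential_comp_bigT U,
    BookPoisson.quasiIso_bigT_and_isZero_homology hm hne hfib hstar⟩
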